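/- Let $H$ be a (real) Lie group acting smoothly on a smooth manifold $M$, and let $\chi\colon H\to\mathbb C^\times$ be a character, i.e. a continuous homomorphism. For an open set $U\subseteq M$, a generalized function on $U$ is a continuous linear functional on the space of compactly supported smooth (complex) densities on $U$, with its inductive smooth topology. It is $\chi$-equivariant if $f(hx)=\chi(h)f(x)$ for all $h\in H$. For a locally closed $H$-stable set $Z\subseteq M$, let $C^{-\infty}_\chi(M;Z)$ be the space of $\chi$-equivariant generalized functions $f$ with $\operatorname{supp} f\subseteq Z$ on an open set $U\subseteq M$ that contains $Z$ as a closed subset (this does not depend on $U$). For a differential operator $D$ on $M$, let $C^{-\infty}_\chi(M;Z;D)$ be the subspace of those $f$ with $Df=0$. Submanifolds are locally closed. A *local $H$ slice* of an $H$-stable submanifold $Z$ is a submanifold $\mathfrak Z\subseteq Z$ such that the action map $H\times\mathfrak Z\to Z$ is a submersion. An $H$-stable submanifold $Z$ of $M$ is *unipotently $\chi$-incompatible* if for every $z_0\in Z$ there are a local $H$ slice $\mathfrak Z$ of $Z$ containing $z_0$ and a smooth map $\phi\colon\mathfrak Z\to H$ such that for all $z\in\mathfrak Z$: (a) $\phi(z)z=z$;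 (b) the linear endomorphism of $T_z(M)/T_z(Z)$ induced by the action of $\phi(z)$ is unipotent; (c) $\chi(\phi(z))\neq1$. If $M$ is equipped with a pseudo-Riemannian metric $\langle\,,\rangle$, a submanifold $Z$ is *metrically proper* if for every $z\in Z$ the space $T_z(Z)$ is contained in a proper nondegenerate subspace of $T_z(M)$. A differential operator $D$ of order at most $2$ on $M$ is *of Laplacian type* if for every $x\in M$ its principal symbol is $\sigma_2(D)(x)=\sum_i u_iv_i$, where $(u_i)$ is a basis of $T_x(M)$ and $(v_i)$ is its dual basis in $T_x(M)$ with respect to $\langle\,,\rangle_x$. An $H$-stable locally closed set $Z\subseteq M$ has the *$\mathrm U_\chi\mathrm M$ property* if there is a finite filtration $Z=Z_0\supset Z_1\supset\dots\supset Z_k\supset Z_{k+1}=\emptyset$ by $H$-stable closed subsets of $Z$ such that each $Z_i\setminus Z_{i+1}$ is a submanifold of $M$ which is either unipotently $\chi$-incompatible or metrically proper. **Theorem.** (1) If $Z$ is an $H$-stable submanifold of $M$ which is unipotently $\chi$-incompatible, then $C^{-\infty}_\chi(M;Z)=0$. (2) Assume that $M$ is pseudo-Riemannian. If $D$ is a differential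 operator on $M$ of Laplacian type and $Z$ is an $H$-stable closed subset of $M$ with the $\mathrm U_\chi\mathrm M$ property, then $C^{-\infty}_\chi(M;Z;D)=0$. -/

import Mathlib

open scoped Manifold ContDiff Topology
open Set Filter MeasureTheory TopologicalSpace

namespace EquivGenFun

/-- The model space `ℝ^m`. -/
abbrev Eu (m : ℕ) : Type := EuclideanSpace ℝ (Fin m)

/-! ### Densities and generalized functions -/

section GeneralizedFunctions

variable (m : ℕ) {M : Type*} [TopologicalSpace M] [ChartedSpace (Eu m) M]

/-- The differential of `φ` at `y`, read on `ℝ^m`: `TangentSpace (𝓡 m) x` is by definition `ℝ^m` for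
every `x`, through the preferred chart at `x`. -/
noncomputable def modelDeriv (m : ℕ) {N M : Type*} [TopologicalSpace N] [ChartedSpace (Eu m) N]
    [TopologicalSpace M] [ChartedSpace (Eu m) M] (φ : N → M) (y : N) : Eu m →L[ℝ] Eu m :=
  mfderiv (𝓡 m) (𝓡 m) φ y

/-- A density on `M` is recorded by the function `ρ : M → ℂ` whose value at `x` is the value of the
density on the standard frame of `T_x M = ℝ^m` (the identification given by the preferred chart
at `x`).  With this convention the pull-back of `ρ` under a local diffeomorphism `φ : N → M` is
`y ↦ |det dφ_y| ρ (φ y)`. -/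
noncomputable def pullDensity (m : ℕ) {N M : Type*} [TopologicalSpace N] [ChartedSpace (Eu m) N]
    [TopologicalSpace M] [ChartedSpace (Eu m) M] (φ : N → M) (ρ : M → ℂ) (y : N) : ℂ :=
  ((|(modelDeriv m φ y).det| : ℝ) : ℂ) * ρ (φ y)

/-- The coefficient of the density `ρ` with respect to Lebesgue measure in the preferred chart
at `c`. -/
noncomputable def densityInChart (c : M) (ρ : M → ℂ) : Eu m → ℂ :=
  letI : ChartedSpace (Eu m) (Eu m) := chartedSpaceSelf _
  pullDensity m (chartAt (Eu m) c).symm ρ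

/-- A density is smooth if its coefficients in charts are smooth. -/
def IsSmoothDensity (ρ : M → ℂ) : Prop :=
  ∀ c : M, ContDiffOn ℝ ∞ (densityInChart m c ρ) (chartAt (Eu m) c).target

theorem pullDensity_add {N : Type*} [TopologicalSpace N] [ChartedSpace (Eu m) N]
    (φ : N → M) (ρ ρ' : M → ℂ) :
    pullDensity m φ (ρ + ρ') = pullDensity m φ ρ + pullDensity m φ ρ' := by
  funext y; simp [pullDensity, mul_add]

theorem pullDensity_smul {N : Type*} [TopologicalSpace N] [ChartedSpace (Eu m) N]
    (φ : N → M) (c : ℂ) (ρ : M → ℂ) :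
    pullDensity m φ (c • ρ) = c • pullDensity m φ ρ := by
  funext y; simp [pullDensity]; ring

/-- The space of smooth densities with compact support contained in the open set `U`. -/
def testDensity (U : Opens M) : Submodule ℂ (M → ℂ) where
  carrier := {ρ | IsSmoothDensity m ρ ∧ HasCompactSupport ρ ∧ tsupport ρ ⊆ U}
  add_mem' := by
    rintro ρ ρ' ⟨h1, h2, h3⟩ ⟨h1', h2', h3'⟩
    refine ⟨fun c => ?_, h2.add h2', (tsupport_add ρ ρ').trans (union_subset h3 h3')⟩
    rw [densityInChart, pullDensity_add]
    exact (h1 c).add (h1' c)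
  zero_mem' := by
    refine ⟨fun c => ?_, HasCompactSupport.zero, by simp [tsupport]⟩
    have : densityInChart m c (0 : M → ℂ) = fun _ => 0 := by
      funext y; simp [densityInChart, pullDensity]
    rw [this]
    exact contDiffOn_const
  smul_mem' := by
    rintro a ρ ⟨h1, h2, h3⟩
    refine ⟨fun c => ?_, ?_, ?_⟩
    · rw [densityInChart, pullDensity_smul]
      exact (h1 c).const_smul a
    · exact h2.smul_left (f := fun _ => a)
    · exact (closure_mono (Function.support_const_smul_subset a ρ)).trans h3

variable {m}

/-- Continuity of a linear functional on the compactly supported smooth densities on `U` for the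
inductive smooth topology: on the densities supported in a fixed compact subset of a chart domain,
the functional is bounded by finitely many derivatives of the coefficient.  (By partitions of unity
it is enough to consider compact sets inside one chart domain.) -/
def IsContinuousFunctional {U : Opens M} (u : Module.Dual ℂ (testDensity m U)) : Prop :=
  ∀ (c : M) (K : Set (Eu m)), IsCompact K → K ⊆ (chartAt (Eu m) c).target →
    (chartAt (Eu m) c).symm '' K ⊆ U →
    ∃ (C : ℝ) (N : ℕ), ∀ ρ : testDensity m U,
      tsupport (ρ : M → ℂ) ⊆ (chartAt (Eu m) c).symm '' K →
      ∀ B : ℝ, 0 ≤ B → (∀ j ≤ N, ∀ y ∈ K, ‖iteratedFDeriv ℝ j (densityInChart m c (ρ : M → ℂ)) y‖ ≤ B) →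
        ‖u ρ‖ ≤ C * B

/-- The space of generalized functions on the open set `U`: continuous linear functionals on the
compactly supported smooth densities on `U`. -/
def genFun (m : ℕ) {M : Type*} [TopologicalSpace M] [ChartedSpace (Eu m) M] (U : Opens M) : Submodule ℂ (Module.Dual ℂ (testDensity m U)) where
  carrier := {u | IsContinuousFunctional u}
  add_mem' := by
    intro u v hu hv c K hK hKt hKU
    obtain ⟨C, N, h⟩ := hu c K hK hKt hKU
    obtain ⟨C', N', h'⟩ := hv c K hK hKt hKU
    refine ⟨C + C', max N N', fun ρ hρ B hB0 hB => ?_⟩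
    have e1 := h ρ hρ B hB0 fun j hj => hB j (hj.trans (le_max_left _ _))
    have e2 := h' ρ hρ B hB0 fun j hj => hB j (hj.trans (le_max_right _ _))
    calc ‖(u + v) ρ‖ ≤ ‖u ρ‖ + ‖v ρ‖ := norm_add_le _ _
      _ ≤ (C + C') * B := by linarith
  zero_mem' := by
    intro c K _ _ _
    exact ⟨0, 0, fun ρ _ B _ _ => by simp⟩
  smul_mem' := by
    intro a u hu c K hK hKt hKU
    obtain ⟨C, N, h⟩ := hu c K hK hKt hKU
    refine ⟨‖a‖ * C, N, fun ρ hρ B hB0 hB => ?_⟩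
    calc ‖(a • u) ρ‖ = ‖a‖ * ‖u ρ‖ := by simp
      _ ≤ ‖a‖ * (C * B) := mul_le_mul_of_nonneg_left (h ρ hρ B hB0 hB) (norm_nonneg a)
      _ = ‖a‖ * C * B := by ring

/-- `supp u ⊆ Z`, for `Z` relatively closed in `U`: `u` vanishes on `U \ Z`. -/
def IsSupportedIn {U : Opens M} (u : Module.Dual ℂ (testDensity m U)) (Z : Set M) : Prop :=
  ∀ ρ : testDensity m U, Disjoint (tsupport (ρ : M → ℂ)) Z → u ρ = 0

/-- The generalized function `u` satisfies `u (h x) = χ h * u x` for all `h`.  Since generalized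
functions are pulled back by transposing the push-forward of densities, and the push-forward under
`x ↦ h x` is the pull-back under `x ↦ h⁻¹ x`, this reads `u (h_* ρ) = χ h * u ρ`.  If `U` is not
stable, only those `ρ` are tested for which `ρ` and `h_* ρ` are both supported in `U`. -/
def IsEquivariant {H : Type*} [Group H] [MulAction H M] (χ : H →* ℂˣ) {U : Opens M}
    (u : Module.Dual ℂ (testDensity m U)) : Prop :=
  ∀ (h : H) (ρ ρ' : testDensity m U),
    (ρ' : M → ℂ) = pullDensity m (fun x : M => h⁻¹ • x) (ρ : M → ℂ) → u ρ' = (χ h : ℂ) * u ρ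

/-- The space of `χ`-equivariant generalized functions on `U` with support in `Z`. -/
def equivariantSupported (m : ℕ) {M : Type*} [TopologicalSpace M] [ChartedSpace (Eu m) M]
    {H : Type*} [Group H] [MulAction H M] (χ : H →* ℂˣ) (U : Opens M)
    (Z : Set M) : Submodule ℂ (Module.Dual ℂ (testDensity m U)) where
  carrier := {u | u ∈ genFun m U ∧ IsSupportedIn u Z ∧ IsEquivariant χ u}
  add_mem' := by
    rintro u v ⟨h1, h2, h3⟩ ⟨h1', h2', h3'⟩
    refine ⟨add_mem h1 h1', fun ρ hρ => ?_, fun h ρ ρ' e => ?_⟩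
    · simp [h2 ρ hρ, h2' ρ hρ]
    · simp [h3 h ρ ρ' e, h3' h ρ ρ' e, mul_add]
  zero_mem' := ⟨zero_mem _, fun _ _ => rfl, fun _ _ _ _ => by simp⟩
  smul_mem' := by
    rintro a u ⟨h1, h2, h3⟩
    refine ⟨(genFun m U).smul_mem a h1, fun ρ hρ => ?_, fun h ρ ρ' e => ?_⟩
    · simp [h2 ρ hρ]
    · simp [h3 h ρ ρ' e]; ring

end GeneralizedFunctions

/-! ### Differential operators -/

section DifferentialOperators

variable {m : ℕ} {M : Type*} [TopologicalSpace M] [ChartedSpace (Eu m) M]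

/-- Smooth complex valued functions on `M`. -/
abbrev SmoothFun (m : ℕ) (M : Type*) [TopologicalSpace M] [ChartedSpace (Eu m) M] : Type _ :=
  ContMDiffMap (𝓡 m) 𝓘(ℝ, ℂ) M ℂ ∞

/-- Differential operators of order at most `k` on `M`, with smooth complex coefficients. -/
structure DiffOp (m : ℕ) (M : Type*) [TopologicalSpace M] [ChartedSpace (Eu m) M] (k : ℕ) where
  /-- The action on smooth functions. -/
  toFun : SmoothFun m M → SmoothFun m M
  /-- In every chart, the operator is a finite sum of terms
  `a_{i₁…iⱼ} ∂_{i₁} ⋯ ∂_{iⱼ}`, with `j ≤ k` and smooth coefficients. -/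
  local_form : ∀ c : M, ∃ a : (j : ℕ) → (Fin j → Fin m) → Eu m → ℂ,
    (∀ j ≤ k, ∀ i, ContDiffOn ℝ ∞ (a j i) (chartAt (Eu m) c).target) ∧
    ∀ f : SmoothFun m M, ∀ y ∈ (chartAt (Eu m) c).target,
      toFun f ((chartAt (Eu m) c).symm y) =
        ∑ j ∈ Finset.range (k + 1), ∑ i : Fin j → Fin m,
          a j i y * iteratedFDeriv ℝ j (fun w => f ((chartAt (Eu m) c).symm w)) y
            (fun l => EuclideanSpace.single (i l) (1 : ℝ))

/-- The smooth function `p ↦ (f p - f x) ^ k`. -/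
noncomputable def devPow (x : M) (f : SmoothFun m M) (k : ℕ) : SmoothFun m M :=
  ⟨fun p => (f p - f x) ^ k, by
    have h : ContDiff ℝ ∞ (fun z : ℂ => (z - f x) ^ k) :=
      (contDiff_id.sub contDiff_const).pow k
    exact h.contMDiff.comp f.contMDiff⟩

/-- The differential `df_x : T_x M → ℂ`. -/
noncomputable def differential (x : M) (f : SmoothFun m M) : TangentSpace (𝓡 m) x →L[ℝ] ℂ :=
  mfderiv (𝓡 m) 𝓘(ℝ, ℂ) f x

/-- The principal symbol of order `k` of `D` at `x`, a homogeneous polynomial of degree `k` on the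
complexified cotangent space, evaluated at the covector `df_x`.  If `D = X₁ ⋯ Xₖ` for vector fields
`Xᵢ`, then it is equal to `∏ᵢ df_x (Xᵢ)`. -/
noncomputable def DiffOp.symbol {k : ℕ} (D : DiffOp m M k) (x : M) (f : SmoothFun m M) : ℂ :=
  ((Nat.factorial k : ℕ) : ℂ)⁻¹ * D.toFun (devPow x f k) x

/-- The integral `∫_M f ρ`, for a density `ρ` supported in the domain of the
preferred chart at `c`. -/
noncomputable def integralInChart (m : ℕ) {M : Type*} [TopologicalSpace M] [ChartedSpace (Eu m) M] (c : M)
    (f : M → ℂ) (ρ : M → ℂ) : ℂ :=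
  ∫ y in (chartAt (Eu m) c).target, f ((chartAt (Eu m) c).symm y) * densityInChart m c ρ y

/-- `ρ'` is the image of `ρ` under the transpose of `D`, i.e. `∫ (D f) ρ = ∫ f ρ'` for all smooth
functions `f`; both densities are supported in the domain of the preferred chart at `c`. -/
def DiffOp.IsTranspose {k : ℕ} (D : DiffOp m M k) (c : M) (ρ ρ' : M → ℂ) : Prop :=
  ∀ f : SmoothFun m M, integralInChart m c (D.toFun f) ρ = integralInChart m c f ρ'

/-- `v = D u` for generalized functions `u`, `v` on `U`, where the action of `D` on generalized
functions is the transpose of its formal transpose on densities (equivalently, the continuous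
extension of its action on smooth functions).  Since differential operators are local, it is enough
to test on densities supported in a chart domain. -/
def DiffOp.Maps {k : ℕ} (D : DiffOp m M k) {U : Opens M}
    (u v : Module.Dual ℂ (testDensity m U)) : Prop :=
  ∀ (c : M) (ρ ρ' : testDensity m U),
    tsupport (ρ : M → ℂ) ⊆ (chartAt (Eu m) c).source →
    tsupport (ρ' : M → ℂ) ⊆ (chartAt (Eu m) c).source →
    D.IsTranspose c ρ ρ' → v ρ = u ρ'

/-- The space of `χ`-equivariant generalized functions `u` on `U` with support in `Z` such that
`D u = 0`. -/
def equivariantSupportedKilled {H : Type*} [Group H] [MulAction H M] (χ : H →* ℂˣ) (U : Opens M)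
    (Z : Set M) {k : ℕ} (D : DiffOp m M k) :
    Submodule ℂ (Module.Dual ℂ (testDensity m U)) where
  carrier := {u | u ∈ equivariantSupported m χ U Z ∧ D.Maps u 0}
  add_mem' := by
    rintro u v ⟨h1, h2⟩ ⟨h1', h2'⟩
    refine ⟨add_mem h1 h1', fun c ρ ρ' s s' t => ?_⟩
    have e := h2 c ρ ρ' s s' t
    have e' := h2' c ρ ρ' s s' t
    simp only [LinearMap.zero_apply] at e e'
    simp [← e, ← e']
  zero_mem' := ⟨zero_mem _, fun _ _ _ _ _ _ => rfl⟩
  smul_mem' := by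
    rintro a u ⟨h1, h2⟩
    refine ⟨(equivariantSupported m χ U Z).smul_mem a h1, fun c ρ ρ' s s' t => ?_⟩
    have e := h2 c ρ ρ' s s' t
    simp only [LinearMap.zero_apply] at e
    simp [← e]

end DifferentialOperators

/-! ### Submanifolds, slices and unipotent incompatibility -/

section Submanifolds

variable {m : ℕ} {M : Type*} [TopologicalSpace M] [ChartedSpace (Eu m) M]

/-- `Z` is a (locally closed, embedded) smooth submanifold of `M`: around each of its points there
is a chart of `M` in which `Z` is a linear subspace. -/
def IsSubmanifold (m : ℕ) {M : Type*} [TopologicalSpace M] [ChartedSpace (Eu m) M]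
    (Z : Set M) : Prop :=
  ∀ z ∈ Z, ∃ e ∈ IsManifold.maximalAtlas (𝓡 m) ∞ M, z ∈ e.source ∧
    ∃ W : Submodule ℝ (Eu m), ∀ x ∈ e.source, x ∈ Z ↔ e x ∈ W

/-- The tangent space `T_z Z` of a submanifold `Z`, as a subspace of `T_z M`: it is generated by
the velocity vectors of smooth curves in `Z`.  (Tangent vectors at the equal points `γ 0` and `z` are
compared as elements of `ℝ^m`.) -/
noncomputable def tangentOf (m : ℕ) {M : Type*} [TopologicalSpace M] [ChartedSpace (Eu m) M]
    (Z : Set M) (z : M) : Submodule ℝ (TangentSpace (𝓡 m) z) :=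
  Submodule.span ℝ {v | ∃ γ : ℝ → M, γ 0 = z ∧ ContMDiffAt 𝓘(ℝ, ℝ) (𝓡 m) ∞ γ 0 ∧
    (∀ᶠ t in 𝓝 (0 : ℝ), γ t ∈ Z) ∧
    (mfderiv 𝓘(ℝ, ℝ) (𝓡 m) γ 0 (1 : ℝ) : Eu m) = (v : Eu m)}

/-- `Z` is stable under `H`. -/
def IsStable (H : Type*) [SMul H M] (Z : Set M) : Prop :=
  ∀ h : H, ∀ z ∈ Z, h • z ∈ Z

variable {d : ℕ} {H : Type*} [Group H] [TopologicalSpace H] [ChartedSpace (Eu d) H] [MulAction H M]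

/-- The differential at `z` of the action of `h`, as a linear map `T_z M → T_{hz} M`. -/
noncomputable def actionDeriv (m : ℕ) {M : Type*} [TopologicalSpace M] [ChartedSpace (Eu m) M]
    {H : Type*} [Group H] [MulAction H M] (h : H) (z : M) :
    TangentSpace (𝓡 m) z →ₗ[ℝ] TangentSpace (𝓡 m) (h • z) :=
  (mfderiv (𝓡 m) (𝓡 m) (fun x : M => h • x) z).toLinearMap

/-- The differential at `h` of the orbit map `h ↦ h z`, as a linear map `T_h H → T_{hz} M`. -/
noncomputable def orbitDeriv (d m : ℕ) {M : Type*} [TopologicalSpace M] [ChartedSpace (Eu m) M]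
    {H : Type*} [Group H] [TopologicalSpace H] [ChartedSpace (Eu d) H] [MulAction H M]
    (h : H) (z : M) : TangentSpace (𝓡 d) h →ₗ[ℝ] TangentSpace (𝓡 m) (h • z) :=
  (mfderiv (𝓡 d) (𝓡 m) (fun k : H => k • z) h).toLinearMap

/-- `S` is a local `H` slice of the `H` stable submanifold `Z`: it is a submanifold contained in
`Z`, and the action map `H × S → Z` is a submersion, i.e. for `h ∈ H` and `z ∈ S` its differential
`T_h H × T_z S → T_{hz} Z` is onto. -/
def IsLocalSlice (d m : ℕ) {M : Type*} [TopologicalSpace M] [ChartedSpace (Eu m) M]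
    (H : Type*) [Group H] [TopologicalSpace H] [ChartedSpace (Eu d) H] [MulAction H M]
    (Z S : Set M) : Prop :=
  S ⊆ Z ∧ IsSubmanifold m S ∧
    ∀ h : H, ∀ z ∈ S,
      LinearMap.range (orbitDeriv d m h z) ⊔ (tangentOf m S z).map (actionDeriv m h z) =
        tangentOf m Z (h • z)

/-- If `h z = z`, the endomorphism of `T_z M` induced by `h` (the spaces `T_{hz} M` and `T_z M` are
both `ℝ^m`, through the same chart). -/
noncomputable def isotropy (m : ℕ) {M : Type*} [TopologicalSpace M] [ChartedSpace (Eu m) M]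
    {H : Type*} [Group H] [MulAction H M] (h : H) (z : M) (_hz : h • z = z) :
    TangentSpace (𝓡 m) z →ₗ[ℝ] TangentSpace (𝓡 m) z :=
  (modelDeriv m (fun x : M => h • x) z).toLinearMap

/-- The `H` stable submanifold `Z` of `M` is unipotently `χ`-incompatible. -/
def UnipotentlyIncompatible (d m : ℕ) {M : Type*} [TopologicalSpace M] [ChartedSpace (Eu m) M]
    {H : Type*} [Group H] [TopologicalSpace H] [ChartedSpace (Eu d) H] [MulAction H M]
    (χ : H →* ℂˣ) (Z : Set M) : Prop :=
  ∀ z₀ ∈ Z, ∃ S : Set M, z₀ ∈ S ∧ IsLocalSlice d m H Z S ∧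
    ∃ φ : M → H, ContMDiffOn (𝓡 m) (𝓡 d) ∞ φ S ∧
      ∀ z ∈ S,
        -- `φ z` fixes `z`, and acts unipotently on `T_z M / T_z Z`
        (∃ hz : φ z • z = z,
          ∃ hT : tangentOf m Z z ≤ (tangentOf m Z z).comap (isotropy m (φ z) z hz),
            IsNilpotent ((tangentOf m Z z).mapQ (tangentOf m Z z) (isotropy m (φ z) z hz) hT - 1)) ∧
        χ (φ z) ≠ 1

end Submanifolds

/-! ### Pseudo-Riemannian metrics, Laplacian type operators, metrical properness -/

section Metric

/-- A pseudo-Riemannian metric on `M`: a smooth family of nondegenerate symmetric bilinear forms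
on the tangent spaces. -/
structure PseudoRiemannianMetric (m : ℕ) (M : Type*) [TopologicalSpace M] [ChartedSpace (Eu m) M]
    [IsManifold (𝓡 m) ∞ M] where
  /-- The bilinear form on the tangent space. -/
  form (x : M) : TangentSpace (𝓡 m) x →L[ℝ] TangentSpace (𝓡 m) x →L[ℝ] ℝ
  symm (x : M) (v w : TangentSpace (𝓡 m) x) : form x v w = form x w v
  nondegenerate (x : M) (v : TangentSpace (𝓡 m) x) : (∀ w, form x v w = 0) → v = 0
  smooth : ContMDiff (𝓡 m) ((𝓡 m).prod 𝓘(ℝ, Eu m →L[ℝ] Eu m →L[ℝ] ℝ)) ∞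
    (fun x => Bundle.TotalSpace.mk' (Eu m →L[ℝ] Eu m →L[ℝ] ℝ)
      (E := fun x : M => TangentSpace (𝓡 m) x →L[ℝ] TangentSpace (𝓡 m) x →L[ℝ] ℝ) x (form x))

variable {m : ℕ} {M : Type*} [TopologicalSpace M] [ChartedSpace (Eu m) M] [IsManifold (𝓡 m) ∞ M]

/-- `Z` is metrically proper: each `T_z Z` is contained in a proper subspace of `T_z M` on which
the form is nondegenerate. -/
def MetricallyProper (g : PseudoRiemannianMetric m M) (Z : Set M) : Prop :=
  ∀ z ∈ Z, ∃ W : Submodule ℝ (TangentSpace (𝓡 m) z), tangentOf m Z z ≤ W ∧ W ≠ ⊤ ∧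
    ∀ v ∈ W, (∀ w ∈ W, g.form z v w = 0) → v = 0

/-- A differential operator of order at most two is of Laplacian type if its principal symbol at
each `x` is `∑ᵢ uᵢ vᵢ`, for a basis `u` of `T_x M` and its dual basis `v` with respect to the
form. -/
def IsLaplacianType (g : PseudoRiemannianMetric m M) (D : DiffOp m M 2) : Prop :=
  ∀ x : M, ∃ u v : Module.Basis (Fin m) ℝ (TangentSpace (𝓡 m) x),
    (∀ i j, g.form x (u i) (v j) = if i = j then 1 else 0) ∧
    ∀ f : SmoothFun m M, D.symbol x f =
      ∑ i, differential x f (u i) * differential x f (v i)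

/-- The `U_χ M` property of an `H` stable locally closed subset `Z` of `M`. -/
def HasUChiM {d : ℕ} {H : Type*} [Group H] [TopologicalSpace H] [ChartedSpace (Eu d) H]
    [MulAction H M] (χ : H →* ℂˣ) (g : PseudoRiemannianMetric m M) (Z : Set M) : Prop :=
  IsStable H Z ∧ IsLocallyClosed Z ∧
  ∃ (k : ℕ) (F : ℕ → Set M), F 0 = Z ∧ F (k + 1) = ∅ ∧
    ∀ i ≤ k, F (i + 1) ⊆ F i ∧ IsStable H (F i) ∧ (∃ C, IsClosed C ∧ F i = Z ∩ C) ∧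
      IsSubmanifold m (F i \ F (i + 1)) ∧
      (UnipotentlyIncompatible d m χ (F i \ F (i + 1)) ∨ MetricallyProper g (F i \ F (i + 1)))

end Metric

end EquivGenFun

open EquivGenFun

/-! Both statements are local: by a partition of unity (`eq_zero_of_locally`) it suffices that `u`
kills all densities supported near a given point of `Z`. In a chart, `u` becomes a functional `f` on
smooth functions which has finite order on a ball and is supported in the zero set of a normal
coordinate `q`. Such an `f` kills every function that is homogeneous of degree `N + 1` in `q`, with
smooth coefficients, once `N` bounds its order (`FiniteOrderOn.exists_kills`). Each part lowers this
degree to zero by descending induction.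

Part (1). Take a chart flattening `Z` to a subspace `W`, the kernel of a projection `Q`. Points of
`Z` near `z₀` are `h(y) s(y)` with `s(y)` in the slice (`exists_slice_section`), so `τ(y) = h(y)
φ(s(y)) h(y)⁻¹` fixes `y`. The map `T(y) = τ(y) y` then fixes `W` pointwise, and its differential
along `W` is unipotent. Although the group element depends on the point, `f` is still multiplied by
the function `χ(τ(y))` under `T` (`LocallyEquivariant.transform_graph`): `T` is embedded in a family
of such maps, and averages over the family can be rewritten as averages of push-forwards by single
group elements. Smoothness of `χ` comes from `f` itself (`LocallyEquivariant.exists_contDiff`). On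
functions `Λ_y(Q y, …, Q y)` of degree `k`, modulo degree `k + 1`, only the values of `Λ` on `W`
matter, and `T` acts there by a unipotent substitution. As `χ(τ) ≠ 1`, the operator `1 - χ(τ) T^*`
is invertible, so every `Λ` has the form `Θ - χ(τ) T^* Θ` modulo higher degree and is killed by `f`
(`UnipotentInvariance.killsForms_of_succ`).

Part (2). The set is peeled off along its filtration: if `u` is supported in one step, its
restriction to the complement of the next step is supported in a submanifold, and once it vanishes
there the support has shrunk. Unipotently incompatible layers are covered by part (1). Near a
metrically proper layer there is a vector `v` orthogonal to the tangent space with `⟨v, v⟩ ≠ 0`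
(`exists_anisotropic_orthogonal`); the covector dual to `v` gives a function `F` vanishing on the
layer with `σ₂(D)(dF) = ⟨v, v⟩ ≠ 0`. The transpose of `D` sends `F^(k+2) ρ` to a nonzero multiple of
`F^k σ₂(D)(dF) ρ` plus a multiple of `F^(k+1)` (`hasLeadingTerm_transposeCoeff`), so `D u = 0` makes
`F^(k+1) u = 0` imply `F^k u = 0`. Equivariance plays no role on these layers. -/

set_option linter.unusedSectionVars false
open scoped BoundedContinuousFunction

namespace EquivGenFun

/-! ### Smooth families of functions on a compact set -/

section Curry

variable {P E F : Type} [NormedAddCommGroup P] [NormedSpace ℝ P] [NormedAddCommGroup E]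
  [NormedSpace ℝ E] [NormedAddCommGroup F] [NormedSpace ℝ F]

/-- The restriction of a continuous function to a compact set, as a bounded continuous function. -/
noncomputable def restrictC {E F : Type} [TopologicalSpace E] [NormedAddCommGroup F] (K : Set E)
    [CompactSpace K] (g : E → F) (hg : Continuous g) : K →ᵇ F :=
  BoundedContinuousFunction.mkOfCompact ⟨fun y => g y, hg.comp continuous_subtype_val⟩

/-- Evaluation of a continuous family of linear maps at a vector. -/
noncomputable def applyFamily (P F : Type) [NormedAddCommGroup P] [NormedSpace ℝ P]
    [NormedAddCommGroup F] [NormedSpace ℝ F] (X : Type) [TopologicalSpace X] [CompactSpace X] :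
    (X →ᵇ (P →L[ℝ] F)) →L[ℝ] P →L[ℝ] (X →ᵇ F) :=
  LinearMap.mkContinuous₂
    (LinearMap.mk₂ ℝ (fun (g : X →ᵇ (P →L[ℝ] F)) (v : P) =>
      BoundedContinuousFunction.mkOfCompact (⟨fun y => g y v, by fun_prop⟩ : C(X, F)))
      (by intros; ext; simp) (by intros; ext; simp) (by intros; ext; simp) (by intros; ext; simp))
    1 (by
      intro g v
      rw [one_mul]
      refine (BoundedContinuousFunction.norm_le (by positivity)).2 fun y => ?_
      exact ((g y).le_opNorm v).trans (by gcongr; exact g.norm_coe_le_norm y))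

theorem applyFamily_apply {X : Type} [TopologicalSpace X] [CompactSpace X]
    (g : X →ᵇ (P →L[ℝ] F)) (v : P) (y : X) : applyFamily P F X g v y = g y v := rfl

theorem continuous_curry {P E : Type} [TopologicalSpace P] [TopologicalSpace E]
    {K : Set E} [CompactSpace K] {Φ : P × E → F} (hΦ : Continuous Φ) :
    Continuous (fun b => restrictC K (fun y => Φ (b, y)) (by fun_prop)) := by
  refine (ContinuousMap.isometryEquivBoundedOfCompact K F).continuous.comp ?_
  refine ContinuousMap.continuous_of_continuous_uncurry _ ?_
  change Continuous fun p : P × K => Φ (p.1, p.2)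
  fun_prop

/-- The remainder must be small uniformly in the compact variable. Compactness makes `b ↦ Φ' (b, ·)`
continuous for the sup norm, and the mean value inequality on a ball turns this into a bound
independent of `y`. -/
theorem hasFDerivAt_curry {K : Set E} [CompactSpace K] {Φ : P × E → F} (hΦ : Continuous Φ)
    (Φ' : P × E → (P →L[ℝ] F)) (hc : Continuous Φ')
    (h' : ∀ b y, HasFDerivAt (fun b => Φ (b, y)) (Φ' (b, y)) b) (b : P) :
    HasFDerivAt (fun b => restrictC K (fun y => Φ (b, y)) (by fun_prop))
      (applyFamily P F K (restrictC K (fun y => Φ' (b, y)) (by fun_prop))) b := by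
  have hcont := continuous_curry (K := K) hc
  rw [hasFDerivAt_iff_isLittleO]
  refine Asymptotics.isLittleO_iff.2 fun ε hε => ?_
  obtain ⟨δ, hδ, H⟩ := Metric.continuous_iff.1 hcont b ε hε
  filter_upwards [Metric.ball_mem_nhds b hδ] with b' hb'
  refine (BoundedContinuousFunction.norm_le (by positivity)).2 fun y => ?_
  have := (convex_ball b δ).norm_image_sub_le_of_norm_hasFDerivWithin_le'
    (f := fun b => Φ (b, y)) (f' := fun b => Φ' (b, y)) (φ := Φ' (b, y)) (C := ε)
    (fun x _ => (h' x y).hasFDerivWithinAt) (fun x hx => ?_) (Metric.mem_ball_self hδ) hb'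
  · simpa [applyFamily_apply, restrictC] using this
  · have h1 := H x hx
    rw [dist_eq_norm] at h1
    exact (BoundedContinuousFunction.norm_coe_le_norm
      (restrictC K (fun y => Φ' (x, y)) (by fun_prop) - restrictC K (fun y => Φ' (b, y))
        (by fun_prop)) y).trans h1.le

/-- The derivative of a curried family is the curried family of partial derivatives followed by the
fixed continuous linear map `applyFamily`. The induction therefore has to change the target space
`F`. -/
theorem contDiff_curry_nat (n : ℕ) {F : Type} [NormedAddCommGroup F] [NormedSpace ℝ F]
    {P : Type} [NormedAddCommGroup P] [NormedSpace ℝ P]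
    {K : Set E} [CompactSpace K] {Φ : P × E → F} (hΦ : ContDiff ℝ ∞ Φ) :
    ContDiff ℝ n (fun b => restrictC K (fun y => Φ (b, y)) (by have := hΦ.continuous; fun_prop)) := by
  induction n generalizing F with
  | zero =>
    rw [Nat.cast_zero, contDiff_zero]
    exact continuous_curry hΦ.continuous
  | succ n ih =>
    have hd : ContDiff ℝ ∞ (fun p : P × E => (fderiv ℝ Φ p).comp (ContinuousLinearMap.inl ℝ P E)) :=
      (hΦ.fderiv_right (m := ∞) (by simp)).clm_comp contDiff_const
    rw [Nat.cast_succ, contDiff_succ_iff_hasFDerivAt]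
    refine ⟨_, (applyFamily P F K).contDiff.comp (ih hd), fun b => ?_⟩
    refine hasFDerivAt_curry hΦ.continuous _ hd.continuous (fun b y => ?_) b
    have h1 := (hΦ.differentiable (by simp) (b, y)).hasFDerivAt
    exact h1.comp b (hasFDerivAt_prodMk_left b y)

/-- A smooth function of two variables, the second in a compact set, is a smooth map into the
space of continuous functions of the second variable. -/
theorem contDiff_curry {K : Set E} [CompactSpace K] {Φ : P × E → F} (hΦ : ContDiff ℝ ∞ Φ) :
    ContDiff ℝ ∞ (fun b => restrictC K (fun y => Φ (b, y)) (by have := hΦ.continuous; fun_prop)) :=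
  contDiff_infty.2 fun n => contDiff_curry_nat n hΦ

end Curry

/-! ### Jets, and functionals of finite order -/

section FiniteOrder

variable {G E : Type} [NormedAddCommGroup G] [NormedSpace ℝ G] [NormedAddCommGroup E]
  [NormedSpace ℝ E]

/-- `f` is of finite order on the smooth functions supported in `K`. -/
def FiniteOrderOn (f : (E → ℂ) →ₗ[ℂ] ℂ) (K : Set E) : Prop :=
  ∃ (C : ℝ) (N : ℕ), ∀ ψ : E → ℂ, ContDiff ℝ ∞ ψ → tsupport ψ ⊆ K → ∀ B : ℝ, 0 ≤ B →
    (∀ j ≤ N, ∀ y ∈ K, ‖iteratedFDeriv ℝ j ψ y‖ ≤ B) → ‖f ψ‖ ≤ C * B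

/-- Smooth functions with support in `K`. -/
noncomputable def smoothSupportedIn (K : Set E) : Submodule ℂ (E → ℂ) where
  carrier := {ψ | ContDiff ℝ ∞ ψ ∧ tsupport ψ ⊆ K}
  add_mem' := fun h h' => ⟨h.1.add h'.1, (tsupport_add _ _).trans (union_subset h.2 h'.2)⟩
  zero_mem' := ⟨contDiff_const, by simp [tsupport]⟩
  smul_mem' := fun a ψ h => ⟨h.1.const_smul a,
    (closure_mono (Function.support_const_smul_subset a ψ)).trans h.2⟩

/-- The space of jets of order `N` along `K`. -/
def JetSpace (E : Type) [NormedAddCommGroup E] [NormedSpace ℝ E] (K : Set E) (N : ℕ) : Type :=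
  (j : Fin (N + 1)) → K →ᵇ (E [×j]→L[ℝ] ℂ)

noncomputable instance (K : Set E) (N : ℕ) : NormedAddCommGroup (JetSpace E K N) :=
  inferInstanceAs (NormedAddCommGroup ((j : Fin (N + 1)) → K →ᵇ (E [×j]→L[ℝ] ℂ)))

noncomputable instance (K : Set E) (N : ℕ) : NormedSpace ℂ (JetSpace E K N) :=
  inferInstanceAs (NormedSpace ℂ ((j : Fin (N + 1)) → K →ᵇ (E [×j]→L[ℝ] ℂ)))

noncomputable instance (K : Set E) (N : ℕ) : NormedSpace ℝ (JetSpace E K N) :=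
  inferInstanceAs (NormedSpace ℝ ((j : Fin (N + 1)) → K →ᵇ (E [×j]→L[ℝ] ℂ)))

instance (K : Set E) (N : ℕ) : CompleteSpace (JetSpace E K N) :=
  inferInstanceAs (CompleteSpace ((j : Fin (N + 1)) → K →ᵇ (E [×j]→L[ℝ] ℂ)))

instance (K : Set E) (N : ℕ) : IsScalarTower ℝ ℂ (JetSpace E K N) :=
  ⟨fun a b g => by
    funext j
    ext1 y
    exact smul_assoc a b ((g j : K → E [×j]→L[ℝ] ℂ) y)⟩

theorem continuous_jet {ψ : E → ℂ} (hψ : ContDiff ℝ ∞ ψ) (j : ℕ) :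
    Continuous (iteratedFDeriv ℝ j ψ) :=
  hψ.continuous_iteratedFDeriv (by exact_mod_cast le_top)

/-- The jet of a smooth function. -/
noncomputable def jet (K : Set E) [CompactSpace K] (N : ℕ) (ψ : E → ℂ) (hψ : ContDiff ℝ ∞ ψ) : JetSpace E K N :=
  fun j => restrictC K (iteratedFDeriv ℝ j ψ) (continuous_jet hψ j)

theorem JetSpace.norm_apply_le {K : Set E} {N : ℕ} (g : JetSpace E K N) (j : Fin (N + 1)) (y : K) :
    ‖(g j : K → E [×j]→L[ℝ] ℂ) y‖ ≤ ‖g‖ :=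
  (BoundedContinuousFunction.norm_coe_le_norm _ _).trans
    (norm_le_pi_norm (G := fun j : Fin (N + 1) => K →ᵇ (E [×j]→L[ℝ] ℂ)) g j)

/-- Evaluation of jets at a point. -/
noncomputable def JetSpace.eval {K : Set E} (N : ℕ) (j : Fin (N + 1)) (y : K) :
    JetSpace E K N →L[ℝ] (E [×j]→L[ℝ] ℂ) :=
  LinearMap.mkContinuous
    { toFun := fun g => (g j : K → E [×j]→L[ℝ] ℂ) y
      map_add' := fun _ _ => rfl
      map_smul' := fun _ _ => rfl } 1 (fun g => by
        rw [one_mul]; exact JetSpace.norm_apply_le g j y)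

/-- The jet as a linear map. -/
noncomputable def jetMap (K : Set E) [CompactSpace K] (N : ℕ) :
    smoothSupportedIn K →ₗ[ℂ] JetSpace E K N where
  toFun := fun ψ => jet K N ψ.1 ψ.2.1
  map_add' := by
    intro ψ ψ'
    funext j
    ext1 y
    have h1 : ContDiffAt ℝ (j : ℕ) ψ.1 (y : E) := ψ.2.1.contDiffAt.of_le (by exact_mod_cast le_top)
    have h2 : ContDiffAt ℝ (j : ℕ) ψ'.1 (y : E) := ψ'.2.1.contDiffAt.of_le (by exact_mod_cast le_top)
    exact iteratedFDeriv_add_apply h1 h2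
  map_smul' := by
    intro a ψ
    funext j
    ext1 y
    have h1 : ContDiffAt ℝ (j : ℕ) ψ.1 (y : E) := ψ.2.1.contDiffAt.of_le (by exact_mod_cast le_top)
    exact iteratedFDeriv_const_smul_apply h1

/-- The component of order zero gives the values on `K`, and the support condition gives zero
elsewhere. -/
theorem jetMap_injective (K : Set E) [CompactSpace K] (N : ℕ) : Function.Injective (jetMap K N) := by
  intro ψ ψ' e
  ext y
  by_cases hy : y ∈ K
  · have h0 := congrArg (fun g : JetSpace E K N => (g 0 : K → E [×0]→L[ℝ] ℂ) ⟨y, hy⟩ 0) e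
    exact h0
  · rw [image_eq_zero_of_notMem_tsupport fun h => hy (ψ.2.2 h),
      image_eq_zero_of_notMem_tsupport fun h => hy (ψ'.2.2 h)]

/-- A functional of finite order extends continuously to the space of jets. -/
theorem FiniteOrderOn.exists_extension {f : (E → ℂ) →ₗ[ℂ] ℂ} {K : Set E} [CompactSpace K]
    (hf : FiniteOrderOn f K) : ∃ (N : ℕ) (T : JetSpace E K N →L[ℂ] ℂ),
      ∀ (ψ : E → ℂ) (hψ : ContDiff ℝ ∞ ψ), tsupport ψ ⊆ K → f ψ = T (jet K N ψ hψ) := by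
  obtain ⟨C, N, h⟩ := hf
  let eJ := LinearEquiv.ofInjective (jetMap K N) (jetMap_injective K N)
  -- Since the jet determines the function, `f` descends to the range of `jetMap`; finite order says
  -- precisely that it is bounded there.
  let f0 : LinearMap.range (jetMap K N) →ₗ[ℂ] ℂ :=
    (f.comp (Submodule.subtype _)).comp eJ.symm.toLinearMap
  have hb : ∀ x : LinearMap.range (jetMap K N), ‖f0 x‖ ≤ C * ‖x‖ := by
    intro x
    obtain ⟨ψ, rfl⟩ := eJ.surjective x
    have e1 : f0 (eJ ψ) = f ψ := by simp [f0]
    rw [e1]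
    refine h ψ ψ.2.1 ψ.2.2 _ (norm_nonneg _) fun j hj y hy => ?_
    exact JetSpace.norm_apply_le (jetMap K N ψ) ⟨j, by omega⟩ ⟨y, hy⟩
  -- Hahn–Banach. The extension makes `f` a continuous linear map on a Banach space, so it preserves
  -- smoothness of curves and commutes with Bochner integrals.
  obtain ⟨T, hT, -⟩ := exists_extension_norm_eq (LinearMap.range (jetMap K N))
    (LinearMap.mkContinuous f0 C hb)
  refine ⟨N, T, fun ψ hψ hs => ?_⟩
  have h2 := hT (eJ ⟨ψ, hψ, hs⟩)
  rw [LinearMap.mkContinuous_apply] at h2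
  have e1 : f0 (eJ ⟨ψ, hψ, hs⟩) = f ψ := by simp [f0]
  rw [← e1, ← h2]
  rfl

end FiniteOrder


/-! ### Finite-order functionals applied to smooth families and to their integrals -/

section Families

variable {G E F : Type} [NormedAddCommGroup G] [NormedSpace ℝ G] [NormedAddCommGroup E]
  [NormedSpace ℝ E] [NormedAddCommGroup F] [NormedSpace ℝ F]

/-- Integration over a compact set, as a continuous linear map. -/
noncomputable def integralC [MeasurableSpace G] [BorelSpace G]
    [SecondCountableTopology G] (μ : Measure G) [IsFiniteMeasureOnCompacts μ] (K : Set G)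
    [CompactSpace K] : (K →ᵇ F) →L[ℝ] F :=
  haveI : IsFiniteMeasure (μ.comap ((↑) : K → G)) :=
    ⟨by
      rw [(MeasurableEmbedding.subtype_coe (isCompact_iff_compactSpace.2 ‹_›).measurableSet).comap_apply]
      simpa using (isCompact_iff_compactSpace.2 ‹CompactSpace K›).measure_lt_top⟩
  have hint : ∀ g : K →ᵇ F, Integrable g (μ.comap ((↑) : K → G)) := fun g =>
    ⟨g.continuous.aestronglyMeasurable, HasFiniteIntegral.of_bounded (C := ‖g‖)
      (ae_of_all _ g.norm_coe_le_norm)⟩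
  LinearMap.mkContinuous
    { toFun := fun g => ∫ y, g y ∂(μ.comap ((↑) : K → G))
      map_add' := fun g g' => integral_add (hint g) (hint g')
      map_smul' := fun a g => integral_smul a _ }
    ((μ.comap ((↑) : K → G)).real univ) (fun g => by
      have := norm_integral_le_of_norm_le_const (μ := μ.comap ((↑) : K → G)) (f := g) (C := ‖g‖)
        (ae_of_all _ g.norm_coe_le_norm)
      rw [mul_comm]
      exact this)

theorem integralC_restrictC [MeasurableSpace G] [BorelSpace G]
    [SecondCountableTopology G] (μ : Measure G) [IsFiniteMeasureOnCompacts μ] (K : Set G)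
    [CompactSpace K] (g : G → F) (hg : Continuous g) :
    integralC μ K (restrictC K g hg) = ∫ y in K, g y ∂μ := by
  have hK : MeasurableSet K := (isCompact_iff_compactSpace.2 ‹_›).measurableSet
  exact integral_subtype_comap hK g

theorem integralC_apply [MeasurableSpace G] [BorelSpace G]
    [SecondCountableTopology G] (μ : Measure G) [IsFiniteMeasureOnCompacts μ] (K : Set G)
    [CompactSpace K] (g : K →ᵇ F) :
    integralC μ K g = ∫ y, g y ∂(μ.comap ((↑) : K → G)) := rfl

/-- Integrals depending on a parameter are smooth. -/
theorem contDiff_parametric_integral [MeasurableSpace G] [BorelSpace G]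
    [SecondCountableTopology G] (μ : Measure G) [IsFiniteMeasureOnCompacts μ] {K : Set G}
    (hK : IsCompact K) {Φ : E × G → F} (hΦ : ContDiff ℝ ∞ Φ) :
    ContDiff ℝ ∞ (fun y => ∫ b in K, Φ (y, b) ∂μ) := by
  have : CompactSpace K := isCompact_iff_compactSpace.1 hK
  have h := (integralC (F := F) μ K).contDiff.comp (contDiff_curry (K := K) hΦ)
  have e : (fun y => ∫ b in K, Φ (y, b) ∂μ) = _ :=
    funext fun y => (integralC_restrictC μ K (fun b => Φ (y, b)) (by
      have := hΦ.continuous; fun_prop)).symm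
  rw [e]
  exact h

/-- The derivative in the second variable is the total derivative with all arguments restricted to
the second factor, and this restriction is one fixed continuous linear map. -/
theorem contDiff_partial_iteratedFDeriv {Ψ : G × E → ℂ} (hΨ : ContDiff ℝ ∞ Ψ) (j : ℕ) :
    ContDiff ℝ ∞ (fun p : G × E => iteratedFDeriv ℝ j (fun y => Ψ (p.1, y)) p.2) := by
  have key : ∀ p : G × E, iteratedFDeriv ℝ j (fun y => Ψ (p.1, y)) p.2 =
      ContinuousMultilinearMap.compContinuousLinearMapL (𝕜 := ℝ) (F := ℂ)
        (fun _ : Fin j => ContinuousLinearMap.inr ℝ G E) (iteratedFDeriv ℝ j Ψ p) := by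
    intro p
    have e1 : (fun y => Ψ (p.1, y)) =
        (fun q => Ψ ((p.1, 0) + q)) ∘ (ContinuousLinearMap.inr ℝ G E) := by
      funext y; simp
    have h1 : ContDiff ℝ ∞ (fun q => Ψ ((p.1, 0) + q)) := hΨ.comp (contDiff_const.add contDiff_id)
    rw [e1, ContinuousLinearMap.iteratedFDeriv_comp_right _ h1 _ (i := j) (by exact_mod_cast le_top),
      iteratedFDeriv_comp_add_left]
    simp
  simp_rw [key]
  exact (ContinuousLinearMap.contDiff _).comp
    (hΨ.iteratedFDeriv_right (m := ∞) (by exact_mod_cast le_top))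

/-- The integral is the composite of a smooth map into continuous functions on `L` with the
continuous linear map `integralC`, and continuous linear maps commute with iterated derivatives. -/
theorem iteratedFDeriv_integral [MeasurableSpace G] [BorelSpace G]
    [SecondCountableTopology G] (μ : Measure G) [IsFiniteMeasureOnCompacts μ] {L : Set G}
    (hL : IsCompact L) {Ψ : G × E → ℂ} (hΨ : ContDiff ℝ ∞ Ψ) (j : ℕ) (y : E) :
    iteratedFDeriv ℝ j (fun y => ∫ b in L, Ψ (b, y) ∂μ) y =
      ∫ b in L, iteratedFDeriv ℝ j (fun y => Ψ (b, y)) y ∂μ := by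
  have : CompactSpace L := isCompact_iff_compactSpace.1 hL
  have hswap : ContDiff ℝ ∞ (fun p : E × G => Ψ (p.2, p.1)) :=
    hΨ.comp (contDiff_snd.prodMk contDiff_fst)
  have hc : ContDiff ℝ ∞ (fun y => restrictC L (fun b => Ψ (b, y)) _) :=
    contDiff_curry (K := L) hswap
  have hj : (j : ℕ∞ω) ≤ ∞ := by exact_mod_cast le_top
  have hint : IntegrableOn (fun b => iteratedFDeriv ℝ j (fun y => Ψ (b, y)) y) L μ := by
    refine ContinuousOn.integrableOn_compact hL (Continuous.continuousOn ?_)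
    exact (contDiff_partial_iteratedFDeriv hΨ j).continuous.comp (Continuous.prodMk_left y)
  have e1 : (fun y => ∫ b in L, Ψ (b, y) ∂μ) = (integralC μ L) ∘
      (fun y => restrictC L (fun b => Ψ (b, y)) (by have := hΨ.continuous; fun_prop)) :=
    funext fun y => (integralC_restrictC μ L (fun b => Ψ (b, y)) _).symm
  ext v
  rw [e1, ContinuousLinearMap.iteratedFDeriv_comp_left _ hc.contDiffAt hj,
    ContinuousLinearMap.compContinuousMultilinearMap_coe, Function.comp_apply, integralC_apply]
  have e2 := ContinuousLinearMap.integral_comp_comm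
    (ContinuousMultilinearMap.apply ℝ (fun _ : Fin j => E) ℂ v) hint
  change _ = (ContinuousMultilinearMap.apply ℝ (fun _ : Fin j => E) ℂ v) _
  rw [← e2, ← integral_subtype_comap hL.measurableSet]
  refine integral_congr_ae (ae_of_all _ fun b => ?_)
  have e3 : (fun y => Ψ (b, y)) = (BoundedContinuousFunction.evalCLM ℝ b) ∘
      (fun y => restrictC L (fun b => Ψ (b, y)) (by have := hΨ.continuous; fun_prop)) := rfl
  change _ = iteratedFDeriv ℝ j (fun y => Ψ (b, y)) y v
  rw [e3, ContinuousLinearMap.iteratedFDeriv_comp_left _ hc.contDiffAt hj]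
  rfl

theorem contDiff_slice {Ψ : G × E → F} (hΨ : ContDiff ℝ ∞ Ψ) (b : G) :
    ContDiff ℝ ∞ (fun y => Ψ (b, y)) := hΨ.comp (contDiff_prodMk_right b)

theorem contDiff_jet {K : Set E} [CompactSpace K] (N : ℕ) {Ψ : G × E → ℂ} (hΨ : ContDiff ℝ ∞ Ψ) :
    ContDiff ℝ ∞ (fun b => jet K N (fun y => Ψ (b, y)) (contDiff_slice hΨ b)) := by
  have h : ContDiff ℝ ∞ (F := (j : Fin (N + 1)) → K →ᵇ (E [×j]→L[ℝ] ℂ))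
      (fun b => jet K N (fun y => Ψ (b, y)) (contDiff_slice hΨ b)) := by
    refine contDiff_pi.2 fun j => ?_
    exact contDiff_curry (K := K) (contDiff_partial_iteratedFDeriv hΨ j)
  exact h

/-- A functional of finite order, applied to a smooth family, gives a smooth function. -/
theorem FiniteOrderOn.contDiff_family {f : (E → ℂ) →ₗ[ℂ] ℂ} {K : Set E} (hK : IsCompact K)
    (hf : FiniteOrderOn f K) {Ψ : G × E → ℂ} (hΨ : ContDiff ℝ ∞ Ψ)
    (hs : ∀ b, tsupport (fun y => Ψ (b, y)) ⊆ K) :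
    ContDiff ℝ ∞ (fun b => f (fun y => Ψ (b, y))) := by
  have : CompactSpace K := isCompact_iff_compactSpace.1 hK
  obtain ⟨N, T, hT⟩ := hf.exists_extension
  have : (fun b => f (fun y => Ψ (b, y))) = fun b =>
      (T.restrictScalars ℝ) (jet K N (fun y => Ψ (b, y)) (contDiff_slice hΨ b)) :=
    funext fun b => hT _ _ (hs b)
  rw [this]
  exact (T.restrictScalars ℝ).contDiff.comp (contDiff_jet N hΨ)

theorem tsupport_integral_subset [MeasurableSpace G] (μ : Measure G) {Ψ : G × E → ℂ} {K : Set E}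
    (hK : IsClosed K) (hs : ∀ b, tsupport (fun y => Ψ (b, y)) ⊆ K) :
    tsupport (fun y => ∫ b, Ψ (b, y) ∂μ) ⊆ K := by
  refine closure_minimal (fun y hy => ?_) hK
  by_contra h
  refine hy ?_
  have : ∀ b, Ψ (b, y) = 0 := fun b =>
    image_eq_zero_of_notMem_tsupport (f := fun y => Ψ (b, y)) fun h' => h (hs b h')
  simp [this]

/-- A functional of finite order commutes with integration of smooth families. -/
theorem FiniteOrderOn.integral_family [MeasurableSpace G] [BorelSpace G]
    [SecondCountableTopology G] (μ : Measure G) [IsFiniteMeasureOnCompacts μ]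
    {f : (E → ℂ) →ₗ[ℂ] ℂ} {K : Set E} (hK : IsCompact K)
    (hf : FiniteOrderOn f K) {Ψ : G × E → ℂ} (hΨ : ContDiff ℝ ∞ Ψ)
    (hs : ∀ b, tsupport (fun y => Ψ (b, y)) ⊆ K) {L : Set G} (hL : IsCompact L)
    (hsL : ∀ b ∉ L, ∀ y, Ψ (b, y) = 0) :
    ContDiff ℝ ∞ (fun y => ∫ b, Ψ (b, y) ∂μ) ∧
    f (fun y => ∫ b, Ψ (b, y) ∂μ) = ∫ b, f (fun y => Ψ (b, y)) ∂μ := by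
  have : CompactSpace K := isCompact_iff_compactSpace.1 hK
  have : CompactSpace L := isCompact_iff_compactSpace.1 hL
  have hswap : ContDiff ℝ ∞ (fun p : E × G => Ψ (p.2, p.1)) :=
    hΨ.comp (contDiff_snd.prodMk contDiff_fst)
  have hset : ∀ y, ∫ b, Ψ (b, y) ∂μ = ∫ b in L, Ψ (b, y) ∂μ := fun y =>
    (setIntegral_eq_integral_of_forall_compl_eq_zero fun b hb => hsL b hb y).symm
  have hsm : ContDiff ℝ ∞ (fun y => ∫ b, Ψ (b, y) ∂μ) :=
    (funext hset : (fun y => ∫ b, Ψ (b, y) ∂μ) = _) ▸ contDiff_parametric_integral μ hL hswap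
  refine ⟨hsm, ?_⟩
  obtain ⟨N, T, hT⟩ := hf.exists_extension
  have hzero : ∀ b ∉ L, f (fun y => Ψ (b, y)) = 0 := fun b hb => by
    have : (fun y => Ψ (b, y)) = 0 := funext fun y => hsL b hb y
    rw [this, map_zero]
  rw [← setIntegral_eq_integral_of_forall_compl_eq_zero hzero,
    hT _ hsm (tsupport_integral_subset μ hK.isClosed hs)]
  have hJ := (contDiff_jet (K := K) N hΨ).continuous
  have hint : IntegrableOn (fun b => jet K N (fun y => Ψ (b, y)) (contDiff_slice hΨ b)) L μ :=
    hJ.continuousOn.integrableOn_compact hL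
  have e : ∀ b, f (fun y => Ψ (b, y)) =
      T (jet K N (fun y => Ψ (b, y)) (contDiff_slice hΨ b)) := fun b => hT _ _ (hs b)
  simp_rw [e]
  -- `T` passes through the Bochner integral of jets. It remains to see that the integral of the
  -- jets is the jet of the integral, which is checked at each order and each point by evaluation
  -- maps.
  have e2 := ContinuousLinearMap.integral_comp_comm (T.restrictScalars ℝ) hint
  change _ = ∫ b in L, (T.restrictScalars ℝ) (jet K N (fun y => Ψ (b, y)) (contDiff_slice hΨ b)) ∂μ
  rw [e2]
  change T _ = T _
  congr 1
  funext j
  ext1 y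
  have e3 := ContinuousLinearMap.integral_comp_comm (JetSpace.eval N j y) hint
  change iteratedFDeriv ℝ j (fun y => ∫ b, Ψ (b, y) ∂μ) y = JetSpace.eval N j y _
  rw [← e3]
  change _ = ∫ b in L, iteratedFDeriv ℝ j (fun y => Ψ (b, y)) y ∂μ
  rw [show (fun y => ∫ b, Ψ (b, y) ∂μ) = _ from funext hset]
  exact iteratedFDeriv_integral μ hL hΨ j y

end Families


/-! ### Cutoffs, Hadamard's lemma, and functions vanishing to high order on the support -/

section Tools

variable {E F V : Type} [NormedAddCommGroup E] [NormedSpace ℝ E] [FiniteDimensional ℝ E]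
  [NormedAddCommGroup F] [NormedSpace ℝ F] [NormedAddCommGroup V] [NormedSpace ℝ V]
  [FiniteDimensional ℝ V]

/-- A function which is smooth on an open set and vanishes off a closed subset of it is smooth. -/
theorem contDiff_of_eq_zero {E : Type} [NormedAddCommGroup E] [NormedSpace ℝ E] {g : E → F}
    {O K : Set E} (hO : IsOpen O) (hK : IsClosed K) (hKO : K ⊆ O)
    (hg : ContDiffOn ℝ ∞ g O) (h0 : ∀ x ∉ K, g x = 0) : ContDiff ℝ ∞ g := by
  refine contDiff_iff_contDiffAt.2 fun x => ?_
  by_cases hx : x ∈ O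
  · exact hg.contDiffAt (hO.mem_nhds hx)
  · have hx' : Kᶜ ∈ 𝓝 x := hK.isOpen_compl.mem_nhds fun h => hx (hKO h)
    refine (contDiffAt_const (c := (0 : F))).congr_of_eventuallyEq ?_
    filter_upwards [hx'] with y hy using h0 y hy

theorem exists_smooth_cutoff (x : E) {r : ℝ} (hr : 0 < r) :
    ∃ η : E → ℝ, ContDiff ℝ ∞ η ∧ (∀ y ∈ Metric.ball x (r / 2), η y = 1) ∧
      tsupport η ⊆ Metric.ball x r ∧ HasCompactSupport η := by
  let b : ContDiffBump x := ⟨r / 2, 3 * r / 4, by positivity, by linarith⟩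
  refine ⟨b, b.contDiff, fun y hy => b.one_of_mem_closedBall (Metric.ball_subset_closedBall hy),
    ?_, b.hasCompactSupport⟩
  rw [b.tsupport_eq]
  refine Metric.closedBall_subset_ball ?_
  change 3 * r / 4 < r
  linarith

/-- A smooth function on a neighbourhood of a point agrees near the point with a smooth function
on the whole space. -/
theorem exists_contDiff_eventuallyEq {g : E → F} {O : Set E} (hO : IsOpen O) {x : E} (hx : x ∈ O)
    (hg : ContDiffOn ℝ ∞ g O) : ∃ g' : E → F, ContDiff ℝ ∞ g' ∧ g' =ᶠ[𝓝 x] g := by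
  obtain ⟨r, hr, hrO⟩ := Metric.isOpen_iff.1 hO x hx
  obtain ⟨η, hη, h1, hs, -⟩ := exists_smooth_cutoff x hr
  refine ⟨fun y => η y • g y, ?_, ?_⟩
  · refine contDiff_of_eq_zero hO (isClosed_tsupport η) (hs.trans hrO)
      (hη.contDiffOn.smul hg) fun y hy => ?_
    rw [image_eq_zero_of_notMem_tsupport hy, zero_smul]
  · filter_upwards [Metric.ball_mem_nhds x (half_pos hr)] with y hy
    rw [h1 y hy, one_smul]

/-- The average of the derivative over a segment, in Hadamard's lemma. -/
noncomputable def hadamard (P Q : E →L[ℝ] E) (g : E → F) (y : E) : E →L[ℝ] F :=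
  ∫ t in Icc (0 : ℝ) 1, fderiv ℝ g (P y + t • Q y)

theorem contDiff_hadamard (P Q : E →L[ℝ] E) {g : E → F} (hg : ContDiff ℝ ∞ g) :
    ContDiff ℝ ∞ (hadamard P Q g) := by
  refine contDiff_parametric_integral (Φ := fun p : E × ℝ => fderiv ℝ g (P p.1 + p.2 • Q p.1))
    volume isCompact_Icc ?_
  have h := hg.fderiv_right (m := ∞) (by simp)
  refine h.comp ?_
  exact (P.contDiff.comp contDiff_fst).add (contDiff_snd.smul (Q.contDiff.comp contDiff_fst))

/-- The fundamental theorem of calculus along the segment from `P y` to `P y + Q y`. With `P + Q =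
1` it divides a function vanishing on the range of `P` by `Q y`. -/
theorem hadamard_apply [CompleteSpace F] (P Q : E →L[ℝ] E) {g : E → F} (hg : ContDiff ℝ ∞ g)
    (y : E) : hadamard P Q g y (Q y) = g (P y + Q y) - g (P y) := by
  have hd : Continuous (fderiv ℝ g) := hg.continuous_fderiv (by simp)
  have hc : Continuous (fun t : ℝ => fderiv ℝ g (P y + t • Q y)) := by fun_prop
  rw [hadamard, ContinuousLinearMap.integral_apply (hc.continuousOn.integrableOn_compact isCompact_Icc),
    integral_Icc_eq_integral_Ioc, ← intervalIntegral.integral_of_le zero_le_one]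
  have hder : ∀ t ∈ uIcc (0 : ℝ) 1, HasDerivAt (fun t : ℝ => g (P y + t • Q y))
      (fderiv ℝ g (P y + t • Q y) (Q y)) t := by
    intro t _
    have h1 : HasDerivAt (fun t : ℝ => P y + t • Q y) (Q y) t := by
      simpa using ((hasDerivAt_id t).smul_const (Q y)).const_add (P y)
    exact ((hg.differentiable (by simp)) _).hasFDerivAt.comp_hasDerivAt t h1
  rw [intervalIntegral.integral_eq_sub_of_hasDerivAt hder]
  · simp
  · exact ((hc.clm_apply continuous_const)).intervalIntegrable _ _

/-- The bound is taken at least `1` so that it is dominated by its own positive powers, as the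
estimate for derivatives of composites requires. -/
theorem exists_bound_iteratedFDeriv {g : E → F} (hg : ContDiff ℝ ∞ g) {K : Set E}
    (hK : IsCompact K) (N : ℕ) :
    ∃ C : ℝ, 1 ≤ C ∧ ∀ j ≤ N, ∀ y ∈ K, ‖iteratedFDeriv ℝ j g y‖ ≤ C := by
  have h : ∀ j : ℕ, ∃ C : ℝ, ∀ y ∈ K, ‖iteratedFDeriv ℝ j g y‖ ≤ C := fun j =>
    hK.exists_bound_of_continuousOn
      (hg.continuous_iteratedFDeriv (m := j) (by exact_mod_cast le_top)).continuousOn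
  choose C hC using h
  refine ⟨1 + ∑ j ∈ Finset.range (N + 1), |C j|, ?_, fun j hj y hy => ?_⟩
  · have : 0 ≤ ∑ j ∈ Finset.range (N + 1), |C j| := Finset.sum_nonneg fun _ _ => abs_nonneg _
    linarith
  · have h1 : |C j| ≤ ∑ j ∈ Finset.range (N + 1), |C j| :=
      Finset.single_le_sum (f := fun j => |C j|) (fun _ _ => abs_nonneg _)
        (Finset.mem_range.2 (by omega))
    have := hC j y hy
    have := le_abs_self (C j)
    linarith

/-- A functional of finite order which is supported in the zero set of `q` kills the functions
vanishing to sufficiently high order along `q = 0`. -/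
theorem FiniteOrderOn.exists_kills {f : (E → ℂ) →ₗ[ℂ] ℂ} {K : Set E} (hK : IsCompact K)
    (hf : FiniteOrderOn f K) {q : E → V} (hq : ContDiff ℝ ∞ q)
    (hs : ∀ ψ : E → ℂ, ContDiff ℝ ∞ ψ → tsupport ψ ⊆ K → (∀ y ∈ tsupport ψ, q y ≠ 0) → f ψ = 0) :
    ∃ N : ℕ, ∀ Γ : E × V → ℂ, ContDiff ℝ ∞ Γ → (∀ y ∉ K, ∀ v, Γ (y, v) = 0) →
      (∀ (y : E) (t : ℝ) (v : V), Γ (y, t • v) = (t : ℂ) ^ (N + 1) * Γ (y, v)) →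
      f (fun y => Γ (y, q y)) = 0 := by
  obtain ⟨C, N, h⟩ := hf
  refine ⟨N, fun Γ hΓ hΓK hhom => ?_⟩
  obtain ⟨η, hη, hη1, -, hηc⟩ := exists_smooth_cutoff (0 : V) (zero_lt_one' ℝ)
  -- Cutting off in `v` makes the derivatives bounded on all of `K × V`; this is needed because the
  -- rescaled argument `q y / ε` is unbounded as `ε` tends to zero.
  set Γ' : E × V → ℂ := fun p => η p.2 • Γ p with hΓ'
  have hΓ's : ContDiff ℝ ∞ Γ' := (hη.comp contDiff_snd).smul hΓ
  -- bounds
  obtain ⟨C₁, hC₁, hb₁⟩ := exists_bound_iteratedFDeriv hΓ's (hK.prod hηc.isCompact) N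
  have hb₁' : ∀ j ≤ N, ∀ y ∈ K, ∀ v, ‖iteratedFDeriv ℝ j Γ' (y, v)‖ ≤ C₁ := by
    intro j hj y hy v
    by_cases hv : v ∈ tsupport η
    · exact hb₁ j hj _ ⟨hy, hv⟩
    · have : Γ' =ᶠ[𝓝 (y, v)] fun _ => 0 := by
        have h1 : (tsupport η)ᶜ ∈ 𝓝 v := (isClosed_tsupport η).isOpen_compl.mem_nhds hv
        filter_upwards [continuous_snd.continuousAt.preimage_mem_nhds (x := (y, v)) h1] with p hp
        simp [hΓ', image_eq_zero_of_notMem_tsupport hp]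
      have h2 := (this.iteratedFDeriv ℝ j).self_of_nhds
      rw [h2]
      have : iteratedFDeriv ℝ j (fun _ : E × V => (0 : ℂ)) = 0 := iteratedFDeriv_fun_zero
      rw [this]
      simp only [Pi.zero_apply, norm_zero]
      linarith
  obtain ⟨C₂, hC₂, hb₂⟩ := exists_bound_iteratedFDeriv (contDiff_id.prodMk hq) hK N
  -- the two pieces
  have hpiece : ∀ ε : ℝ, 0 < ε → ε ≤ 1 →
      ‖f (fun y => Γ (y, q y))‖ ≤ |C| * ((N.factorial : ℝ) * C₁ * C₂ ^ N) * ε := by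
    intro ε hε hε1
    -- Rescaling of the normal variable by `ε⁻¹`; its norm is where negative powers of `ε` enter.
    let S : E × V →L[ℝ] E × V :=
      (ContinuousLinearMap.fst ℝ E V).prod (ε⁻¹ • ContinuousLinearMap.snd ℝ E V)
    have hSn : ‖S‖ ≤ ε⁻¹ := by
      refine ContinuousLinearMap.opNorm_le_bound _ (by positivity) fun p => ?_
      have h1 : 1 ≤ ε⁻¹ := (one_le_inv₀ hε).2 hε1
      refine max_le ?_ ?_
      · calc ‖p.1‖ ≤ ‖p‖ := norm_fst_le p
          _ ≤ ε⁻¹ * ‖p‖ := le_mul_of_one_le_left (norm_nonneg _) h1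
      · change ‖ε⁻¹ • p.2‖ ≤ _
        rw [norm_smul, Real.norm_of_nonneg (by positivity)]
        gcongr
        exact norm_snd_le p
    let A : E → E × V := S ∘ fun y => (y, q y)
    have hA : ContDiff ℝ ∞ A := S.contDiff.comp (contDiff_id.prodMk hq)
    have hAb : ∀ y ∈ K, ∀ i, 1 ≤ i → i ≤ N → ‖iteratedFDeriv ℝ i A y‖ ≤ (C₂ / ε) ^ i := by
      intro y hy i hi hiN
      have e1 : (1 : ℝ) ≤ C₂ / ε := by rw [le_div_iff₀ hε]; linarith
      calc ‖iteratedFDeriv ℝ i A y‖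
          ≤ ‖S‖ * ‖iteratedFDeriv ℝ i (fun y => (y, q y)) y‖ :=
            S.norm_iteratedFDeriv_comp_left (contDiff_id.prodMk hq).contDiffAt
              (by exact_mod_cast le_top)
        _ ≤ ε⁻¹ * C₂ := by gcongr; exact hb₂ i hiN y hy
        _ = C₂ / ε := by ring
        _ ≤ (C₂ / ε) ^ i := le_self_pow₀ e1 (by omega)
    -- By homogeneity this is `η(q y / ε) Γ(y, q y)`, the part of the function close to `q = 0`.
    -- Derivatives up to order `N` cost at most `ε^(-N)` against the factor `ε^(N+1)`, which leaves
    -- a bound proportional to `ε`.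
    let ψ₁ : E → ℂ := fun y => ((ε : ℂ) ^ (N + 1)) • Γ' (A y)
    have hψ₁ : ContDiff ℝ ∞ ψ₁ := (hΓ's.comp hA).const_smul _
    have hA2 : ∀ y, Γ (y, q y) = (ε : ℂ) ^ (N + 1) * Γ (A y) := by
      intro y
      have h1 := hhom y ε (ε⁻¹ • q y)
      rw [smul_smul, mul_inv_cancel₀ hε.ne', one_smul] at h1
      exact h1
    have hψ₁K : tsupport ψ₁ ⊆ K := by
      refine closure_minimal (fun y hy => ?_) hK.isClosed
      by_contra hyK
      exact hy (by simp [ψ₁, hΓ', A, S, hΓK y hyK])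
    have hψK : tsupport (fun y => Γ (y, q y)) ⊆ K := by
      refine closure_minimal (fun y hy => ?_) hK.isClosed
      by_contra hyK
      exact hy (hΓK y hyK _)
    have hψ : ContDiff ℝ ∞ (fun y => Γ (y, q y)) := hΓ.comp (contDiff_id.prodMk hq)
    -- The difference vanishes where `q y / ε` is small, so its closed support avoids the zero set
    -- of `q`.
    have hsub : f ((fun y => Γ (y, q y)) - ψ₁) = 0 := by
      refine hs _ (hψ.sub hψ₁) ((tsupport_sub _ _).trans (union_subset hψK hψ₁K)) fun y hy hy0 => ?_
      have hnear : ∀ᶠ z in 𝓝 y, ((fun y => Γ (y, q y)) - ψ₁) z = 0 := by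
        have h1 : ∀ᶠ z in 𝓝 y, ε⁻¹ • q z ∈ Metric.ball (0 : V) (1 / 2) := by
          have hc : Continuous (fun z => ε⁻¹ • q z) := hq.continuous.const_smul _
          refine hc.continuousAt.preimage_mem_nhds ?_
          rw [hy0, smul_zero]
          exact Metric.ball_mem_nhds _ (by norm_num)
        filter_upwards [h1] with z hz
        have e2 : η (A z).2 = 1 := hη1 _ hz
        simp only [Pi.sub_apply, ψ₁, hΓ', e2, one_smul, hA2 z, smul_eq_mul, sub_self]
      exact (notMem_tsupport_iff_eventuallyEq.2 hnear) hy
    rw [map_sub, sub_eq_zero] at hsub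
    rw [hsub]
    have hB : ∀ j ≤ N, ∀ y ∈ K, ‖iteratedFDeriv ℝ j ψ₁ y‖ ≤ (N.factorial : ℝ) * C₁ * C₂ ^ N * ε := by
      intro j hj y hy
      have e1 : ‖iteratedFDeriv ℝ j ψ₁ y‖ = ε ^ (N + 1) * ‖iteratedFDeriv ℝ j (Γ' ∘ A) y‖ := by
        have : iteratedFDeriv ℝ j ψ₁ y = ((ε : ℂ) ^ (N + 1)) • iteratedFDeriv ℝ j (Γ' ∘ A) y :=
          iteratedFDeriv_const_smul_apply (𝕜 := ℝ) (i := j) (x := y) (a := (ε : ℂ) ^ (N + 1))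
            (f := Γ' ∘ A) ((hΓ's.comp hA).contDiffAt.of_le (by exact_mod_cast le_top))
        rw [this, norm_smul]
        simp [abs_of_pos hε]
      rw [e1]
      have e2 := norm_iteratedFDeriv_comp_le hΓ's hA (n := j) (by exact_mod_cast le_top) y (C := C₁)
        (D := C₂ / ε) (fun i hi => hb₁' i (hi.trans hj) y hy _)
        (fun i hi hij => hAb y hy i hi (hij.trans hj))
      have e3 : (1 : ℝ) ≤ C₂ / ε := by rw [le_div_iff₀ hε]; linarith
      calc ε ^ (N + 1) * ‖iteratedFDeriv ℝ j (Γ' ∘ A) y‖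
          ≤ ε ^ (N + 1) * ((N.factorial : ℝ) * C₁ * (C₂ / ε) ^ N) := by
            gcongr
            refine e2.trans ?_
            gcongr
        _ = (N.factorial : ℝ) * C₁ * C₂ ^ N * ε := by
            rw [div_pow, pow_succ]
            field_simp
    have := h ψ₁ hψ₁ hψ₁K _ (by positivity) hB
    calc ‖f ψ₁‖ ≤ C * ((N.factorial : ℝ) * C₁ * C₂ ^ N * ε) := this
      _ ≤ |C| * ((N.factorial : ℝ) * C₁ * C₂ ^ N * ε) := by gcongr; exact le_abs_self C
      _ = _ := by ring
  set B := |C| * ((N.factorial : ℝ) * C₁ * C₂ ^ N) with hB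
  have hB0 : 0 ≤ B := by positivity
  rw [← norm_le_zero_iff]
  refine le_of_forall_pos_le_add fun δ hδ => ?_
  rw [zero_add]
  -- The denominator is `B + 1` because `B` may be zero.
  have hε : 0 < min 1 (δ / (B + 1)) := by positivity
  refine (hpiece _ hε (min_le_left _ _)).trans ?_
  calc B * min 1 (δ / (B + 1)) ≤ B * (δ / (B + 1)) := by gcongr; exact min_le_right _ _
    _ ≤ (B + 1) * (δ / (B + 1)) := by gcongr; linarith
    _ = δ := by field_simp

end Tools


/-! ### Unipotent substitutions in multilinear forms, and determinants -/

section Forms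

variable {X E F : Type} [NormedAddCommGroup X] [NormedSpace ℝ X] [NormedAddCommGroup E]
  [NormedSpace ℝ E] [FiniteDimensional ℝ E] [NormedAddCommGroup F] [NormedSpace ℝ F]

/-- The space of complex valued `k`-linear forms. -/
def FormSpace (E : Type) [NormedAddCommGroup E] [NormedSpace ℝ E] (k : ℕ) : Type :=
  E [×k]→L[ℝ] ℂ

noncomputable instance (k : ℕ) : NormedAddCommGroup (FormSpace E k) :=
  inferInstanceAs (NormedAddCommGroup (E [×k]→L[ℝ] ℂ))

noncomputable instance (k : ℕ) : NormedSpace ℝ (FormSpace E k) :=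
  inferInstanceAs (NormedSpace ℝ (E [×k]→L[ℝ] ℂ))

noncomputable instance (k : ℕ) : NormedSpace ℂ (FormSpace E k) :=
  inferInstanceAs (NormedSpace ℂ (E [×k]→L[ℝ] ℂ))

instance (k : ℕ) : CompleteSpace (FormSpace E k) :=
  inferInstanceAs (CompleteSpace (E [×k]→L[ℝ] ℂ))

instance (k : ℕ) : IsScalarTower ℝ ℂ (FormSpace E k) :=
  inferInstanceAs (IsScalarTower ℝ ℂ (E [×k]→L[ℝ] ℂ))

instance (k : ℕ) : FunLike (FormSpace E k) (Fin k → E) ℂ :=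
  inferInstanceAs (FunLike (E [×k]→L[ℝ] ℂ) (Fin k → E) ℂ)

/-- Substitution of linear maps into the slots of multilinear forms. -/
noncomputable def substSlots (E : Type) [NormedAddCommGroup E] [NormedSpace ℝ E] (k : ℕ) :
    ContinuousMultilinearMap ℝ (fun _ : Fin k => E →L[ℝ] E) (FormSpace E k →L[ℝ] FormSpace E k) :=
  ContinuousMultilinearMap.compContinuousLinearMapContinuousMultilinear ℝ (fun _ : Fin k => E)
    (fun _ : Fin k => E) ℂ

/-- Substitution of a linear map into all the slots of multilinear forms. -/
noncomputable def substForm (E : Type) [NormedAddCommGroup E] [NormedSpace ℝ E] (k : ℕ)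
    (g : E →L[ℝ] E) : FormSpace E k →L[ℝ] FormSpace E k :=
  substSlots E k (fun _ => g)

theorem contDiff_substForm {k : ℕ} {g : X → E →L[ℝ] E} (hg : ContDiff ℝ ∞ g) :
    ContDiff ℝ ∞ (fun x => substForm E k (g x)) :=
  (ContinuousMultilinearMap.contDiff _).comp (contDiff_pi.2 fun _ => hg)

theorem contDiff_apply_diag {k : ℕ} {Λ : X → FormSpace E k} (hΛ : ContDiff ℝ ∞ Λ) {v : X → E}
    (hv : ContDiff ℝ ∞ v) : ContDiff ℝ ∞ (fun x => Λ x (fun _ => v x)) := by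
  have hΛ' : ContDiff ℝ ∞ (F := E [×k]→L[ℝ] ℂ) Λ := hΛ
  have e : (fun x => Λ x (fun _ => v x)) = fun x =>
      (ContinuousMultilinearMap.apply ℝ (fun _ : Fin k => ℝ) ℂ (fun _ => 1))
        ((ContinuousMultilinearMap.compContinuousLinearMapContinuousMultilinear ℝ
          (fun _ : Fin k => ℝ) (fun _ : Fin k => E) ℂ
          (fun _ => ContinuousLinearMap.toSpanSingleton ℝ (v x))) (Λ x)) := by
    funext x
    change _ = Λ x (fun _ => (1 : ℝ) • v x)
    simp
  rw [e]
  refine (ContinuousLinearMap.contDiff _).comp (ContDiff.clm_apply ?_ hΛ')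
  refine (ContinuousMultilinearMap.contDiff _).comp (contDiff_pi.2 fun _ => ?_)
  exact (ContinuousLinearMap.toSpanSingletonCLE (𝕜 := ℝ) (E := E)).contDiff.comp hv

theorem apply_diag_smul {k : ℕ} (Λ : FormSpace E k) (t : ℝ) (v : E) :
    Λ (fun _ => t • v) = (t : ℂ) ^ k * Λ (fun _ => v) := by
  have := ContinuousMultilinearMap.map_smul_univ (show E [×k]→L[ℝ] ℂ from Λ) (fun _ => t)
    (fun _ => v)
  refine this.trans ?_
  change (∏ _i : Fin k, t) • Λ (fun _ => v) = _
  simp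

/-- Substitution is contravariant, hence the reversed order of the factors in each slot. -/
theorem substSlots_mul {k : ℕ} (a b : Fin k → (E →L[ℝ] E)) :
    substSlots E k a * substSlots E k b = substSlots E k (fun i => b i * a i) := rfl

theorem substSlots_one {k : ℕ} : substSlots E k (fun _ => 1) = 1 := rfl

theorem substSlots_pow {k : ℕ} (a : Fin k → (E →L[ℝ] E)) (N : ℕ) :
    substSlots E k a ^ N = substSlots E k (fun i => a i ^ N) := by
  induction N with
  | zero => simp_rw [pow_zero]; exact substSlots_one.symm
  | succ N ih => rw [pow_succ, ih, substSlots_mul]; simp_rw [pow_succ']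

/-- Substitution of unipotent maps is unipotent. -/
theorem isNilpotent_substForm_sub_one {k : ℕ} {g : E →L[ℝ] E} (hg : IsNilpotent (g - 1)) :
    IsNilpotent (substForm E k g - 1) := by
  classical
  obtain ⟨n, hn⟩ : ∃ n, g = 1 + n := ⟨g - 1, by abel⟩
  have hn' : IsNilpotent n := by rwa [hn, add_sub_cancel_left] at hg
  -- Writing `g = 1 + n` and expanding by multilinearity gives one term per subset of slots, namely
  -- the slots that keep `1`; the full set contributes the identity.
  have hsum : substForm E k g =
      ∑ s : Finset (Fin k), substSlots E k (s.piecewise (fun _ => 1) (fun _ => n)) := by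
    rw [substForm, hn]
    exact (substSlots E k).toMultilinearMap.map_add_univ (fun _ => 1) (fun _ => n)
  have h1 : substSlots E k ((Finset.univ : Finset (Fin k)).piecewise (fun _ => 1) (fun _ => n)) = 1 := by
    rw [Finset.piecewise_univ, substSlots_one]
  rw [hsum, ← Finset.add_sum_erase _ _ (Finset.mem_univ Finset.univ), h1, add_sub_cancel_left]
  -- Each remaining term has `n` in some slot, so a power of it has a zero slot. The terms commute
  -- because in every slot only `1` and `n` occur.
  refine Commute.isNilpotent_sum (fun s hs => ?_) fun s t _ _ => ?_
  · obtain ⟨i, hi⟩ : ∃ i, i ∉ s := by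
      by_contra! h
      exact (Finset.mem_erase.1 hs).1 (Finset.eq_univ_iff_forall.2 h)
    obtain ⟨N, hN⟩ := hn'
    refine ⟨N, ?_⟩
    rw [substSlots_pow]
    refine (substSlots E k).map_coord_zero i ?_
    rw [Finset.piecewise_eq_of_notMem _ _ _ hi, hN]
  · rw [Commute, SemiconjBy, substSlots_mul, substSlots_mul]
    congr 1
    funext i
    by_cases h1 : i ∈ s <;> by_cases h2 : i ∈ t <;> simp [h1, h2]

/-- Multiplication of forms by a complex number. -/
noncomputable def scalarForm (E : Type) [NormedAddCommGroup E] [NormedSpace ℝ E] (k : ℕ) :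
    ℂ →L[ℝ] FormSpace E k →L[ℝ] FormSpace E k :=
  ContinuousLinearMap.lsmul ℝ ℂ

theorem scalarForm_mul {k : ℕ} (a b : ℂ) :
    scalarForm E k a * scalarForm E k b = scalarForm E k (a * b) := by
  ext1 Λ
  exact smul_smul a b Λ

theorem scalarForm_one {k : ℕ} : scalarForm E k 1 = 1 := by
  ext1 Λ
  exact one_smul ℂ Λ

/-- With `R` the substitution, `1 - c R = (1 - c) - c (R - 1)` is an invertible scalar plus a
commuting nilpotent operator. This is the only place where unipotence and `c ≠ 1` are combined. -/
theorem isUnit_one_sub_scalarForm_mul {k : ℕ} {g : E →L[ℝ] E} (hg : IsNilpotent (g - 1)) {c : ℂ}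
    (hc : c ≠ 1) : IsUnit (1 - scalarForm E k c * substForm E k g) := by
  have hcomm : ∀ (a : ℂ), Commute (scalarForm E k a) (substForm E k g - 1) := fun a =>
    Commute.sub_right (show scalarForm E k a * substForm E k g = substForm E k g * scalarForm E k a
      from rfl) (Commute.one_right _)
  have hc' : 1 - c ≠ 0 := sub_ne_zero.2 hc.symm
  have hu : IsUnit (scalarForm E k (1 - c)) := by
    refine ⟨⟨scalarForm E k (1 - c), scalarForm E k (1 - c)⁻¹, ?_, ?_⟩, rfl⟩
    · rw [scalarForm_mul, mul_inv_cancel₀ hc', scalarForm_one]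
    · rw [scalarForm_mul, inv_mul_cancel₀ hc', scalarForm_one]
  have hn := isNilpotent_substForm_sub_one (k := k) hg
  have e : 1 - scalarForm E k c * substForm E k g =
      scalarForm E k (1 - c) + (-(scalarForm E k c * (substForm E k g - 1))) := by
    rw [map_sub, scalarForm_one, mul_sub, mul_one]
    abel
  rw [e]
  refine IsNilpotent.isUnit_add_left_of_commute ?_ hu ?_
  · exact ((hcomm c).isNilpotent_mul_left hn).neg
  · refine Commute.neg_left (Commute.mul_left ?_ (hcomm (1 - c)).symm)
    rw [Commute, SemiconjBy, scalarForm_mul, scalarForm_mul, mul_comm]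

/-- In a basis the determinant is a polynomial in the matrix entries. -/
theorem contDiff_det : ContDiff ℝ ∞ (fun A : E →L[ℝ] E => A.det) := by
  classical
  let b := Module.finBasis ℝ E
  have e : (fun A : E →L[ℝ] E => A.det) = fun A : E →L[ℝ] E =>
      ∑ σ : Equiv.Perm (Fin (Module.finrank ℝ E)), ((Equiv.Perm.sign σ : ℤ) : ℝ) *
        ∏ i, b.repr (A (b i)) (σ i) := by
    funext A
    rw [ContinuousLinearMap.det, ← LinearMap.det_toMatrix b, Matrix.det_apply']
    simp [LinearMap.toMatrix_apply]
  rw [e]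
  refine ContDiff.sum fun σ _ => contDiff_const.mul (contDiff_prod fun i _ => ?_)
  let l : (E →L[ℝ] E) →ₗ[ℝ] ℝ :=
    { toFun := fun A => b.repr (A (b i)) (σ i)
      map_add' := by intros; simp
      map_smul' := by intros; simp }
  have hl : Continuous l := by
    have h1 : Continuous (b.coord (σ i)) := LinearMap.continuous_of_finiteDimensional _
    exact h1.comp (ContinuousLinearMap.apply ℝ E (b i)).continuous
  exact (ContinuousLinearMap.contDiff (⟨l, hl⟩ : (E →L[ℝ] E) →L[ℝ] ℝ))

/-- For `n = A - 1`, the determinant of `1 - (-n)` is the characteristic polynomial of the nilpotent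
map `-n`, a power of `X`, evaluated at `1`. -/
theorem det_eq_one_of_isNilpotent {A : E →L[ℝ] E} (hA : IsNilpotent (A - 1)) : A.det = 1 := by
  set n : Module.End ℝ E := ((A - 1 : E →L[ℝ] E) : E →ₗ[ℝ] E) with hn
  have h1 : IsNilpotent n := by
    obtain ⟨N, hN⟩ := hA
    refine ⟨N, ?_⟩
    have := congrArg (ContinuousLinearMap.toLinearMapRingHom (R₁ := ℝ) (M₁ := E)) hN
    rw [map_pow, map_zero] at this
    exact this
  have h2 : IsNilpotent (-n) := h1.neg
  have h3 := h2.charpoly_eq_X_pow_finrank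
  have h5 : (A : E →ₗ[ℝ] E) = algebraMap ℝ (Module.End ℝ E) 1 - (-n) := by
    ext v; simp [hn]
  rw [ContinuousLinearMap.det, h5, ← LinearMap.eval_charpoly, h3]
  simp

end Forms


/-! ### Pull-back and push-forward of densities on a vector space -/

section Push

variable {G E F : Type} [NormedAddCommGroup G] [NormedSpace ℝ G] [FiniteDimensional ℝ G]
  [NormedAddCommGroup E] [NormedSpace ℝ E] [FiniteDimensional ℝ E]
  [NormedAddCommGroup F] [NormedSpace ℝ F]

/-- `θ` is the push-forward under `g` of the density `ψ`. -/
def IsPush (g : E → E) (ψ θ : E → ℂ) : Prop :=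
  (∀ y ∈ tsupport ψ, ((|(fderiv ℝ g y).det| : ℝ) : ℂ) * θ (g y) = ψ y) ∧
    ∀ z ∉ g '' tsupport ψ, θ z = 0

theorem contDiffAt_abs_det {X : Type} [NormedAddCommGroup X] [NormedSpace ℝ X]
    {A : X → E →L[ℝ] E} {x : X} (hA : ContDiffAt ℝ ∞ A x) (h : (A x).det ≠ 0) :
    ContDiffAt ℝ ∞ (fun y => |(A y).det|) x :=
  ContDiffAt.comp (g := fun t : ℝ => |t|) (f := fun y => (A y).det) x (contDiffAt_abs h)
    (contDiff_det.contDiffAt.comp x hA)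

theorem det_ne_zero_iff_injective {A : E →L[ℝ] E} : A.det ≠ 0 ↔ ∀ v, A v = 0 → v = 0 := by
  rw [ContinuousLinearMap.det, ← isUnit_iff_ne_zero, ← LinearMap.isUnit_iff_isUnit_det,
    LinearMap.isUnit_iff_ker_eq_bot, LinearMap.ker_eq_bot']
  rfl

/-- The inverse function theorem. -/
theorem exists_local_inverse {g : E → E} (hg : ContDiff ℝ ∞ g) {y₀ : E}
    (hdet : (fderiv ℝ g y₀).det ≠ 0) :
    ∃ e : OpenPartialHomeomorph E E, (⇑e = g) ∧ y₀ ∈ e.source ∧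
      (∀ y ∈ e.source, (fderiv ℝ g y).det ≠ 0) ∧ ContDiffOn ℝ ∞ e.symm e.target := by
  have hd : ∀ (y : E) (h : (fderiv ℝ g y).det ≠ 0), HasFDerivAt g
      (((fderiv ℝ g y).toContinuousLinearEquivOfDetNeZero h : E ≃L[ℝ] E) : E →L[ℝ] E) y := by
    intro y h
    rw [ContinuousLinearMap.coe_toContinuousLinearEquivOfDetNeZero]
    exact ((hg.differentiable (by simp)) y).hasFDerivAt
  let e₀ := hg.contDiffAt.toOpenPartialHomeomorph g (hd y₀ hdet) (by simp)
  have hopen : IsOpen {y | (fderiv ℝ g y).det ≠ 0} := by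
    have : Continuous (fun y => (fderiv ℝ g y).det) :=
      contDiff_det.continuous.comp (hg.continuous_fderiv (by simp))
    exact isOpen_ne_fun this continuous_const
  -- The source is shrunk to points with invertible derivative, so that the inverse is smooth on the
  -- whole target and not only at the image of `y₀`.
  let e := e₀.restrOpen _ hopen
  have hes : ∀ y ∈ e.source, (fderiv ℝ g y).det ≠ 0 := fun y hy => hy.2
  refine ⟨e, rfl, ⟨hg.contDiffAt.mem_toOpenPartialHomeomorph_source _ _, hdet⟩, hes, ?_⟩
  intro z hz
  have hy := e.map_target hz
  exact (e.contDiffAt_symm hz (hd _ (hes _ hy)) hg.contDiffAt).contDiffWithinAt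

/-- Pull-back of densities under a local diffeomorphism. -/
theorem exists_pullback {g : E → E} (hg : ContDiff ℝ ∞ g) {y₀ : E} (hg0 : g y₀ = y₀)
    (hdet : (fderiv ℝ g y₀).det ≠ 0) :
    ∃ r₀ > 0, (∀ y ∈ Metric.ball y₀ r₀, (fderiv ℝ g y).det ≠ 0) ∧
      ∀ r, 0 < r → r ≤ r₀ → ∃ s > 0, s ≤ r ∧ ∀ Θ : E → F, ContDiff ℝ ∞ Θ →
        tsupport Θ ⊆ Metric.ball y₀ s →
          ∃ Ψ : E → F, ContDiff ℝ ∞ Ψ ∧ tsupport Ψ ⊆ Metric.ball y₀ r ∧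
            (∀ y ∈ Metric.ball y₀ r, Ψ y = |(fderiv ℝ g y).det| • Θ (g y)) ∧
            ∀ z, Θ z ≠ 0 → ∃ y ∈ Metric.ball y₀ r, g y = z := by
  classical
  obtain ⟨e, rfl, hy₀, hd, -⟩ := exists_local_inverse hg hdet
  obtain ⟨r₀, hr₀, hball⟩ := Metric.isOpen_iff.1 e.open_source _ hy₀
  refine ⟨r₀, hr₀, fun y hy => hd y (hball hy), fun r hr hrr => ?_⟩
  have hb : Metric.ball y₀ r ⊆ e.source := (Metric.ball_subset_ball hrr).trans hball
  have himg : IsOpen (e '' Metric.ball y₀ r) :=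
    e.isOpen_image_of_subset_source Metric.isOpen_ball hb
  -- The radius `s` is chosen so that the small ball lies in the image of the ball of radius `r`:
  -- every point where `Θ` is nonzero then has a preimage there.
  obtain ⟨s, hs, hsb⟩ := Metric.isOpen_iff.1 himg (e y₀) ⟨y₀, Metric.mem_ball_self hr, rfl⟩
  rw [hg0] at hsb
  refine ⟨min s r, by positivity, min_le_right _ _, fun Θ hΘ hΘs => ?_⟩
  have hΘs' : tsupport Θ ⊆ e '' Metric.ball y₀ r :=
    hΘs.trans ((Metric.ball_subset_ball (min_le_left _ _)).trans hsb)
  have hΘt : tsupport Θ ⊆ e.target := hΘs'.trans (by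
    rintro _ ⟨y, hy, rfl⟩; exact e.map_source (hb hy))
  have hΘc : IsCompact (tsupport Θ) :=
    (isCompact_closedBall y₀ (min s r)).of_isClosed_subset (isClosed_tsupport _)
      (hΘs.trans Metric.ball_subset_closedBall)
  set L : Set E := e.symm '' tsupport Θ with hL
  have hLc : IsCompact L := hΘc.image_of_continuousOn (e.continuousOn_symm.mono hΘt)
  have hLb : L ⊆ Metric.ball y₀ r := by
    rintro _ ⟨z, hz, rfl⟩
    obtain ⟨y, hy, rfl⟩ := hΘs' hz
    rwa [e.left_inv (hb hy)]
  let Ψ : E → F := fun y => if y ∈ Metric.ball y₀ r then |(fderiv ℝ e y).det| • Θ (e y) else 0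
  have hΨ0 : ∀ y ∉ L, Ψ y = 0 := by
    intro y hy
    by_cases hyb : y ∈ Metric.ball y₀ r
    · have : Θ (e y) = 0 := by
        refine image_eq_zero_of_notMem_tsupport fun h => hy ⟨e y, h, e.left_inv (hb hyb)⟩
      simp [Ψ, this]
    · simp only [Ψ, if_neg hyb]
  refine ⟨Ψ, ?_, ?_, fun y hy => by simp only [Ψ, if_pos hy], ?_⟩
  · refine contDiff_of_eq_zero Metric.isOpen_ball hLc.isClosed hLb ?_ hΨ0
    refine ContDiffOn.congr (f := fun y => |(fderiv ℝ e y).det| • Θ (e y)) ?_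
      (fun y hy => by simp only [Ψ, if_pos hy])
    intro y hy
    exact ((contDiffAt_abs_det (hg.fderiv_right (m := ∞) (by simp)).contDiffAt
      (hd y (hb hy))).smul (hΘ.comp hg).contDiffAt).contDiffWithinAt
  · refine (closure_minimal (fun y hy => ?_) hLc.isClosed).trans hLb
    by_contra h
    exact hy (hΨ0 y h)
  · intro z hz
    exact hΘs' (subset_tsupport _ hz)

/-- Push-forward of a smooth family of densities under a smooth family of local diffeomorphisms. -/
theorem exists_push_family {g : G × E → E} (hg : ContDiff ℝ ∞ g) {p₀ : G × E}
    (hdet : (fderiv ℝ (fun y => g (p₀.1, y)) p₀.2).det ≠ 0) :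
    ∃ r₀ > 0, (∀ b, InjOn (fun y => g (b, y)) {y | (b, y) ∈ Metric.ball p₀ r₀}) ∧
      ∀ Ψ : G × E → ℂ, ContDiff ℝ ∞ Ψ → tsupport Ψ ⊆ Metric.ball p₀ r₀ →
        ∃ Θ : G × E → ℂ, ContDiff ℝ ∞ Θ ∧
          tsupport Θ ⊆ (fun p : G × E => (p.1, g p)) '' tsupport Ψ ∧
          ∀ b, IsPush (fun y => g (b, y)) (fun y => Ψ (b, y)) (fun y => Θ (b, y)) := by
  classical
  -- Keeping the parameter as a coordinate gives a single local diffeomorphism, so one inverse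
  -- serves the whole family. Its derivative is block triangular, hence invertible exactly when the
  -- derivative of `g` in the second variable is.
  set Φ : G × E → G × E := fun p => (p.1, g p) with hΦ
  have hΦs : ContDiff ℝ ∞ Φ := contDiff_fst.prodMk hg
  have hDg : ∀ p : G × E, fderiv ℝ (fun y => g (p.1, y)) p.2 =
      (fderiv ℝ g p).comp (ContinuousLinearMap.inr ℝ G E) := fun p =>
    (((hg.differentiable (by simp)) p).hasFDerivAt.comp p.2
      (hasFDerivAt_prodMk_right p.1 p.2)).fderiv
  have hDΦ : ∀ p, fderiv ℝ Φ p = (ContinuousLinearMap.fst ℝ G E).prod (fderiv ℝ g p) := fun p =>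
    (hasFDerivAt_fst.prodMk ((hg.differentiable (by simp)) p).hasFDerivAt).fderiv
  have hdet_iff : ∀ p, (fderiv ℝ Φ p).det ≠ 0 ↔ (fderiv ℝ (fun y => g (p.1, y)) p.2).det ≠ 0 := by
    intro p
    rw [det_ne_zero_iff_injective, det_ne_zero_iff_injective, hDg, hDΦ]
    constructor
    · intro h v hv
      exact (Prod.ext_iff.1 (h (0, v) (Prod.ext rfl hv))).2
    · rintro h ⟨u, v⟩ huv
      obtain ⟨h1, h2⟩ := Prod.ext_iff.1 huv
      obtain rfl : u = 0 := h1
      rw [h v h2]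
      rfl
  obtain ⟨e, he, hp₀, hd, hsymm⟩ := exists_local_inverse hΦs ((hdet_iff p₀).2 hdet)
  obtain ⟨r₀, hr₀, hball⟩ := Metric.isOpen_iff.1 e.open_source _ hp₀
  refine ⟨r₀, hr₀, ?_, fun Ψ hΨ hΨs => ?_⟩
  · intro b y hy y' hy' h
    have : e (b, y) = e (b, y') := by rw [he]; exact Prod.ext rfl h
    exact (Prod.ext_iff.1 (e.injOn (hball hy) (hball hy') this)).2
  have hΨsrc := hΨs.trans hball
  have hΨc : IsCompact (tsupport Ψ) :=
    (isCompact_closedBall p₀ r₀).of_isClosed_subset (isClosed_tsupport _)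
      (hΨs.trans Metric.ball_subset_closedBall)
  have hLc : IsCompact (Φ '' tsupport Ψ) := hΨc.image hΦs.continuous
  let D : G × E → ℝ := fun p => |((fderiv ℝ g p).comp (ContinuousLinearMap.inr ℝ G E)).det|
  have hD0 : ∀ p ∈ e.source, D p ≠ 0 := fun p hp => by
    have := (hdet_iff p).1 (hd p hp)
    rw [hDg] at this
    exact abs_ne_zero.2 this
  let Θ : G × E → ℂ := fun q =>
    if q ∈ e.target then (D (e.symm q))⁻¹ • Ψ (e.symm q) else 0
  have hΘ0 : ∀ q ∉ Φ '' tsupport Ψ, Θ q = 0 := by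
    intro q hq
    by_cases hqt : q ∈ e.target
    · have : Ψ (e.symm q) = 0 := by
        refine image_eq_zero_of_notMem_tsupport fun h => hq ⟨e.symm q, h, ?_⟩
        rw [← he, e.right_inv hqt]
      simp [Θ, this]
    · simp only [Θ, if_neg hqt]
  have hΘe : ∀ p ∈ e.source, Θ (Φ p) = (D p)⁻¹ • Ψ p := by
    intro p hp
    have h1 : Φ p ∈ e.target := by rw [← he]; exact e.map_source hp
    have h2 : e.symm (Φ p) = p := by rw [← he]; exact e.left_inv hp
    simp only [Θ, if_pos h1, h2]
  refine ⟨Θ, ?_, ?_, fun b => ⟨fun y hy => ?_, fun z hz => ?_⟩⟩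
  · refine contDiff_of_eq_zero e.open_target hLc.isClosed ?_ ?_ hΘ0
    · rw [← he]
      rintro _ ⟨p, hp, rfl⟩
      exact e.map_source (hΨsrc hp)
    · refine ContDiffOn.congr (f := fun q => (D (e.symm q))⁻¹ • Ψ (e.symm q)) ?_
        (fun q hq => by simp only [Θ, if_pos hq])
      have hinner : ContDiffOn ℝ ∞ (fun p => (D p)⁻¹ • Ψ p) e.source := by
        intro p hp
        have hdp : ((fderiv ℝ g p).comp (ContinuousLinearMap.inr ℝ G E)).det ≠ 0 := by
          rw [← hDg]; exact (hdet_iff p).1 (hd p hp)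
        have h1 : ContDiffAt ℝ ∞ D p := by
          refine contDiffAt_abs_det (A := fun p => (fderiv ℝ g p).comp
            (ContinuousLinearMap.inr ℝ G E)) ?_ hdp
          exact ((hg.fderiv_right (m := ∞) (by simp)).clm_comp contDiff_const).contDiffAt
        exact ((h1.inv (hD0 p hp)).smul hΨ.contDiffAt).contDiffWithinAt
      exact hinner.comp hsymm (fun q hq => e.map_target hq)
  · refine closure_minimal (fun q hq => ?_) hLc.isClosed
    by_contra h
    exact hq (hΘ0 q h)
  · have hy' : (b, y) ∈ tsupport Ψ := by
      have hc : Continuous (fun y : E => (b, y)) := by fun_prop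
      exact tsupport_comp_subset_preimage (f := fun y : E => (b, y)) Ψ hc hy
    have h1 := hΘe (b, y) (hΨsrc hy')
    change ((|(fderiv ℝ (fun y => g (b, y)) y).det| : ℝ) : ℂ) * Θ (Φ (b, y)) = Ψ (b, y)
    rw [h1, hDg (b, y)]
    change ((D (b, y) : ℝ) : ℂ) * _ = _
    have h2 : ((D (b, y) : ℝ) : ℂ) ≠ 0 := by exact_mod_cast hD0 (b, y) (hΨsrc hy')
    rw [Complex.real_smul, Complex.ofReal_inv, mul_inv_cancel_left₀ h2]
  · by_contra hne
    have hmem : (b, z) ∈ Φ '' tsupport Ψ := by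
      by_contra h
      exact hne (hΘ0 _ h)
    obtain ⟨⟨b', y⟩, hp, hpe⟩ := hmem
    obtain ⟨h1, h2⟩ := Prod.ext_iff.1 hpe
    obtain rfl : b' = b := h1
    have h3 := hΘe (b', y) (hΨsrc hp)
    rw [hpe] at h3
    have h4 : Ψ (b', y) ≠ 0 := by
      intro h
      rw [h, smul_zero] at h3
      exact hne h3
    exact hz ⟨y, subset_tsupport (fun y => Ψ (b', y)) h4, h2⟩

/-- Change of variables. Injectivity is needed only on the closed support of `ψ`, since both
integrands vanish off it and off its image. -/
theorem IsPush.integral_eq [MeasurableSpace E] [BorelSpace E] (μ : Measure E) [μ.IsAddHaarMeasure]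
    {g : E → E} (hg : ContDiff ℝ ∞ g) {ψ θ : E → ℂ} (h : IsPush g ψ θ)
    (hinj : InjOn g (tsupport ψ)) (k : E → ℂ) :
    ∫ z, θ z * k z ∂μ = ∫ y, ψ y * k (g y) ∂μ := by
  have hS : MeasurableSet (tsupport ψ) := (isClosed_tsupport ψ).measurableSet
  rw [← setIntegral_eq_integral_of_forall_compl_eq_zero (s := g '' tsupport ψ)
      (fun z hz => by rw [h.2 z hz, zero_mul]),
    integral_image_eq_integral_abs_det_fderiv_smul μ hS
      (fun x _ => ((hg.differentiable (by simp)) x).hasFDerivAt.hasFDerivWithinAt) hinj,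
    ← setIntegral_eq_integral_of_forall_compl_eq_zero (s := tsupport ψ)
      (f := fun y => ψ y * k (g y))
      (fun z hz => by rw [image_eq_zero_of_notMem_tsupport hz, zero_mul])]
  refine setIntegral_congr_fun hS fun y hy => ?_
  rw [← h.1 y hy, Complex.real_smul, mul_assoc]

end Push


/-! ### Descending induction on the transversal degree under a unipotent map -/

section Vanishing

variable {E : Type} [NormedAddCommGroup E] [NormedSpace ℝ E] [FiniteDimensional ℝ E]

/-- Contraction of a family of `k`-forms depending linearly on a vector to `(k + 1)`-forms. -/
noncomputable def uncurryForm (E : Type) [NormedAddCommGroup E] [NormedSpace ℝ E] (k : ℕ) :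
    (E →L[ℝ] FormSpace E k) →L[ℝ] FormSpace E (k + 1) :=
  ((continuousMultilinearCurryLeftEquiv ℝ (fun _ : Fin (k + 1) => E) ℂ).symm.toContinuousLinearEquiv :
    (E →L[ℝ] (E [×k]→L[ℝ] ℂ)) →L[ℝ] (E [×(k + 1)]→L[ℝ] ℂ))

/-- The line `w + t v` stays in the kernel, where `T` is the identity for small `t`; differentiate
at `t = 0`. -/
theorem fderiv_apply_of_eq_on_kernel {Q : E →L[ℝ] E} {T : E → E} (hT : ContDiff ℝ ∞ T) {w v : E}
    (hw : ∀ᶠ y in 𝓝 w, Q y = 0 → T y = y) (hQw : Q w = 0) (hv : Q v = 0) :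
    fderiv ℝ T w v = v := by
  have h1 : HasDerivAt (fun t : ℝ => w + t • v) v 0 := by
    simpa using ((hasDerivAt_id (0 : ℝ)).smul_const v).const_add w
  have h0 : w + (0 : ℝ) • v = w := by simp
  have h2 : HasDerivAt (fun t : ℝ => T (w + t • v)) (fderiv ℝ T w v) 0 := by
    have := ((hT.differentiable (by simp)) (w + (0 : ℝ) • v)).hasFDerivAt.comp_hasDerivAt 0 h1
    rwa [h0] at this
  refine h2.unique (h1.congr_of_eventuallyEq ?_)
  have hc : Tendsto (fun t : ℝ => w + t • v) (𝓝 0) (𝓝 w) := by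
    have : Continuous (fun t : ℝ => w + t • v) := by fun_prop
    simpa using this.tendsto 0
  filter_upwards [hc.eventually hw] with t ht
  exact ht (by simp [hQw, hv])

/-- `f` kills the functions which are given by a `k`-form in the normal coordinate `Q y`, near
`y₀`. -/
def KillsForms (f : (E → ℂ) →ₗ[ℂ] ℂ) (Q : E →L[ℝ] E) (y₀ : E) (k : ℕ) : Prop :=
  ∃ r > 0, ∀ Λ : E → FormSpace E k, ContDiff ℝ ∞ Λ → tsupport Λ ⊆ Metric.ball y₀ r →
    f (fun y => Λ y (fun _ => Q y)) = 0

/-- A form-valued function vanishing on the kernel of `Q` is divisible by `Q y`. -/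
theorem KillsForms.apply_eq_zero {f : (E → ℂ) →ₗ[ℂ] ℂ} {P Q : E →L[ℝ] E} {y₀ : E} {k : ℕ}
    (hPQ : ∀ y, P y + Q y = y) {r : ℝ} (hr : 0 < r)
    (hf : ∀ Λ : E → FormSpace E (k + 1), ContDiff ℝ ∞ Λ → tsupport Λ ⊆ Metric.ball y₀ r →
      f (fun y => Λ y (fun _ => Q y)) = 0) {Λ : E → FormSpace E k} (hΛ : ContDiff ℝ ∞ Λ)
    (hs : tsupport Λ ⊆ Metric.ball y₀ (r / 2)) (h0 : ∀ y, Λ (P y) = 0) :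
    f (fun y => Λ y (fun _ => Q y)) = 0 := by
  -- The quotient provided by Hadamard's lemma need not have small support, so it is multiplied by a
  -- cutoff equal to `1` on the ball containing the support of `Λ`.
  obtain ⟨η, hη, hη1, hηs, -⟩ := exists_smooth_cutoff y₀ hr
  have h := hf (fun y => η y • uncurryForm E k (hadamard P Q Λ y))
    (hη.smul ((uncurryForm E k).contDiff.comp (contDiff_hadamard P Q hΛ)))
    ((tsupport_smul_subset_left η _).trans hηs)
  refine Eq.trans (congrArg f (funext fun y => ?_)) h
  have e1 : (η y • uncurryForm E k (hadamard P Q Λ y)) (fun _ => Q y) =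
      η y • (hadamard P Q Λ y (Q y)) (fun _ => Q y) := rfl
  rw [e1, hadamard_apply P Q hΛ, hPQ, h0, sub_zero]
  by_cases hy : y ∈ tsupport Λ
  · rw [hη1 y (hs hy), one_smul]
  · rw [image_eq_zero_of_notMem_tsupport hy]
    change (0 : ℂ) = η y • 0
    rw [smul_zero]

/-- Data of a smooth map fixing a linear subspace (the kernel of `Q`) near `y₀`, with unipotent
derivative there, under which `f` is multiplied by `c`. -/
structure UnipotentInvariance (f : (E → ℂ) →ₗ[ℂ] ℂ) (P Q : E →L[ℝ] E) (T : E → E) (c : E → ℂ)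
    (y₀ : E) : Prop where
  add_eq : ∀ y, P y + Q y = y
  idem : ∀ y, P (P y) = P y
  base : Q y₀ = 0
  smooth : ContDiff ℝ ∞ T
  smooth_mul : ContDiff ℝ ∞ c
  fixes : ∀ᶠ y in 𝓝 y₀, Q y = 0 → T y = y
  unipotent : ∀ᶠ y in 𝓝 y₀, Q y = 0 → IsNilpotent (fderiv ℝ T y - 1)
  ne_one : c y₀ ≠ 1
  transform : ∃ r > 0, ∀ ψ θ : E → ℂ, ContDiff ℝ ∞ ψ → ContDiff ℝ ∞ θ →
    tsupport ψ ⊆ Metric.ball y₀ r → IsPush T ψ θ → f θ = f (fun y => c y * ψ y)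

namespace UnipotentInvariance

variable {f : (E → ℂ) →ₗ[ℂ] ℂ} {P Q : E →L[ℝ] E} {T : E → E} {c : E → ℂ} {y₀ : E}

/-- The matrix `B y` such that `Q (T y) = B y (Q y)`. -/
noncomputable def normalPart (P Q : E →L[ℝ] E) (T : E → E) (y : E) : E →L[ℝ] E :=
  1 + Q * (hadamard P Q T y - 1) * Q

theorem contDiff_normalPart (hT : ContDiff ℝ ∞ T) : ContDiff ℝ ∞ (normalPart P Q T) := by
  refine contDiff_const.add (ContDiff.mul (contDiff_const.mul ?_) contDiff_const)
  exact (contDiff_hadamard P Q hT).sub contDiff_const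

variable (h : UnipotentInvariance f P Q T c y₀)
include h

theorem Q_P (y : E) : Q (P y) = 0 := by
  have := h.add_eq (P y)
  rw [h.idem] at this
  simpa using this

theorem P_Q (y : E) : P (Q y) = 0 := by
  have h1 := congrArg P (h.add_eq y)
  rw [map_add, h.idem] at h1
  simpa using h1

theorem Q_Q (y : E) : Q (Q y) = Q y := by
  have := h.add_eq (Q y)
  rwa [h.P_Q, zero_add] at this

theorem P_of_Q_eq_zero {y : E} (hy : Q y = 0) : P y = y := by
  have := h.add_eq y
  rwa [hy, add_zero] at this

/-- Hadamard's lemma writes `T y - T (P y)` as a matrix applied to `Q y`; since `T (P y) = P y` is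
killed by `Q`, applying `Q` leaves `Q (T y)`. -/
theorem normalPart_apply {y : E} (hy : T (P y) = P y) :
    normalPart P Q T y (Q y) = Q (T y) := by
  change Q y + Q (hadamard P Q T y (Q (Q y)) - Q (Q y)) = Q (T y)
  rw [h.Q_Q, hadamard_apply P Q h.smooth, h.add_eq, hy]
  simp [h.Q_P, h.Q_Q]

/-- At a point of the kernel the Hadamard average is the derivative itself. With `X` this derivative
minus one, `X` vanishes on the range of `P`, so `X Q = X`; therefore `(Q X)^(N+1) = Q X^(N+1)`, and
nilpotence of `X` passes to `Q X`. -/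
theorem isNilpotent_normalPart {w : E} (hw : ∀ᶠ y in 𝓝 w, Q y = 0 → T y = y) (hQw : Q w = 0)
    (hn : IsNilpotent (fderiv ℝ T w - 1)) : IsNilpotent (normalPart P Q T w - 1) := by
  set X := fderiv ℝ T w - 1 with hX
  have e0 : hadamard P Q T w = fderiv ℝ T w := by
    simp [hadamard, h.P_of_Q_eq_zero hQw, hQw]
  have hXQ : X * Q = X := by
    ext v
    have h1 : X (P v) = 0 := by
      change fderiv ℝ T w (P v) - P v = 0
      rw [fderiv_apply_of_eq_on_kernel h.smooth hw hQw (h.Q_P v), sub_self]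
    have h2 := congrArg X (h.add_eq v)
    rw [map_add, h1, zero_add] at h2
    exact h2
  have e1 : normalPart P Q T w - 1 = Q * X := by
    rw [normalPart, e0, add_sub_cancel_left, mul_assoc, ← hX, hXQ]
  have hpow : ∀ N : ℕ, (Q * X) ^ (N + 1) = Q * X ^ (N + 1) := by
    intro N
    induction N with
    | zero => simp
    | succ N ih =>
      have e2 : X ^ (N + 1) * (Q * X) = X ^ (N + 1) * X := by
        rw [pow_succ, mul_assoc, ← mul_assoc X Q X, hXQ]
        simp only [mul_assoc]
      rw [pow_succ, ih, pow_succ X (N + 1), mul_assoc, e2]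
  obtain ⟨N, hN⟩ := hn
  refine ⟨N + 1, ?_⟩
  rw [e1, hpow, pow_succ, hN, zero_mul, mul_zero]

/-- The equation `Λ' - c (T^* Λ') = Λ` can be solved for forms. -/
theorem exists_resolvent (k : ℕ) : ∃ M : E → (FormSpace E k →L[ℝ] FormSpace E k), ContDiff ℝ ∞ M ∧
    ∀ᶠ y in 𝓝 y₀, ∀ Λ : FormSpace E k,
      M y Λ - c y • substForm E k (normalPart P Q T y) (M y Λ) = Λ := by
  set A : E → (FormSpace E k →L[ℝ] FormSpace E k) := fun y =>
    1 - scalarForm E k (c y) * substForm E k (normalPart P Q T y) with hA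
  have hAs : ContDiff ℝ ∞ A := by
    refine contDiff_const.sub (ContDiff.mul ((scalarForm E k).contDiff.comp h.smooth_mul) ?_)
    exact contDiff_substForm (contDiff_normalPart h.smooth)
  have hu : IsUnit (A y₀) := isUnit_one_sub_scalarForm_mul
    (h.isNilpotent_normalPart h.fixes h.base (h.unipotent.self_of_nhds h.base)) h.ne_one
  -- Invertibility at `y₀` spreads to a neighbourhood, where inversion is smooth; off the kernel of
  -- `Q` no unipotence is available, so openness is what gives the inverse there.
  have hopen : IsOpen {y | IsUnit (A y)} := Units.isOpen.preimage hAs.continuous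
  obtain ⟨M, hM, hMe⟩ := exists_contDiff_eventuallyEq hopen hu
    (g := fun y => Ring.inverse (A y)) (fun y hy => by
      obtain ⟨u, hu⟩ := hy
      have h1 := contDiffAt_ringInverse ℝ (n := ∞) u
      rw [hu] at h1
      exact (h1.comp y hAs.contDiffAt).contDiffWithinAt)
  refine ⟨M, hM, ?_⟩
  filter_upwards [hMe, hopen.mem_nhds hu] with y hy hyu Λ
  have h1 : A y * M y = 1 := by rw [hy]; exact Ring.mul_inverse_cancel _ hyu
  have h2 := congrArg (fun B : FormSpace E k →L[ℝ] FormSpace E k => B Λ) h1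
  exact h2

/-- Solve `Λ = Θ - c T^*Θ` on the kernel of `Q`, where `T` is the identity and `T^*` acts on forms
by a unipotent substitution. The equation then holds modulo forms vanishing on the kernel, which are
of degree `k + 1` and are killed. Invariance makes `f` take the same value on `Θ` and on `c T^*Θ`,
so it kills `Λ`. -/
theorem killsForms_of_succ {k : ℕ} (hk : KillsForms f Q y₀ (k + 1)) : KillsForms f Q y₀ k := by
  obtain ⟨r₁, hr₁, hk⟩ := hk
  obtain ⟨rT, hrT, htr⟩ := h.transform
  obtain ⟨M, hM, hMe⟩ := h.exists_resolvent k
  have hT0 : T y₀ = y₀ := h.fixes.self_of_nhds h.base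
  have hdet0 : (fderiv ℝ T y₀).det ≠ 0 := by
    rw [det_eq_one_of_isNilpotent (h.unipotent.self_of_nhds h.base)]
    exact one_ne_zero
  obtain ⟨r₀, hr₀, hdet, hpb⟩ := exists_pullback (F := FormSpace E k) h.smooth hT0 hdet0
  have hP0 : P y₀ = y₀ := h.P_of_Q_eq_zero h.base
  have hfixP : ∀ᶠ y in 𝓝 y₀, T (P y) = P y := by
    have : Tendsto P (𝓝 y₀) (𝓝 y₀) := by simpa [hP0] using P.continuous.tendsto y₀
    filter_upwards [this.eventually h.fixes] with y hy using hy (h.Q_P y)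
  obtain ⟨rN, hrN, hnear⟩ := Metric.eventually_nhds_iff_ball.1
    ((hMe.and (hfixP.and (h.fixes.eventually_nhds.and h.unipotent))))
  set r₂ := min (min r₀ rT) (min rN (r₁ / 2)) with hr₂
  have hr₂0 : 0 < r₂ := by positivity
  have hr₂₀ : r₂ ≤ r₀ := (min_le_left _ _).trans (min_le_left _ _)
  have hr₂T : r₂ ≤ rT := (min_le_left _ _).trans (min_le_right _ _)
  have hr₂N : r₂ ≤ rN := (min_le_right _ _).trans (min_le_left _ _)
  have hr₂1 : r₂ ≤ r₁ / 2 := (min_le_right _ _).trans (min_le_right _ _)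
  obtain ⟨s, hs, hsr, hpb⟩ := hpb r₂ hr₂0 hr₂₀
  refine ⟨s / 2, by positivity, fun Λ hΛ hΛs => ?_⟩
  -- The solution is constructed on the kernel, extended along the fibres of `P` and cut off in the
  -- normal direction. The bounds `s / 2` for `P y - y₀` and for `Q y` add up to the required radius
  -- `s`.
  obtain ⟨η, hη, hη1, hηs, -⟩ := exists_smooth_cutoff (0 : E) (half_pos hs)
  -- the solution
  set Θ : E → FormSpace E k := fun y => η (Q y) • M (P y) (Λ (P y)) with hΘdef
  have hΘ : ContDiff ℝ ∞ Θ := by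
    refine (hη.comp Q.contDiff).smul ((hM.comp P.contDiff).clm_apply (hΛ.comp P.contDiff))
  have hΘs : tsupport Θ ⊆ Metric.ball y₀ s := by
    have hcl : IsClosed (Q ⁻¹' tsupport η ∩ P ⁻¹' tsupport Λ) :=
      ((isClosed_tsupport η).preimage Q.continuous).inter ((isClosed_tsupport Λ).preimage P.continuous)
    refine (closure_minimal (fun y hy => ?_) hcl).trans fun y hy => ?_
    · by_contra hne
      rw [mem_inter_iff, not_and_or] at hne
      refine hy ?_
      rcases hne with h1 | h1
      · simp only [hΘdef]
        rw [image_eq_zero_of_notMem_tsupport h1, zero_smul]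
      · simp only [hΘdef]
        rw [image_eq_zero_of_notMem_tsupport h1, map_zero, smul_zero]
    · have h1 := hηs hy.1
      have h2 := hΛs hy.2
      rw [mem_ball_zero_iff] at h1
      rw [mem_ball_iff_norm] at h2 ⊢
      have e : y - y₀ = (P y - y₀) + Q y := by
        rw [sub_add_eq_add_sub, h.add_eq]
      rw [e]
      refine (norm_add_le _ _).trans_lt ?_
      linarith
  obtain ⟨Ψ, hΨ, hΨs, hΨe, hΨsurj⟩ := hpb Θ hΘ hΘs
  set R : E → (FormSpace E k →L[ℝ] FormSpace E k) := fun y => substForm E k (normalPart P Q T y)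
    with hR
  have hRs : ContDiff ℝ ∞ R := contDiff_substForm (contDiff_normalPart h.smooth)
  set θ : E → ℂ := fun y => Θ y (fun _ => Q y) with hθ
  set ψ : E → ℂ := fun y => R y (Ψ y) (fun _ => Q y) with hψ
  have hQ : ContDiff ℝ ∞ (fun y => Q y) := Q.contDiff
  have hzero : ∀ v : Fin k → E, (0 : FormSpace E k) v = 0 := fun _ => rfl
  have hψs : tsupport ψ ⊆ tsupport Ψ := by
    refine closure_mono fun y hy => ?_
    intro h0
    refine hy ?_
    simp only [hψ]
    rw [h0, map_zero, hzero]
  -- Substituting `normalPart` into the slots replaces `Q y` by `Q (T y)`, so `ψ` is the pull-back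
  -- density of `θ`, written again as a form of degree `k` in `Q y`.
  have hψe : ∀ y ∈ Metric.ball y₀ r₂, ψ y = ((|(fderiv ℝ T y).det| : ℝ) : ℂ) * θ (T y) := by
    intro y hy
    have hyN := hnear y (Metric.ball_subset_ball hr₂N hy)
    change Ψ y (fun _ => normalPart P Q T y (Q y)) = _
    rw [h.normalPart_apply hyN.2.1, hΨe y hy]
    change |(fderiv ℝ T y).det| • Θ (T y) (fun _ => Q (T y)) = _
    rw [Complex.real_smul]
  have hpush : IsPush T ψ θ := by
    refine ⟨fun y hy => (hψe y (hΨs (hψs hy))).symm, fun z hz => ?_⟩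
    by_contra hne
    have hΘz : Θ z ≠ 0 := fun h0 => hne (by simp only [hθ]; rw [h0, hzero])
    obtain ⟨y, hy, rfl⟩ := hΨsurj z hΘz
    refine hz ⟨y, subset_tsupport _ ?_, rfl⟩
    change ψ y ≠ 0
    rw [hψe y hy]
    refine mul_ne_zero ?_ hne
    exact_mod_cast abs_ne_zero.2 (hdet y (Metric.ball_subset_ball hr₂₀ hy))
  have htrans := htr ψ θ (contDiff_apply_diag (hRs.clm_apply hΨ) hQ) (contDiff_apply_diag hΘ hQ)
    ((hψs.trans hΨs).trans (Metric.ball_subset_ball hr₂T)) hpush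
  -- the error term
  have hmain := KillsForms.apply_eq_zero (Λ := fun y => Λ y - Θ y + c y • R y (Ψ y)) h.add_eq hr₁ hk
    ((hΛ.sub hΘ).add (h.smooth_mul.smul (hRs.clm_apply hΨ))) ?_ ?_
  · have e : (fun y => (Λ y - Θ y + c y • R y (Ψ y)) (fun _ => Q y)) =
        (fun y => Λ y (fun _ => Q y)) - θ + fun y => c y * ψ y := rfl
    rw [e, map_add, map_sub, htrans] at hmain
    simpa using hmain
  · have hsub : ∀ {t : ℝ}, t ≤ r₂ → Metric.ball y₀ t ⊆ Metric.ball y₀ (r₁ / 2) := fun ht =>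
      Metric.ball_subset_ball (ht.trans hr₂1)
    refine (tsupport_add _ _).trans (union_subset ((tsupport_sub _ _).trans (union_subset ?_ ?_)) ?_)
    · exact hΛs.trans (hsub (by linarith))
    · exact hΘs.trans (hsub hsr)
    · refine Subset.trans ?_ (hΨs.trans (hsub le_rfl))
      refine closure_mono fun y hy h0 => hy ?_
      simp only
      rw [h0, map_zero, smul_zero]
  -- On the kernel `T w = w` and the Jacobian of `T` is `1`, being that of a unipotent map, so the
  -- error term is the resolvent equation. Outside the ball all three terms vanish.
  · intro y
    set w := P y with hw
    have hQw : Q w = 0 := h.Q_P y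
    have hPw : P w = w := h.idem y
    by_cases hwb : w ∈ Metric.ball y₀ r₂
    · obtain ⟨h1, h2, h3, h4⟩ := hnear w (Metric.ball_subset_ball hr₂N hwb)
      have hTw : T w = w := h3.self_of_nhds hQw
      have hΘw : Θ w = M w (Λ w) := by
        simp only [hΘdef]
        rw [hQw, hPw, hη1 0 (Metric.mem_ball_self (by positivity)), one_smul]
      rw [hΨe w hwb, hTw, det_eq_one_of_isNilpotent (h4 hQw), abs_one, one_smul, hΘw]
      have := h1 (Λ w)
      rw [sub_add, sub_eq_zero]
      exact this.symm
    · have e1 : Λ w = 0 := image_eq_zero_of_notMem_tsupport fun hm =>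
        hwb (Metric.ball_subset_ball (by linarith) (hΛs hm))
      have e2 : Θ w = 0 := image_eq_zero_of_notMem_tsupport fun hm =>
        hwb (Metric.ball_subset_ball hsr (hΘs hm))
      have e3 : Ψ w = 0 := image_eq_zero_of_notMem_tsupport fun hm => hwb (hΨs hm)
      rw [e1, e2, e3, map_zero, smul_zero, sub_zero, add_zero]

/-- A functional of finite order supported in the kernel of `Q` which is transformed by a factor
different from one under a map with unipotent derivative along its support vanishes. -/
theorem eq_zero {R : ℝ} (hR : 0 < R) (hf : FiniteOrderOn f (Metric.closedBall y₀ R))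
    (hs : ∀ ψ : E → ℂ, ContDiff ℝ ∞ ψ → tsupport ψ ⊆ Metric.closedBall y₀ R →
      (∀ y ∈ tsupport ψ, Q y ≠ 0) → f ψ = 0) :
    ∃ r > 0, ∀ ψ : E → ℂ, ContDiff ℝ ∞ ψ → tsupport ψ ⊆ Metric.ball y₀ r → f ψ = 0 := by
  obtain ⟨N, hN⟩ := hf.exists_kills (isCompact_closedBall y₀ R) (q := fun y => Q y) Q.contDiff hs
  have hbase : KillsForms f Q y₀ (N + 1) := by
    refine ⟨R, hR, fun Λ hΛ hΛs => ?_⟩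
    refine hN (fun p => Λ p.1 (fun _ => p.2))
      (contDiff_apply_diag (hΛ.comp contDiff_fst) contDiff_snd) (fun y hy v => ?_) fun y t v => ?_
    · have : Λ y = 0 := image_eq_zero_of_notMem_tsupport fun hm =>
        hy (Metric.ball_subset_closedBall (hΛs hm))
      simp only
      rw [this]
      rfl
    · exact apply_diag_smul _ _ _
  -- The induction ends at degree zero, where a form is just a function. Its radius may shrink at
  -- each step, but there are finitely many steps.
  have hall : ∀ k, KillsForms f Q y₀ k → KillsForms f Q y₀ 0 := by
    intro k
    induction k with
    | zero => exact id
    | succ k ih => exact fun hk => ih (h.killsForms_of_succ hk)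
  obtain ⟨r, hr, hkill⟩ := hall _ hbase
  refine ⟨r, hr, fun ψ hψ hψs => ?_⟩
  let Λ : E → FormSpace E 0 := fun y =>
    (continuousMultilinearCurryFin0 ℝ E ℂ).symm (ψ y)
  have hΛ : ContDiff ℝ ∞ Λ :=
    (continuousMultilinearCurryFin0 ℝ E ℂ).symm.contDiff.comp hψ
  have hsub : tsupport Λ ⊆ tsupport ψ := by
    refine closure_mono fun y hy h0 => hy ?_
    simp only [Λ, h0, map_zero]
    rfl
  exact hkill Λ hΛ (hsub.trans hψs)

end UnipotentInvariance

end Vanishing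


/-! ### From equivariance under a group to a transformation rule for point-dependent group elements
-/

section Graph

variable {G E : Type} [NormedAddCommGroup G] [NormedSpace ℝ G] [FiniteDimensional ℝ G]
  [NormedAddCommGroup E] [NormedSpace ℝ E] [FiniteDimensional ℝ E]

/-- Equivariance of `f`, near `y₀`, under the family of maps `A (b, ·)`, for `b` near `b₀`. -/
def LocallyEquivariant (f : (E → ℂ) →ₗ[ℂ] ℂ) (A : G × E → E) (χ : G → ℂ) (b₀ : G) (y₀ : E) : Prop :=
  ∃ r > 0, ∀ b ∈ Metric.ball b₀ r, ∀ ψ θ : E → ℂ, ContDiff ℝ ∞ ψ → ContDiff ℝ ∞ θ →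
    tsupport ψ ⊆ Metric.ball y₀ r → IsPush (fun y => A (b, y)) ψ θ → f θ = χ b * f ψ

/-- A nonzero Jacobian lets the defining equation be solved for `θ` on the image of the support;
elsewhere both densities are zero. -/
theorem IsPush.unique {g : E → E} {ψ θ θ' : E → ℂ} (h : IsPush g ψ θ) (h' : IsPush g ψ θ')
    (hd : ∀ y ∈ tsupport ψ, (fderiv ℝ g y).det ≠ 0) : θ = θ' := by
  funext z
  by_cases hz : z ∈ g '' tsupport ψ
  · obtain ⟨y, hy, rfl⟩ := hz
    have h1 : ((|(fderiv ℝ g y).det| : ℝ) : ℂ) ≠ 0 := by exact_mod_cast abs_ne_zero.2 (hd y hy)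
    exact mul_left_cancel₀ h1 ((h.1 y hy).trans (h'.1 y hy).symm)
  · rw [h.2 z hz, h'.2 z hz]

theorem tsupport_slice_subset (Ψ : G × E → ℂ) (b : G) :
    tsupport (fun y => Ψ (b, y)) ⊆ (fun y => (b, y)) ⁻¹' tsupport Ψ :=
  tsupport_comp_subset_preimage (f := fun y : E => (b, y)) Ψ (by fun_prop)

/-- The equivariance factor is smooth, if it occurs in a nonzero equivariant functional. -/
theorem LocallyEquivariant.exists_contDiff {f : (E → ℂ) →ₗ[ℂ] ℂ} {A : G × E → E} {χ : G → ℂ}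
    {b₀ : G} {y₀ : E} (h : LocallyEquivariant f A χ b₀ y₀) (hA : ContDiff ℝ ∞ A)
    (hA0 : A (b₀, y₀) = y₀) (hdet : (fderiv ℝ (fun y => A (b₀, y)) y₀).det ≠ 0) {R : ℝ}
    (hR : 0 < R) (hf : FiniteOrderOn f (Metric.closedBall y₀ R))
    (hne : ∀ r > 0, ∃ ψ : E → ℂ, ContDiff ℝ ∞ ψ ∧ tsupport ψ ⊆ Metric.ball y₀ r ∧ f ψ ≠ 0) :
    ∃ χ' : G → ℂ, ContDiff ℝ ∞ χ' ∧ χ' =ᶠ[𝓝 b₀] χ := by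
  obtain ⟨r, hr, h⟩ := h
  obtain ⟨r₀, hr₀, -, hpush⟩ := exists_push_family hA (p₀ := (b₀, y₀)) hdet
  have hAR : A ⁻¹' Metric.ball y₀ R ∈ 𝓝 (b₀, y₀) :=
    hA.continuous.continuousAt.preimage_mem_nhds (by rw [hA0]; exact Metric.ball_mem_nhds _ hR)
  obtain ⟨δ', hδ', hAR⟩ := Metric.mem_nhds_iff.1 hAR
  set δ := min (min r₀ r) δ' with hδ
  have hδ0 : 0 < δ := by positivity
  obtain ⟨ψ, hψ, hψs, hfψ⟩ := hne δ hδ0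
  obtain ⟨η, hη, hη1, hηs, -⟩ := exists_smooth_cutoff b₀ hδ0
  set Ψ : G × E → ℂ := fun p => η p.1 • ψ p.2 with hΨ
  have hΨsm : ContDiff ℝ ∞ Ψ := (hη.comp contDiff_fst).smul (hψ.comp contDiff_snd)
  have hΨs : tsupport Ψ ⊆ Metric.ball (b₀, y₀) δ := by
    have hcl : IsClosed (tsupport η ×ˢ tsupport ψ) :=
      (isClosed_tsupport η).prod (isClosed_tsupport ψ)
    refine (closure_minimal (fun p hp => ?_) hcl).trans ?_
    · by_contra hn
      rw [mem_prod, not_and_or] at hn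
      refine hp ?_
      rcases hn with h1 | h1 <;> simp [hΨ, image_eq_zero_of_notMem_tsupport h1]
    · rw [← ball_prod_same]
      exact prod_mono hηs hψs
  obtain ⟨Θ, hΘ, hΘs, hΘp⟩ := hpush Ψ hΨsm
    (hΨs.trans (Metric.ball_subset_ball ((min_le_left _ _).trans (min_le_left _ _))))
  have hsl : ∀ b, tsupport (fun y => Θ (b, y)) ⊆ Metric.closedBall y₀ R := by
    intro b z hz
    obtain ⟨p, hp, hpe⟩ := hΘs (tsupport_slice_subset Θ b hz)
    obtain ⟨-, rfl⟩ := Prod.ext_iff.1 hpe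
    exact Metric.ball_subset_closedBall
      (hAR (Metric.ball_subset_ball (min_le_right _ _) (hΨs hp)))
  -- For `b` near `b₀` the slice `Θ (b, ·)` is the push-forward of a fixed `ψ` with `f ψ ≠ 0`, so
  -- equivariance expresses `χ b` as this quotient, whose numerator depends smoothly on `b`.
  refine ⟨fun b => f (fun y => Θ (b, y)) / f ψ,
    (hf.contDiff_family (isCompact_closedBall y₀ R) hΘ hsl).div_const _, ?_⟩
  filter_upwards [Metric.ball_mem_nhds b₀ (half_pos hδ0)] with b hb
  have hb' : b ∈ Metric.ball b₀ r := Metric.ball_subset_ball (by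
    have : δ ≤ r := (min_le_left _ _).trans (min_le_right _ _)
    linarith) hb
  have e : (fun y => Ψ (b, y)) = ψ := by
    funext y
    simp only [hΨ]
    rw [hη1 b hb, one_smul]
  have h1 := hΘp b
  rw [e] at h1
  rw [h b hb' ψ _ hψ (contDiff_slice hΘ b)
    (hψs.trans (Metric.ball_subset_ball ((min_le_left _ _).trans (min_le_right _ _)))) h1]
  field_simp

theorem isCompact_tsupport_of_subset_ball {X : Type} [NormedAddCommGroup X] [NormedSpace ℝ X]
    [FiniteDimensional ℝ X] {g : X → ℂ} {x : X} {r : ℝ} (h : tsupport g ⊆ Metric.ball x r) :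
    HasCompactSupport g :=
  (isCompact_closedBall x r).of_isClosed_subset (isClosed_tsupport _)
    (h.trans Metric.ball_subset_closedBall)

/-- Two descriptions of the same averaged push-forward. -/
theorem integral_push_eq [MeasurableSpace G] [BorelSpace G] [MeasurableSpace E] [BorelSpace E]
    (μ : Measure G) [μ.IsAddHaarMeasure] (ν : Measure E) [ν.IsAddHaarMeasure]
    {A : G × E → E} (hA : ContDiff ℝ ∞ A) {β : E → G} (hβ : ContDiff ℝ ∞ β)
    {ΨA ΘA ΨT ΘT : G × E → ℂ} (hΨT : ContDiff ℝ ∞ ΨT) (hΨA : ContDiff ℝ ∞ ΨA)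
    (hΘT : ContDiff ℝ ∞ ΘT) (hΘA : ContDiff ℝ ∞ ΘA)
    (cΨT : HasCompactSupport ΨT) (cΨA : HasCompactSupport ΨA)
    (cΘT : HasCompactSupport ΘT) (cΘA : HasCompactSupport ΘA)
    (hrel : ∀ b y, ΨA (b, y) = ΨT (b - β y, y))
    (hpA : ∀ b, IsPush (fun y => A (b, y)) (fun y => ΨA (b, y)) (fun y => ΘA (b, y)))
    (hpT : ∀ b, IsPush (fun y => A (b + β y, y)) (fun y => ΨT (b, y)) (fun y => ΘT (b, y)))
    (iA : ∀ b, InjOn (fun y => A (b, y)) (tsupport fun y => ΨA (b, y)))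
    (iT : ∀ b, InjOn (fun y => A (b + β y, y)) (tsupport fun y => ΨT (b, y)))
    (cA : Continuous fun z => ∫ b, ΘA (b, z) ∂μ) (cT : Continuous fun z => ∫ b, ΘT (b, z) ∂μ) :
    (fun z => ∫ b, ΘA (b, z) ∂μ) = fun z => ∫ b, ΘT (b, z) ∂μ := by
  have hT : ContDiff ℝ ∞ (fun p : G × E => A (p.1 + β p.2, p.2)) :=
    hA.comp ((contDiff_fst.add (hβ.comp contDiff_snd)).prodMk contDiff_snd)
  -- The two continuous functions are compared by pairing with test functions: after Fubini and a
  -- change of variables in each fibre, both pairings are integrals of `Ψ` over the source, where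
  -- the families differ by a shift of the parameter.
  have key : ∀ k : E → ℝ, ContDiff ℝ ∞ k → HasCompactSupport k →
      ∫ z, k z • ∫ b, ΘA (b, z) ∂μ ∂ν = ∫ z, k z • ∫ b, ΘT (b, z) ∂μ ∂ν := by
    intro k hk _
    have hkc : Continuous fun z => ((k z : ℝ) : ℂ) := by
      have := hk.continuous; fun_prop
    have step : ∀ (g : G × E → E) (Ψ Θ : G × E → ℂ), ContDiff ℝ ∞ g → ContDiff ℝ ∞ Ψ →
        ContDiff ℝ ∞ Θ → HasCompactSupport Ψ → HasCompactSupport Θ →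
        (∀ b, IsPush (fun y => g (b, y)) (fun y => Ψ (b, y)) (fun y => Θ (b, y))) →
        (∀ b, InjOn (fun y => g (b, y)) (tsupport fun y => Ψ (b, y))) →
        ∫ z, k z • ∫ b, Θ (b, z) ∂μ ∂ν = ∫ y, ∫ b, Ψ (b, y) * ((k (g (b, y)) : ℝ) : ℂ) ∂μ ∂ν := by
      intro g Ψ Θ hg hΨ hΘ cΨ cΘ hp hi
      have i1 : Integrable (fun p : G × E => Θ p * ((k p.2 : ℝ) : ℂ)) (μ.prod ν) := by
        refine Continuous.integrable_of_hasCompactSupport ?_ cΘ.mul_right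
        exact hΘ.continuous.mul (hkc.comp continuous_snd)
      have i2 : Integrable (fun p : G × E => Ψ p * ((k (g p) : ℝ) : ℂ)) (μ.prod ν) := by
        refine Continuous.integrable_of_hasCompactSupport ?_ cΨ.mul_right
        exact hΨ.continuous.mul (hkc.comp hg.continuous)
      calc ∫ z, k z • ∫ b, Θ (b, z) ∂μ ∂ν
          = ∫ z, ∫ b, Θ (b, z) * ((k z : ℝ) : ℂ) ∂μ ∂ν := by
            congr 1
            funext z
            rw [integral_mul_const, Complex.real_smul, mul_comm]
        _ = ∫ b, ∫ z, Θ (b, z) * ((k z : ℝ) : ℂ) ∂ν ∂μ :=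
            (integral_integral_swap (f := fun b z => Θ (b, z) * ((k z : ℝ) : ℂ)) i1).symm
        _ = ∫ b, ∫ y, Ψ (b, y) * ((k (g (b, y)) : ℝ) : ℂ) ∂ν ∂μ := by
            congr 1
            funext b
            exact (hp b).integral_eq ν (contDiff_slice hg b) (hi b) (fun z => ((k z : ℝ) : ℂ))
        _ = _ := integral_integral_swap
            (f := fun b y => Ψ (b, y) * ((k (g (b, y)) : ℝ) : ℂ)) i2
    rw [step A ΨA ΘA hA hΨA hΘA cΨA cΘA hpA iA,
      step (fun p => A (p.1 + β p.2, p.2)) ΨT ΘT hT hΨT hΘT cΨT cΘT hpT iT]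
    congr 1
    funext y
    -- For fixed `y` the shift by `β y` preserves Haar measure on the parameter space. This is why
    -- the parameters are taken in a vector space.
    rw [← integral_sub_right_eq_self (μ := μ)
      (fun b => ΨT (b, y) * ((k (A (b + β y, y)) : ℝ) : ℂ)) (β y)]
    congr 1
    funext b
    rw [hrel, sub_add_cancel]
  have hae := ae_eq_of_integral_contDiff_smul_eq (μ := ν) (cA.locallyIntegrable) (cT.locallyIntegrable)
    key
  exact (Continuous.ae_eq_iff_eq ν cA cT).1 hae

/-- An equivariant functional is transformed by the factor `χ (β y)` under the map
`y ↦ A (β y, y)`. -/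
theorem LocallyEquivariant.transform_graph {f : (E → ℂ) →ₗ[ℂ] ℂ} {A : G × E → E} {χ : G → ℂ}
    {b₀ : G} {y₀ : E} (h : LocallyEquivariant f A χ b₀ y₀) (hA : ContDiff ℝ ∞ A)
    (hχ : ContDiff ℝ ∞ χ) (hA0 : A (b₀, y₀) = y₀)
    (hdet : (fderiv ℝ (fun y => A (b₀, y)) y₀).det ≠ 0) {R : ℝ}
    (hR : 0 < R) (hf : FiniteOrderOn f (Metric.closedBall y₀ R))
    {β : E → G} (hβ : ContDiff ℝ ∞ β) (hβ0 : β y₀ = b₀)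
    (hdetT : (fderiv ℝ (fun y => A (β y, y)) y₀).det ≠ 0) :
    ∃ r > 0, ∀ ψ θ : E → ℂ, ContDiff ℝ ∞ ψ → ContDiff ℝ ∞ θ → tsupport ψ ⊆ Metric.ball y₀ r →
      IsPush (fun y => A (β y, y)) ψ θ → f θ = f (fun y => χ (β y) * ψ y) := by
  let : MeasurableSpace G := borel G
  have : BorelSpace G := ⟨rfl⟩
  let : MeasurableSpace E := borel E
  have : BorelSpace E := ⟨rfl⟩
  let μ : Measure G := Measure.addHaar
  let ν : Measure E := Measure.addHaar
  obtain ⟨rE, hrE, h⟩ := h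
  -- The map of interest is the member `b = 0` of this family. A single one is not a map by which
  -- `f` is known to transform, but averages over `b` can be rewritten by means of the maps `A (b,
  -- ·)`.
  set T : G × E → E := fun p => A (p.1 + β p.2, p.2) with hTdef
  have hT : ContDiff ℝ ∞ T :=
    hA.comp ((contDiff_fst.add (hβ.comp contDiff_snd)).prodMk contDiff_snd)
  have hT0 : (fun y => T (0, y)) = fun y => A (β y, y) := by simp [hTdef]
  obtain ⟨rA, hrA, injA, pushA⟩ := exists_push_family hA (p₀ := (b₀, y₀)) hdet
  obtain ⟨rT, hrT, injT, pushT⟩ := exists_push_family hT (p₀ := (0, y₀)) (by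
    simp only [hT0]; exact hdetT)
  have hAR : A ⁻¹' Metric.ball y₀ R ∈ 𝓝 (b₀, y₀) :=
    hA.continuous.continuousAt.preimage_mem_nhds (by rw [hA0]; exact Metric.ball_mem_nhds _ hR)
  obtain ⟨δ', hδ', hAR⟩ := Metric.mem_nhds_iff.1 hAR
  set δ := min (min rA rE) (min δ' R) with hδ
  have hδ0 : 0 < δ := by positivity
  have hδA : δ ≤ rA := (min_le_left _ _).trans (min_le_left _ _)
  have hδE : δ ≤ rE := (min_le_left _ _).trans (min_le_right _ _)
  have hδ1 : δ ≤ δ' := (min_le_right _ _).trans (min_le_left _ _)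
  have hδR : δ ≤ R := (min_le_right _ _).trans (min_le_right _ _)
  have hdetn : ∀ᶠ y in 𝓝 y₀, (fderiv ℝ (fun y => A (β y, y)) y).det ≠ 0 := by
    have hs : ContDiff ℝ ∞ (fun y => A (β y, y)) := hA.comp (hβ.prodMk contDiff_id)
    have : Continuous (fun y => (fderiv ℝ (fun y => A (β y, y)) y).det) :=
      contDiff_det.continuous.comp (hs.continuous_fderiv (by simp))
    exact (isOpen_ne_fun this continuous_const).mem_nhds hdetT
  have hβn : ∀ᶠ y in 𝓝 y₀, β y ∈ Metric.ball b₀ (δ / 2) :=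
    hβ.continuous.continuousAt.preimage_mem_nhds
      (by rw [hβ0]; exact Metric.ball_mem_nhds _ (half_pos hδ0))
  obtain ⟨ε', hε', hnear⟩ := Metric.eventually_nhds_iff_ball.1 (hdetn.and hβn)
  set ε := min (min ε' rT) (δ / 2) with hε
  have hε0 : 0 < ε := by positivity
  have hεε' : ε ≤ ε' := (min_le_left _ _).trans (min_le_left _ _)
  have hεT : ε ≤ rT := (min_le_left _ _).trans (min_le_right _ _)
  have hεδ : ε ≤ δ / 2 := min_le_right _ _
  refine ⟨ε, hε0, fun ψ θ hψ hθ hψs hp => ?_⟩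
  obtain ⟨η, hη, hη1, hηs, hηc⟩ := exists_smooth_cutoff (0 : G) hε0
  have hshift : ∀ b y, b ∈ tsupport η → y ∈ tsupport ψ →
      (b + β y, y) ∈ Metric.ball (b₀, y₀) δ := by
    intro b y hb hy
    have h1 := hηs hb
    have h2 := hψs hy
    have h3 := (hnear y (Metric.ball_subset_ball hεε' h2)).2
    rw [← ball_prod_same]
    refine ⟨?_, Metric.ball_subset_ball (by linarith) h2⟩
    rw [mem_ball_zero_iff] at h1
    rw [mem_ball_iff_norm] at h3 ⊢
    calc ‖b + β y - b₀‖ = ‖b + (β y - b₀)‖ := by rw [add_sub_assoc]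
      _ ≤ ‖b‖ + ‖β y - b₀‖ := norm_add_le _ _
      _ < δ := by linarith
  -- the family for the maps `T (b, ·)`
  set ΨT : G × E → ℂ := fun p => η p.1 • ψ p.2 with hΨT
  have hΨTsm : ContDiff ℝ ∞ ΨT := (hη.comp contDiff_fst).smul (hψ.comp contDiff_snd)
  have hΨT0 : ∀ p : G × E, ΨT p ≠ 0 → p.1 ∈ tsupport η ∧ p.2 ∈ tsupport ψ := by
    intro p hp
    by_contra hn
    rw [not_and_or] at hn
    rcases hn with h1 | h1 <;> exact hp (by simp [hΨT, image_eq_zero_of_notMem_tsupport h1])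
  have hΨTs : tsupport ΨT ⊆ tsupport η ×ˢ tsupport ψ :=
    closure_minimal (fun p hp => hΨT0 p hp) ((isClosed_tsupport η).prod (isClosed_tsupport ψ))
  have hΨTb : tsupport ΨT ⊆ Metric.ball (0, y₀) rT := by
    refine hΨTs.trans ?_
    rw [← ball_prod_same]
    exact prod_mono (hηs.trans (Metric.ball_subset_ball hεT))
      (hψs.trans (Metric.ball_subset_ball hεT))
  obtain ⟨ΘT, hΘT, hΘTs, hΘTp⟩ := pushT ΨT hΨTsm hΨTb
  have cΨT : HasCompactSupport ΨT := isCompact_tsupport_of_subset_ball hΨTb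
  have cΘT : HasCompactSupport ΘT :=
    (cΨT.image (continuous_fst.prodMk hT.continuous)).of_isClosed_subset (isClosed_tsupport _) hΘTs
  have hAball : ∀ p ∈ Metric.ball (b₀, y₀) δ, A p ∈ Metric.closedBall y₀ R := fun p hp =>
    Metric.ball_subset_closedBall (hAR (Metric.ball_subset_ball hδ1 hp))
  have slT : ∀ b, tsupport (fun y => ΘT (b, y)) ⊆ Metric.closedBall y₀ R := by
    intro b z hz
    obtain ⟨p, hp, hpe⟩ := hΘTs (tsupport_slice_subset ΘT b hz)
    obtain ⟨-, rfl⟩ := Prod.ext_iff.1 hpe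
    obtain ⟨h1, h2⟩ := hΨTs hp
    exact hAball _ (hshift p.1 p.2 h1 h2)
  have hKc := isCompact_closedBall y₀ R
  have hψK : tsupport ψ ⊆ Metric.closedBall y₀ R :=
    hψs.trans (Metric.ball_subset_closedBall.trans (Metric.closedBall_subset_closedBall (by linarith)))
  -- the family on the other side
  set Ξ : G × E → ℂ := fun p => η p.1 • (χ (p.1 + β p.2) * ψ p.2) with hΞ
  have hΞsm : ContDiff ℝ ∞ Ξ := (hη.comp contDiff_fst).smul
    ((hχ.comp (contDiff_fst.add (hβ.comp contDiff_snd))).mul (hψ.comp contDiff_snd))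
  have slΞ : ∀ b, tsupport (fun y => Ξ (b, y)) ⊆ Metric.closedBall y₀ R := by
    intro b
    have : tsupport (fun y => Ξ (b, y)) ⊆ tsupport ψ := by
      refine closure_mono fun y hy h0 => hy ?_
      simp [hΞ, h0]
    exact this.trans hψK
  -- The defect in the transformation rule for the member `b`. It is continuous, so it vanishes at
  -- `0` once all its weighted averages vanish.
  set D : G → ℂ := fun b => f (fun y => ΘT (b, y)) - f (fun y => Ξ (b, y)) with hD
  have hDc : Continuous D :=
    ((hf.contDiff_family hKc hΘT slT).sub (hf.contDiff_family hKc hΞsm slΞ)).continuous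
  have hDint : ∀ α : G → ℝ, ContDiff ℝ ∞ α → HasCompactSupport α → ∫ b, α b • D b ∂μ = 0 := by
    intro α hα hαc
    have hLc : IsCompact (tsupport η) := hηc
    -- weighted families
    have smulfam : ∀ Ω : G × E → ℂ, ContDiff ℝ ∞ Ω →
        (∀ b, tsupport (fun y => Ω (b, y)) ⊆ Metric.closedBall y₀ R) →
        (∀ b ∉ tsupport η, ∀ y, Ω (b, y) = 0) →
        ContDiff ℝ ∞ (fun y => ∫ b, α b • Ω (b, y) ∂μ) ∧
        f (fun y => ∫ b, α b • Ω (b, y) ∂μ) = ∫ b, α b • f (fun y => Ω (b, y)) ∂μ := by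
      intro Ω hΩ hsl hz
      obtain ⟨h1, h2⟩ := hf.integral_family μ hKc (Ψ := fun p => α p.1 • Ω p)
        ((hα.comp contDiff_fst).smul hΩ) (fun b => (tsupport_smul_subset_right (fun _ => α b)
          (fun y => Ω (b, y))).trans (hsl b)) hLc
        (fun b hb y => by simp only [hz b hb y, smul_zero])
      refine ⟨h1, h2.trans ?_⟩
      congr 1
      funext b
      have : (fun y => α b • Ω (b, y)) = ((α b : ℝ) : ℂ) • fun y => Ω (b, y) := by
        funext y; simp
      rw [this, map_smul, Complex.real_smul, smul_eq_mul]
    have zT : ∀ b ∉ tsupport η, ∀ y, ΘT (b, y) = 0 := by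
      intro b hb y
      by_contra hne
      obtain ⟨p, hp, hpe⟩ := hΘTs (subset_tsupport _ hne)
      obtain ⟨h1, -⟩ := Prod.ext_iff.1 hpe
      simp only at h1
      exact hb (h1 ▸ (hΨTs hp).1)
    have zΞ : ∀ b ∉ tsupport η, ∀ y, Ξ (b, y) = 0 := by
      intro b hb y
      simp [hΞ, image_eq_zero_of_notMem_tsupport hb]
    obtain ⟨sT, eT⟩ := smulfam ΘT hΘT slT zT
    obtain ⟨-, eΞ⟩ := smulfam Ξ hΞsm slΞ zΞ
    -- the family for the maps `A (b, ·)`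
    set ΨA : G × E → ℂ := fun p => α (p.1 - β p.2) • ΨT (p.1 - β p.2, p.2) with hΨA
    have hsh : ContDiff ℝ ∞ (fun p : G × E => p.1 - β p.2) :=
      contDiff_fst.sub (hβ.comp contDiff_snd)
    have hΨAsm : ContDiff ℝ ∞ ΨA :=
      (hα.comp hsh).smul (hΨTsm.comp (hsh.prodMk contDiff_snd))
    have hΨAs : tsupport ΨA ⊆ Metric.ball (b₀, y₀) δ := by
      have hcl : IsClosed ((fun p : G × E => p.1 - β p.2) ⁻¹' tsupport η ∩ Prod.snd ⁻¹' tsupport ψ) :=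
        ((isClosed_tsupport η).preimage hsh.continuous).inter
          ((isClosed_tsupport ψ).preimage continuous_snd)
      refine (closure_minimal (fun p hp => ?_) hcl).trans fun p hp => ?_
      · exact hΨT0 (p.1 - β p.2, p.2) fun h0 => hp (by simp only [hΨA, h0, smul_zero])
      · have := hshift _ _ hp.1 hp.2
        rwa [sub_add_cancel] at this
    obtain ⟨ΘA, hΘA, hΘAs, hΘAp⟩ := pushA ΨA hΨAsm (hΨAs.trans (Metric.ball_subset_ball hδA))
    have cΨA : HasCompactSupport ΨA := isCompact_tsupport_of_subset_ball hΨAs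
    have cΘA : HasCompactSupport ΘA :=
      (cΨA.image (continuous_fst.prodMk hA.continuous)).of_isClosed_subset (isClosed_tsupport _) hΘAs
    have slA : ∀ b, tsupport (fun y => ΘA (b, y)) ⊆ Metric.closedBall y₀ R := by
      intro b z hz
      obtain ⟨p, hp, hpe⟩ := hΘAs (tsupport_slice_subset ΘA b hz)
      obtain ⟨-, rfl⟩ := Prod.ext_iff.1 hpe
      exact hAball _ (hΨAs hp)
    have zΨA : ∀ b ∉ Metric.closedBall b₀ δ, ∀ y, ΨA (b, y) = 0 := by
      intro b hb y
      refine image_eq_zero_of_notMem_tsupport fun hm => hb ?_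
      have := hΨAs hm
      rw [← ball_prod_same] at this
      exact Metric.ball_subset_closedBall this.1
    have zA : ∀ b ∉ Metric.closedBall b₀ δ, ∀ y, ΘA (b, y) = 0 := by
      intro b hb y
      by_contra hne
      obtain ⟨p, hp, hpe⟩ := hΘAs (subset_tsupport _ hne)
      obtain ⟨h1, -⟩ := Prod.ext_iff.1 hpe
      simp only at h1
      have := hΨAs hp
      rw [← ball_prod_same] at this
      exact hb (h1 ▸ Metric.ball_subset_closedBall this.1)
    obtain ⟨sA, eA⟩ := hf.integral_family μ hKc hΘA slA (isCompact_closedBall b₀ δ) zA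
    -- comparison of the averages
    have hcomp : (fun z => ∫ b, ΘA (b, z) ∂μ) = fun z => ∫ b, α b • ΘT (b, z) ∂μ := by
      have hsub : tsupport (fun p : G × E => α p.1 • ΨT p) ⊆ tsupport ΨT :=
        tsupport_smul_subset_right (fun p : G × E => α p.1) ΨT
      refine integral_push_eq μ ν hA hβ (ΨA := ΨA) (ΘA := ΘA) (ΨT := fun p => α p.1 • ΨT p)
        (ΘT := fun p => α p.1 • ΘT p) ((hα.comp contDiff_fst).smul hΨTsm) hΨAsm
        ((hα.comp contDiff_fst).smul hΘT) hΘA (cΨT.of_isClosed_subset (isClosed_tsupport _) hsub)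
        cΨA (cΘT.of_isClosed_subset (isClosed_tsupport _) (tsupport_smul_subset_right _ _)) cΘA
        (fun b y => rfl) hΘAp (fun b => ?_) (fun b => ?_) (fun b => ?_) sA.continuous sT.continuous
      -- Multiplication by a scalar keeps the closed support only if the scalar is nonzero; for zero
      -- weight the push-forward relation is trivial.
      · by_cases hαb : α b = 0
        · simp only [hαb, zero_smul]
          exact ⟨fun y hy => by simp, fun _ _ => rfl⟩
        · have ets : tsupport (fun y => α b • ΨT (b, y)) = tsupport (fun y => ΨT (b, y)) := by
            have : Function.support (fun y => α b • ΨT (b, y)) =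
                Function.support (fun y => ΨT (b, y)) := by
              ext y; simp [hαb]
            rw [tsupport, this, tsupport]
          have hq := hΘTp b
          refine ⟨fun y hy => ?_, fun z hz => ?_⟩
          · change _ * (α b • ΘT (b, T (b, y))) = α b • ΨT (b, y)
            change y ∈ tsupport (fun y => α b • ΨT (b, y)) at hy
            rw [ets] at hy
            rw [mul_smul_comm]
            exact congrArg (α b • ·) (hq.1 y hy)
          · change α b • ΘT (b, z) = 0
            change z ∉ _ '' tsupport (fun y => α b • ΨT (b, y)) at hz
            rw [ets] at hz
            have e : ΘT (b, z) = 0 := hq.2 z hz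
            rw [e, smul_zero]
      · refine (injA b).mono fun y hy => ?_
        have : (b, y) ∈ Metric.ball (b₀, y₀) δ := hΨAs (tsupport_slice_subset ΨA b hy)
        exact Metric.ball_subset_ball hδA this
      · refine (injT b).mono fun y hy => ?_
        exact hΨTb (hsub (tsupport_slice_subset (fun p : G × E => α p.1 • ΨT p) b hy))
    rw [hcomp, eT] at eA
    -- equivariance
    have hequiv : ∀ b, f (fun y => ΘA (b, y)) = f (fun y => χ b * ΨA (b, y)) := by
      intro b
      have e1 : (fun y => χ b * ΨA (b, y)) = χ b • fun y => ΨA (b, y) := rfl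
      rw [e1, map_smul, smul_eq_mul]
      by_cases hb : b ∈ Metric.ball b₀ δ
      · refine h b (Metric.ball_subset_ball hδE hb) _ _ (contDiff_slice hΨAsm b)
          (contDiff_slice hΘA b) (fun y hy => ?_) (hΘAp b)
        have := hΨAs (tsupport_slice_subset ΨA b hy)
        rw [← ball_prod_same] at this
        exact Metric.ball_subset_ball hδE this.2
      · have z1 : (fun y => ΨA (b, y)) = 0 := by
          funext y
          refine image_eq_zero_of_notMem_tsupport fun hm => hb ?_
          have := hΨAs hm
          rw [← ball_prod_same] at this
          exact this.1
        have z2 : (fun y => ΘA (b, y)) = 0 := by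
          funext z
          refine (hΘAp b).2 z ?_
          rw [z1]
          simp [tsupport]
        rw [z1, z2, map_zero, mul_zero]
    have slχ : ∀ b, tsupport (fun y => χ b * ΨA (b, y)) ⊆ Metric.closedBall y₀ R := by
      intro b
      refine (closure_mono fun y hy => ?_ : tsupport _ ⊆ tsupport ψ).trans hψK
      have h1 : ΨA (b, y) ≠ 0 := right_ne_zero_of_mul hy
      intro h0
      exact h1 (by simp [hΨA, hΨT, h0])
    obtain ⟨-, eχ⟩ := hf.integral_family μ hKc (Ψ := fun p => χ p.1 * ΨA p)
      ((hχ.comp contDiff_fst).mul hΨAsm) slχ (isCompact_closedBall b₀ δ)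
      (fun b hb y => by simp only [zΨA b hb y, mul_zero])
    -- The substitution `b ↦ b + β y` undoes the shift built into `ΨA` and turns the constant factor
    -- `χ b` into `χ (b + β y)`.
    have hpt : (fun y => ∫ b, χ b * ΨA (b, y) ∂μ) = fun y => ∫ b, α b • Ξ (b, y) ∂μ := by
      funext y
      rw [← integral_sub_right_eq_self (μ := μ) (fun b => α b • Ξ (b, y)) (β y)]
      congr 1
      funext b
      simp only [hΨA, hΨT, hΞ, sub_add_cancel, mul_smul_comm]
    simp only at eχ
    rw [hpt, eΞ] at eχ
    have efin : ∫ b, α b • f (fun y => ΘT (b, y)) ∂μ = ∫ b, α b • f (fun y => Ξ (b, y)) ∂μ := by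
      rw [eA, eχ]
      congr 1
      funext b
      exact hequiv b
    have iT : Integrable (fun b => α b • f (fun y => ΘT (b, y))) μ :=
      Continuous.integrable_of_hasCompactSupport
        (hα.continuous.smul (hf.contDiff_family hKc hΘT slT).continuous) hαc.smul_right
    have iΞ : Integrable (fun b => α b • f (fun y => Ξ (b, y))) μ :=
      Continuous.integrable_of_hasCompactSupport
        (hα.continuous.smul (hf.contDiff_family hKc hΞsm slΞ).continuous) hαc.smul_right
    simp only [hD, smul_sub]
    rw [integral_sub iT iΞ, efin, sub_self]
  -- Almost everywhere vanishing improves to vanishing everywhere by continuity, and the value at `b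
  -- = 0`, where the cutoff `η` is `1`, is the claim.
  have hDae := ae_eq_zero_of_integral_contDiff_smul_eq_zero (μ := μ) hDc.locallyIntegrable hDint
  have hD0 : D = fun _ => 0 := (Continuous.ae_eq_iff_eq μ hDc continuous_const).1 hDae
  have h0 := congrFun hD0 0
  have hη0 : η 0 = 1 := hη1 0 (Metric.mem_ball_self (by positivity))
  have e1 : (fun y => ΨT (0, y)) = ψ := by
    funext y; simp [hΨT, hη0]
  have hpT0 := hΘTp 0
  rw [e1, hT0] at hpT0
  have e2 : (fun y => ΘT (0, y)) = θ := hpT0.unique hp fun y hy =>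
    (hnear y (Metric.ball_subset_ball hεε' (hψs hy))).1
  have e3 : (fun y => Ξ (0, y)) = fun y => χ (β y) * ψ y := by
    funext y; simp [hΞ, hη0]
  simp only [hD] at h0
  rw [e2, e3] at h0
  exact sub_eq_zero.1 h0

end Graph


/-! ### Densities in charts -/

section Densities

variable {m : ℕ} {N M L : Type*} [TopologicalSpace N] [ChartedSpace (Eu m) N]
  [TopologicalSpace M] [ChartedSpace (Eu m) M] [TopologicalSpace L] [ChartedSpace (Eu m) L]

theorem modelDeriv_comp {f : N → M} {g : M → L} {y : N}
    (hg : MDifferentiableAt (𝓡 m) (𝓡 m) g (f y)) (hf : MDifferentiableAt (𝓡 m) (𝓡 m) f y) :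
    modelDeriv m (g ∘ f) y = (modelDeriv m g (f y)).comp (modelDeriv m f y) :=
  mfderiv_comp y hg hf

theorem modelDeriv_eq_fderiv (g : Eu m → Eu m) (y : Eu m) : modelDeriv m g y = fderiv ℝ g y :=
  mfderiv_eq_fderiv

theorem modelDeriv_id (x : M) : modelDeriv m (id : M → M) x = 1 := mfderiv_id

theorem modelDeriv_congr {f g : N → M} {y : N} (h : f =ᶠ[𝓝 y] g) :
    modelDeriv m f y = modelDeriv m g y := h.mfderiv_eq

theorem pullDensity_congr {f g : N → M} {y : N} (h : f =ᶠ[𝓝 y] g) (ρ : M → ℂ) :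
    pullDensity m f ρ y = pullDensity m g ρ y := by
  rw [pullDensity, pullDensity, modelDeriv_congr h, h.eq_of_nhds]

theorem pullDensity_comp {f : N → M} {g : M → L} {y : N}
    (hg : MDifferentiableAt (𝓡 m) (𝓡 m) g (f y)) (hf : MDifferentiableAt (𝓡 m) (𝓡 m) f y)
    (ρ : L → ℂ) : pullDensity m f (pullDensity m g ρ) y = pullDensity m (g ∘ f) ρ y := by
  have : (modelDeriv m (g ∘ f) y).det = (modelDeriv m g (f y)).det * (modelDeriv m f y).det := by
    rw [modelDeriv_comp hg hf]
    exact LinearMap.det_comp _ _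
  simp only [pullDensity, this, abs_mul, Complex.ofReal_mul, Function.comp]
  ring

theorem pullDensity_id (ρ : M → ℂ) (x : M) : pullDensity m (id : M → M) ρ x = ρ x := by
  rw [pullDensity, modelDeriv_id]
  simp [ContinuousLinearMap.det]

variable (m) in
/-- The coefficient of a density in a chart. -/
noncomputable def chartDensity (e : OpenPartialHomeomorph M (Eu m)) (ρ : M → ℂ) : Eu m → ℂ :=
  pullDensity m e.symm ρ

/-- The density with a given coefficient in a chart, extended by zero. -/
noncomputable def liftDensity (e : OpenPartialHomeomorph M (Eu m)) (ψ : Eu m → ℂ) : M → ℂ :=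
  e.source.indicator (pullDensity m e ψ)

variable {e c : OpenPartialHomeomorph M (Eu m)}

theorem liftDensity_add (ψ ψ' : Eu m → ℂ) :
    liftDensity e (ψ + ψ') = liftDensity e ψ + liftDensity e ψ' := by
  rw [liftDensity, pullDensity_add, indicator_add']; rfl

theorem liftDensity_smul (a : ℂ) (ψ : Eu m → ℂ) :
    liftDensity e (a • ψ) = a • liftDensity e ψ := by
  rw [liftDensity, pullDensity_smul, liftDensity]
  exact indicator_const_smul e.source a (pullDensity m e ψ)

variable [IsManifold (𝓡 m) ∞ M]

theorem mdifferentiableAt_chart (he : e ∈ IsManifold.maximalAtlas (𝓡 m) ∞ M) {x : M}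
    (hx : x ∈ e.source) : MDifferentiableAt (𝓡 m) (𝓡 m) e x :=
  (contMDiffAt_of_mem_maximalAtlas he hx).mdifferentiableAt (by simp)

theorem mdifferentiableAt_chart_symm (he : e ∈ IsManifold.maximalAtlas (𝓡 m) ∞ M) {y : Eu m}
    (hy : y ∈ e.target) : MDifferentiableAt (𝓡 m) (𝓡 m) e.symm y :=
  (contMDiffAt_symm_of_mem_maximalAtlas he hy).mdifferentiableAt (by simp)

theorem chartDensity_eq (he : e ∈ IsManifold.maximalAtlas (𝓡 m) ∞ M)
    (hc : c ∈ IsManifold.maximalAtlas (𝓡 m) ∞ M) (ρ : M → ℂ) {y : Eu m} (hy : y ∈ e.target)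
    (hyc : e.symm y ∈ c.source) :
    chartDensity m e ρ y =
      ((|(fderiv ℝ (fun y => c (e.symm y)) y).det| : ℝ) : ℂ) * chartDensity m c ρ (c (e.symm y)) := by
  have h1 := mdifferentiableAt_chart_symm he hy
  have h2 := mdifferentiableAt_chart hc hyc
  have h3 := mdifferentiableAt_chart_symm hc (c.map_source hyc)
  have e1 : ((|(fderiv ℝ (fun y => c (e.symm y)) y).det| : ℝ) : ℂ) *
      chartDensity m c ρ (c (e.symm y)) =
      pullDensity m (fun y => c (e.symm y)) (pullDensity m c.symm ρ) y := by
    rw [pullDensity, modelDeriv_eq_fderiv, chartDensity]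
  rw [e1, pullDensity_comp (f := fun y => c (e.symm y)) h3 (h2.comp y h1)]
  refine pullDensity_congr ?_ ρ
  have : e.symm ⁻¹' c.source ∈ 𝓝 y := (e.continuousAt_symm hy).preimage_mem_nhds
    (c.open_source.mem_nhds hyc)
  filter_upwards [this] with w hw
  exact (c.left_inv hw).symm

theorem chartDensity_liftDensity (he : e ∈ IsManifold.maximalAtlas (𝓡 m) ∞ M) (ψ : Eu m → ℂ)
    {y : Eu m} (hy : y ∈ e.target) : chartDensity m e (liftDensity e ψ) y = ψ y := by
  have h1 := mdifferentiableAt_chart_symm he hy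
  have h2 := mdifferentiableAt_chart he (e.map_target hy)
  have e1 : chartDensity m e (liftDensity e ψ) y = pullDensity m e.symm (pullDensity m e ψ) y := by
    rw [chartDensity, pullDensity, liftDensity, indicator_of_mem (e.map_target hy)]
    rfl
  rw [e1, pullDensity_comp h2 h1, ← pullDensity_id (m := m) ψ y]
  refine pullDensity_congr ?_ ψ
  filter_upwards [e.open_target.mem_nhds hy] with w hw
  exact e.right_inv hw

theorem liftDensity_chartDensity (he : e ∈ IsManifold.maximalAtlas (𝓡 m) ∞ M) {ρ : M → ℂ}
    {ψ : Eu m → ℂ} (hψ : ∀ y ∈ e.target, ψ y = chartDensity m e ρ y)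
    (hρ : ∀ x ∉ e.source, ρ x = 0) : liftDensity e ψ = ρ := by
  funext x
  by_cases hx : x ∈ e.source
  · have h1 := mdifferentiableAt_chart_symm he (e.map_source hx)
    have h2 := mdifferentiableAt_chart he hx
    rw [liftDensity, indicator_of_mem hx, pullDensity, hψ _ (e.map_source hx), chartDensity]
    change pullDensity m e (pullDensity m e.symm ρ) x = ρ x
    rw [pullDensity_comp h1 h2, ← pullDensity_id (m := m) ρ x]
    refine pullDensity_congr ?_ ρ
    filter_upwards [e.open_source.mem_nhds hx] with w hw
    exact e.left_inv hw
  · rw [liftDensity, indicator_of_notMem hx, hρ x hx]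

theorem contDiffOn_transition (he : e ∈ IsManifold.maximalAtlas (𝓡 m) ∞ M)
    (hc : c ∈ IsManifold.maximalAtlas (𝓡 m) ∞ M) :
    ContDiffOn ℝ ∞ (fun y => c (e.symm y)) (e.target ∩ e.symm ⁻¹' c.source) := by
  refine contMDiffOn_iff_contDiffOn.1 fun y hy => ContMDiffAt.contMDiffWithinAt ?_
  exact (contMDiffAt_of_mem_maximalAtlas hc hy.2).comp y
    (contMDiffAt_symm_of_mem_maximalAtlas he hy.1)

theorem isOpen_transition : IsOpen (e.target ∩ e.symm ⁻¹' c.source) :=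
  e.isOpen_inter_preimage_symm c.open_source

/-- A zero Jacobian would make every density have coefficient zero at `y`, by the transition rule,
whereas the lift of the constant `1` has coefficient `1`. -/
theorem det_transition_ne_zero (he : e ∈ IsManifold.maximalAtlas (𝓡 m) ∞ M)
    (hc : c ∈ IsManifold.maximalAtlas (𝓡 m) ∞ M) {y : Eu m} (hy : y ∈ e.target)
    (hyc : e.symm y ∈ c.source) : (fderiv ℝ (fun y => c (e.symm y)) y).det ≠ 0 := by
  intro h0
  have h := chartDensity_eq he hc (liftDensity e fun _ => 1) hy hyc
  rw [chartDensity_liftDensity he _ hy, h0] at h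
  simp at h

theorem contDiffOn_abs_det_transition (he : e ∈ IsManifold.maximalAtlas (𝓡 m) ∞ M)
    (hc : c ∈ IsManifold.maximalAtlas (𝓡 m) ∞ M) :
    ContDiffOn ℝ ∞ (fun y => |(fderiv ℝ (fun y => c (e.symm y)) y).det|)
      (e.target ∩ e.symm ⁻¹' c.source) := by
  intro y hy
  refine ContDiffAt.contDiffWithinAt (contDiffAt_abs_det ?_ (det_transition_ne_zero he hc hy.1 hy.2))
  exact ((contDiffOn_transition he hc).contDiffAt (isOpen_transition.mem_nhds hy)).fderiv_right
    (m := ∞) (by simp)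

/-- Smoothness is required only in preferred charts; the transition rule carries it to every chart
of the maximal atlas, in particular to charts flattening a submanifold. -/
theorem IsSmoothDensity.contDiffOn_chartDensity {ρ : M → ℂ} (hρ : IsSmoothDensity m ρ)
    (he : e ∈ IsManifold.maximalAtlas (𝓡 m) ∞ M) : ContDiffOn ℝ ∞ (chartDensity m e ρ) e.target := by
  intro y hy
  set c := chartAt (Eu m) (e.symm y) with hcdef
  have hc : c ∈ IsManifold.maximalAtlas (𝓡 m) ∞ M := IsManifold.chart_mem_maximalAtlas _
  have hyc : e.symm y ∈ c.source := mem_chart_source _ _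
  have hO : e.target ∩ e.symm ⁻¹' c.source ∈ 𝓝 y := isOpen_transition.mem_nhds ⟨hy, hyc⟩
  refine ContDiffAt.contDiffWithinAt ?_
  have h1 : ContDiffAt ℝ ∞ (fun y => (|(fderiv ℝ (fun y => c (e.symm y)) y).det| •
      chartDensity m c ρ (c (e.symm y)))) y :=
    ((contDiffOn_abs_det_transition he hc).contDiffAt hO).smul
      (((hρ (e.symm y)).contDiffAt (c.open_target.mem_nhds (c.map_source hyc))).comp y
        ((contDiffOn_transition he hc).contDiffAt hO))
  refine h1.congr_of_eventuallyEq ?_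
  filter_upwards [hO] with w hw
  rw [chartDensity_eq he hc ρ hw.1 hw.2, Complex.real_smul]

theorem support_liftDensity_subset (ψ : Eu m → ℂ) :
    Function.support (liftDensity e ψ) ⊆ e.source ∩ e ⁻¹' Function.support ψ := by
  intro x hx
  have hxs : x ∈ e.source := by
    by_contra h
    exact hx (indicator_of_notMem h _)
  refine ⟨hxs, fun h0 => hx ?_⟩
  rw [liftDensity, indicator_of_mem hxs, pullDensity, h0, mul_zero]

theorem support_liftDensity_subset_image (ψ : Eu m → ℂ) :
    Function.support (liftDensity e ψ) ⊆ e.symm '' tsupport ψ := by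
  intro x hx
  obtain ⟨h1, h2⟩ := support_liftDensity_subset ψ hx
  exact ⟨e x, subset_tsupport _ h2, e.left_inv h1⟩

variable [T2Space M]

theorem isCompact_image_symm {ψ : Eu m → ℂ} (hψ : HasCompactSupport ψ) (hs : tsupport ψ ⊆ e.target) :
    IsCompact (e.symm '' tsupport ψ) :=
  hψ.isCompact.image_of_continuousOn (e.continuousOn_symm.mono hs)

theorem tsupport_liftDensity_subset {ψ : Eu m → ℂ} (hψ : HasCompactSupport ψ)
    (hs : tsupport ψ ⊆ e.target) : tsupport (liftDensity e ψ) ⊆ e.symm '' tsupport ψ :=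
  closure_minimal (support_liftDensity_subset_image ψ) (isCompact_image_symm hψ hs).isClosed

/-- At points of the chart domain the transition rule gives smoothness. Any other point is off the
image of the support, which is compact and hence closed, so the density is zero nearby. -/
theorem liftDensity_mem_testDensity (he : e ∈ IsManifold.maximalAtlas (𝓡 m) ∞ M) {U : Opens M}
    {ψ : Eu m → ℂ} (hψ : ContDiff ℝ ∞ ψ) (hc : HasCompactSupport ψ) (hs : tsupport ψ ⊆ e.target)
    (hU : ∀ y ∈ tsupport ψ, e.symm y ∈ U) : liftDensity e ψ ∈ testDensity m U := by
  have hts := tsupport_liftDensity_subset hc hs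
  have hK := isCompact_image_symm hc hs
  refine ⟨fun x y hy => ?_, hK.of_isClosed_subset (isClosed_tsupport _) hts, hts.trans ?_⟩
  · set c := chartAt (Eu m) x
    have hcm : c ∈ IsManifold.maximalAtlas (𝓡 m) ∞ M := IsManifold.chart_mem_maximalAtlas _
    change ContDiffWithinAt ℝ ∞ (chartDensity m c (liftDensity e ψ)) _ _
    refine ContDiffAt.contDiffWithinAt ?_
    by_cases hye : c.symm y ∈ e.source
    · have hO : c.target ∩ c.symm ⁻¹' e.source ∈ 𝓝 y := isOpen_transition.mem_nhds ⟨hy, hye⟩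
      have h1 : ContDiffAt ℝ ∞ (fun y => (|(fderiv ℝ (fun y => e (c.symm y)) y).det| •
          ψ (e (c.symm y)))) y :=
        ((contDiffOn_abs_det_transition hcm he).contDiffAt hO).smul
          (hψ.contDiffAt.comp y ((contDiffOn_transition hcm he).contDiffAt hO))
      refine h1.congr_of_eventuallyEq ?_
      filter_upwards [hO] with w hw
      rw [chartDensity_eq hcm he _ hw.1 hw.2, chartDensity_liftDensity he _ (e.map_source hw.2),
        Complex.real_smul]
    · have hO : c.symm ⁻¹' (e.symm '' tsupport ψ)ᶜ ∈ 𝓝 y := by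
        refine (c.continuousAt_symm hy).preimage_mem_nhds (hK.isClosed.isOpen_compl.mem_nhds ?_)
        rintro ⟨w, hw, hwe⟩
        exact hye (hwe ▸ e.map_target (hs hw))
      refine (contDiffAt_const (c := (0 : ℂ))).congr_of_eventuallyEq ?_
      filter_upwards [hO] with w hw
      have : liftDensity e ψ (c.symm w) = 0 := by
        by_contra h
        exact hw (support_liftDensity_subset_image ψ h)
      rw [chartDensity, pullDensity, this, mul_zero]
  · rintro - ⟨y, hy, rfl⟩
    exact hU y hy

/-- Every test density supported in the domain of a chart comes from a smooth function. -/
theorem exists_liftDensity_eq (he : e ∈ IsManifold.maximalAtlas (𝓡 m) ∞ M) {U : Opens M}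
    {ρ : M → ℂ} (hρ : ρ ∈ testDensity m U) (hs : tsupport ρ ⊆ e.source) :
    ∃ ψ : Eu m → ℂ, ContDiff ℝ ∞ ψ ∧ HasCompactSupport ψ ∧ tsupport ψ ⊆ e '' tsupport ρ ∧
      liftDensity e ψ = ρ ∧ ∀ y ∈ e.target, ψ y = chartDensity m e ρ y := by
  classical
  obtain ⟨h1, h2, h3⟩ := hρ
  have hK : IsCompact (e '' tsupport ρ) := h2.isCompact.image_of_continuousOn (e.continuousOn.mono hs)
  have hKt : e '' tsupport ρ ⊆ e.target := by
    rintro - ⟨x, hx, rfl⟩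
    exact e.map_source (hs hx)
  set ψ : Eu m → ℂ := e.target.indicator (chartDensity m e ρ) with hψ
  have hz : ∀ y ∉ e '' tsupport ρ, ψ y = 0 := by
    intro y hy
    by_cases hyt : y ∈ e.target
    · have h0 : ρ (e.symm y) = 0 :=
        image_eq_zero_of_notMem_tsupport fun h => hy ⟨_, h, e.right_inv hyt⟩
      rw [hψ, indicator_of_mem hyt, chartDensity, pullDensity, h0, mul_zero]
    · rw [hψ, indicator_of_notMem hyt]
  have hts : tsupport ψ ⊆ e '' tsupport ρ :=
    closure_minimal (fun y hy => by_contra fun h => hy (hz y h)) hK.isClosed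
  have he' : ∀ y ∈ e.target, ψ y = chartDensity m e ρ y := fun y hy => indicator_of_mem hy _
  refine ⟨ψ, contDiff_of_eq_zero e.open_target hK.isClosed hKt
    ((h1.contDiffOn_chartDensity he).congr he') hz,
    hK.of_isClosed_subset (isClosed_tsupport _) hts, hts, liftDensity_chartDensity he he' ?_, he'⟩
  intro x hx
  exact image_eq_zero_of_notMem_tsupport fun h => hx (hs h)

theorem mul_mem_testDensity {U : Opens M} {ρ : M → ℂ} (hρ : ρ ∈ testDensity m U) {α : M → ℝ}
    (hα : ContMDiff (𝓡 m) 𝓘(ℝ, ℝ) ∞ α) : (fun x => α x • ρ x) ∈ testDensity m U := by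
  obtain ⟨h1, h2, h3⟩ := hρ
  have hts : tsupport (fun x => α x • ρ x) ⊆ tsupport ρ := tsupport_smul_subset_right α ρ
  refine ⟨fun c => ?_, h2.of_isClosed_subset (isClosed_tsupport _) hts, hts.trans h3⟩
  have e1 : densityInChart m c (fun x => α x • ρ x) =
      fun y => α ((chartAt (Eu m) c).symm y) • densityInChart m c ρ y := by
    funext y
    simp only [densityInChart, pullDensity, Complex.real_smul]
    ring
  rw [e1]
  have h4 : ContDiffOn ℝ ∞ (fun y => α ((chartAt (Eu m) c).symm y)) (chartAt (Eu m) c).target := by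
    refine contMDiffOn_iff_contDiffOn.1 fun y hy => ContMDiffAt.contMDiffWithinAt ?_
    exact hα.contMDiffAt.comp y
      (contMDiffAt_symm_of_mem_maximalAtlas (IsManifold.chart_mem_maximalAtlas _) hy)
  exact h4.smul (h1 c)

/-- A functional on test densities which vanishes locally is zero. -/
theorem eq_zero_of_locally [SecondCountableTopology M] {U : Opens M}
    {u : Module.Dual ℂ (testDensity m U)}
    (h : ∀ z ∈ U, ∃ V : Set M, IsOpen V ∧ z ∈ V ∧
      ∀ ρ : testDensity m U, tsupport (ρ : M → ℂ) ⊆ V → u ρ = 0) : u = 0 := by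
  classical
  have : LocallyCompactSpace M := ChartedSpace.locallyCompactSpace (Eu m) M
  refine LinearMap.ext fun ρ => ?_
  rw [LinearMap.zero_apply]
  choose! V hV hzV hu using h
  obtain ⟨t, ht⟩ := ρ.2.2.1.isCompact.elim_finite_subcover (fun z : U => V z)
    (fun z => hV z z.2) fun x hx => mem_iUnion.2 ⟨⟨x, ρ.2.2.2 hx⟩, hzV x (ρ.2.2.2 hx)⟩
  obtain ⟨α, hα⟩ := SmoothPartitionOfUnity.exists_isSubordinate (𝓡 m) (isClosed_tsupport (ρ : M → ℂ))
    (fun z : t => V (z : U)) (fun z => hV _ (z : U).2) (fun x hx => by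
      obtain ⟨i, hi, hxi⟩ := mem_iUnion₂.1 (ht hx)
      exact mem_iUnion.2 ⟨⟨i, hi⟩, hxi⟩)
  have hsum : ρ = ∑ i : t, (⟨_, mul_mem_testDensity ρ.2 (α i).contMDiff⟩ : testDensity m U) := by
    refine Subtype.ext (funext fun x => ?_)
    rw [AddSubmonoidClass.coe_finsetSum, Finset.sum_apply]
    by_cases hx : x ∈ tsupport (ρ : M → ℂ)
    · have := α.sum_eq_one hx
      rw [finsum_eq_sum_of_fintype] at this
      rw [← Finset.sum_smul, this, one_smul]
    · have h0 := image_eq_zero_of_notMem_tsupport hx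
      rw [h0]
      exact (Finset.sum_eq_zero fun i _ => by
        change α i x • (ρ : M → ℂ) x = 0
        rw [h0, smul_zero]).symm
  rw [hsum, map_sum]
  refine Finset.sum_eq_zero fun i _ => hu _ (i : U).2 _ ?_
  exact (tsupport_smul_subset_left (α i) (ρ : M → ℂ)).trans (hα i)

end Densities


/-! ### Generalized functions in charts -/

section ChartFunctionals

/-- The Leibniz rule and the bound for derivatives of composites. It transfers seminorm estimates
through a change of coordinates `σ` with Jacobian factor `J`. -/
theorem exists_bound_smul_comp {E : Type} [NormedAddCommGroup E] [NormedSpace ℝ E]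
    [FiniteDimensional ℝ E] {σ : E → E} {J : E → ℝ} (hσ : ContDiff ℝ ∞ σ)
    (hJ : ContDiff ℝ ∞ J) {K : Set E} (hK : IsCompact K) (N : ℕ) :
    ∃ C : ℝ, ∀ ψ : E → ℂ, ContDiff ℝ ∞ ψ → ∀ B : ℝ, 0 ≤ B →
      (∀ j ≤ N, ∀ y ∈ K, ‖iteratedFDeriv ℝ j ψ (σ y)‖ ≤ B) →
      ∀ j ≤ N, ∀ y ∈ K, ‖iteratedFDeriv ℝ j (fun y => J y • ψ (σ y)) y‖ ≤ C * B := by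
  obtain ⟨C₁, hC₁, h₁⟩ := exists_bound_iteratedFDeriv hσ hK N
  obtain ⟨C₂, hC₂, h₂⟩ := exists_bound_iteratedFDeriv hJ hK N
  refine ⟨2 ^ N * (C₂ * (N.factorial * C₁ ^ N)), fun ψ hψ B hB hb j hj y hy => ?_⟩
  have hcomp : ∀ i ≤ N, ‖iteratedFDeriv ℝ i (fun y => ψ (σ y)) y‖ ≤ N.factorial * B * C₁ ^ N := by
    intro i hi
    refine (norm_iteratedFDeriv_comp_le hψ hσ (n := i) (by exact_mod_cast le_top) y (C := B) (D := C₁)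
      (fun l hl => hb l (hl.trans hi) y hy) fun l hl1 hl => ?_).trans ?_
    · exact (h₁ l (hl.trans hi) y hy).trans (le_self_pow₀ hC₁ (by omega))
    · gcongr
  have hC₂0 : 0 ≤ C₂ := by linarith
  have hC₁0 : 0 ≤ C₁ := by linarith
  have hX : 0 ≤ C₂ * (N.factorial * B * C₁ ^ N) := by positivity
  calc ‖iteratedFDeriv ℝ j (fun y => J y • ψ (σ y)) y‖
      ≤ ∑ i ∈ Finset.range (j + 1), (j.choose i : ℝ) * ‖iteratedFDeriv ℝ i J y‖ *
          ‖iteratedFDeriv ℝ (j - i) (fun y => ψ (σ y)) y‖ :=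
        norm_iteratedFDeriv_smul_le hJ (hψ.comp hσ) y (by exact_mod_cast le_top)
    _ ≤ ∑ i ∈ Finset.range (j + 1), (j.choose i : ℝ) * (C₂ * (N.factorial * B * C₁ ^ N)) := by
        refine Finset.sum_le_sum fun i hi => ?_
        have hi' := Finset.mem_range.1 hi
        rw [mul_assoc]
        gcongr
        · exact h₂ i (by omega) y hy
        · exact hcomp _ (by omega)
    _ = 2 ^ j * (C₂ * (N.factorial * B * C₁ ^ N)) := by
        rw [← Finset.sum_mul]
        congr 1
        exact_mod_cast Nat.sum_range_choose j
    _ ≤ 2 ^ N * (C₂ * (N.factorial * B * C₁ ^ N)) := by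
        gcongr
        norm_num
    _ = _ := by ring

variable {m : ℕ} {M : Type*} [TopologicalSpace M] [ChartedSpace (Eu m) M]

/-- `f` is the expression of the functional `u` in the chart `e`. -/
def IsChartFunctional {U : Opens M} (e : OpenPartialHomeomorph M (Eu m))
    (u : Module.Dual ℂ (testDensity m U)) (f : (Eu m → ℂ) →ₗ[ℂ] ℂ) : Prop :=
  ∀ (ψ : Eu m → ℂ) (h : liftDensity e ψ ∈ testDensity m U), f ψ = u ⟨_, h⟩

/-- The functional is determined only on functions whose lift is a test density; it is extended to
all functions by pure linear algebra. The extension is arbitrary, and no continuity is claimed for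
it. -/
theorem exists_isChartFunctional {U : Opens M} (e : OpenPartialHomeomorph M (Eu m))
    (u : Module.Dual ℂ (testDensity m U)) : ∃ f, IsChartFunctional e u f := by
  let Λ : (Eu m → ℂ) →ₗ[ℂ] (M → ℂ) :=
    { toFun := liftDensity e, map_add' := liftDensity_add, map_smul' := liftDensity_smul }
  obtain ⟨f, hf⟩ := LinearMap.exists_extend
    (u.comp (Λ.restrict (p := (testDensity m U).comap Λ) (q := testDensity m U) fun _ h => h))
  exact ⟨f, fun ψ h => LinearMap.congr_fun hf ⟨ψ, h⟩⟩

variable [IsManifold (𝓡 m) ∞ M] [T2Space M] {U : Opens M} {e : OpenPartialHomeomorph M (Eu m)}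
  {u : Module.Dual ℂ (testDensity m U)} {f : (Eu m → ℂ) →ₗ[ℂ] ℂ}

theorem IsChartFunctional.eq_zero_of_tsupport (h : IsChartFunctional e u f)
    (he : e ∈ IsManifold.maximalAtlas (𝓡 m) ∞ M) {Z : Set M} (hu : IsSupportedIn u Z)
    {ψ : Eu m → ℂ} (hψ : ContDiff ℝ ∞ ψ) (hc : HasCompactSupport ψ)
    (hs : tsupport ψ ⊆ e.target ∩ e.symm ⁻¹' U) (hZ : ∀ y ∈ tsupport ψ, e.symm y ∉ Z) : f ψ = 0 := by
  have hst : tsupport ψ ⊆ e.target := hs.trans inter_subset_left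
  rw [h ψ (liftDensity_mem_testDensity he hψ hc hst fun y hy => (hs hy).2)]
  refine hu _ (Set.disjoint_left.2 fun x hx hxZ => ?_)
  obtain ⟨y, hy, rfl⟩ := tsupport_liftDensity_subset hc hst hx
  exact hZ y hy hxZ

/-- Continuity of `u` is formulated in preferred charts, so the bound is taken in the preferred
chart at the point and carried to `e` along the transition map and its Jacobian. -/
theorem IsChartFunctional.finiteOrderOn (h : IsChartFunctional e u f)
    (he : e ∈ IsManifold.maximalAtlas (𝓡 m) ∞ M) (hu : u ∈ genFun m U) {y₀ : Eu m}
    (hy₀ : y₀ ∈ e.target) (hy₀U : e.symm y₀ ∈ U) :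
    ∃ R > 0, Metric.closedBall y₀ R ⊆ e.target ∩ e.symm ⁻¹' U ∧
      FiniteOrderOn f (Metric.closedBall y₀ R) := by
  set x₀ := e.symm y₀
  set c := chartAt (Eu m) x₀ with hcdef
  have hc : c ∈ IsManifold.maximalAtlas (𝓡 m) ∞ M := IsManifold.chart_mem_maximalAtlas _
  have hx₀ : x₀ ∈ c.source := mem_chart_source _ _
  have hw₀ : c x₀ ∈ c.target ∩ c.symm ⁻¹' e.source :=
    ⟨c.map_source hx₀, by simpa [c.left_inv hx₀] using e.map_target hy₀⟩
  obtain ⟨σ, hσ, hσe⟩ := exists_contDiff_eventuallyEq isOpen_transition hw₀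
    (contDiffOn_transition hc he)
  obtain ⟨J, hJ, hJe⟩ := exists_contDiff_eventuallyEq isOpen_transition hw₀
    (contDiffOn_abs_det_transition hc he)
  have hgood : ∀ᶠ w in 𝓝 (c x₀), (σ w = e (c.symm w) ∧
      J w = |(fderiv ℝ (fun y => e (c.symm y)) w).det|) ∧ w ∈ c.target ∩ c.symm ⁻¹' e.source :=
    (hσe.and hJe).and (isOpen_transition.mem_nhds hw₀)
  obtain ⟨s, hs, hball⟩ := Metric.eventually_nhds_iff_ball.1 hgood
  have hcont : ContinuousAt (fun y => c (e.symm y)) y₀ :=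
    (c.continuousAt hx₀).comp (e.continuousAt_symm hy₀)
  have hnear : e.target ∩ e.symm ⁻¹' (U ∩ c.source) ∩
      (fun y => c (e.symm y)) ⁻¹' Metric.ball (c x₀) s ∈ 𝓝 y₀ :=
    inter_mem ((e.isOpen_inter_preimage_symm (U.isOpen.inter c.open_source)).mem_nhds
      ⟨hy₀, hy₀U, hx₀⟩) (hcont.preimage_mem_nhds (Metric.ball_mem_nhds _ hs))
  obtain ⟨R, hR, hRs⟩ := Metric.nhds_basis_closedBall.mem_iff.1 hnear
  refine ⟨R, hR, fun y hy => ⟨(hRs hy).1.1, (hRs hy).1.2.1⟩, ?_⟩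
  set K := Metric.closedBall y₀ R
  have hKc : IsCompact K := isCompact_closedBall y₀ R
  set K' := (fun y => c (e.symm y)) '' K with hK'
  have hK'c : IsCompact K' := hKc.image_of_continuousOn
    ((contDiffOn_transition he hc).continuousOn.mono fun y hy => ⟨(hRs hy).1.1, (hRs hy).1.2.2⟩)
  have hK'b : K' ⊆ Metric.ball (c x₀) s := by
    rintro - ⟨y, hy, rfl⟩
    exact (hRs hy).2
  have him : ∀ y ∈ K, c.symm (c (e.symm y)) = e.symm y := fun y hy => c.left_inv (hRs hy).1.2.2
  obtain ⟨C, N, hb⟩ := hu x₀ K' hK'c (fun w hw => (hball w (hK'b hw)).2.1) (by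
    rintro - ⟨-, ⟨y, hy, rfl⟩, rfl⟩
    change c.symm (c (e.symm y)) ∈ U
    rw [him y hy]
    exact (hRs hy).1.2.1)
  obtain ⟨C', hC'⟩ := exists_bound_smul_comp hσ hJ hK'c N
  -- The absolute value is taken because `C'` has no known sign, while the seminorm bound passed to
  -- the continuity estimate must be nonnegative.
  refine ⟨C * |C'|, N, fun ψ hψ hψK B hB hψB => ?_⟩
  have hψc : HasCompactSupport ψ := hKc.of_isClosed_subset (isClosed_tsupport _) hψK
  have hψt : tsupport ψ ⊆ e.target := fun y hy => (hRs (hψK hy)).1.1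
  have hmem := liftDensity_mem_testDensity (U := U) he hψ hψc hψt
    fun y hy => (hRs (hψK hy)).1.2.1
  rw [h ψ hmem, mul_assoc]
  refine hb ⟨_, hmem⟩ ?_ (|C'| * B) (by positivity) fun j hj w hw => ?_
  · refine (tsupport_liftDensity_subset hψc hψt).trans ?_
    rintro - ⟨y, hy, rfl⟩
    exact ⟨_, ⟨y, hψK hy, rfl⟩, him y (hψK hy)⟩
  · have hev : densityInChart m x₀ (liftDensity e ψ) =ᶠ[𝓝 w] fun w => J w • ψ (σ w) := by
      filter_upwards [Metric.isOpen_ball.mem_nhds (hK'b hw)] with w hw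
      obtain ⟨⟨h1, h2⟩, h3, h4⟩ := hball w hw
      change chartDensity m c (liftDensity e ψ) w = _
      rw [chartDensity_eq hc he _ h3 h4, chartDensity_liftDensity he _ (e.map_source h4), h1, h2,
        Complex.real_smul]
    change ‖iteratedFDeriv ℝ j (densityInChart m x₀ (liftDensity e ψ)) w‖ ≤ _
    rw [(hev.iteratedFDeriv ℝ j).eq_of_nhds]
    refine (hC' ψ hψ B hB (fun i hi w hw => hψB i hi _ ?_) j hj w hw).trans
      (mul_le_mul_of_nonneg_right (le_abs_self C') hB)
    obtain ⟨y, hy, rfl⟩ := hw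
    rw [(hball _ (hK'b ⟨y, hy, rfl⟩)).1.1]
    change e (c.symm (c (e.symm y))) ∈ K
    rw [him y hy, e.right_inv (hRs hy).1.1]
    exact hy

end ChartFunctionals

/-! ### The group action in charts and local equivariance -/

section ChartAction

variable {d m : ℕ} {H : Type*} [Group H] [TopologicalSpace H] [ChartedSpace (Eu d) H]
  [IsManifold (𝓡 d) ∞ H]
  {M : Type*} [TopologicalSpace M] [ChartedSpace (Eu m) M] [IsManifold (𝓡 m) ∞ M]
  [MulAction H M] [ContMDiffSMul (𝓡 d) (𝓡 m) ∞ H M]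

variable (m) in
theorem mdifferentiableAt_smul (d : ℕ) {H : Type*} [Group H] [TopologicalSpace H]
    [ChartedSpace (Eu d) H] {M : Type*} [TopologicalSpace M] [ChartedSpace (Eu m) M] [MulAction H M]
    [ContMDiffSMul (𝓡 d) (𝓡 m) ∞ H M] (h : H) (x : M) :
    MDifferentiableAt (𝓡 m) (𝓡 m) (fun x : M => h • x) x :=
  (ContMDiffSMul.contMDiff_const_smul (I := 𝓡 d) (I' := 𝓡 m) (n := ∞) h).contMDiffAt.mdifferentiableAt
    (by simp)

/-- The action read in charts is smooth. -/
theorem contDiffOn_chart_smul {κ : OpenPartialHomeomorph H (Eu d)} {e c : OpenPartialHomeomorph M (Eu m)}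
    (hκ : κ ∈ IsManifold.maximalAtlas (𝓡 d) ∞ H) (he : e ∈ IsManifold.maximalAtlas (𝓡 m) ∞ M)
    (hc : c ∈ IsManifold.maximalAtlas (𝓡 m) ∞ M) {O : Set (Eu d × Eu m)}
    (hO : ∀ p ∈ O, p.1 ∈ κ.target ∧ p.2 ∈ e.target ∧ κ.symm p.1 • e.symm p.2 ∈ c.source) :
    ContDiffOn ℝ ∞ (fun p : Eu d × Eu m => c (κ.symm p.1 • e.symm p.2)) O := by
  refine contMDiffOn_iff_contDiffOn.1 fun p hp => ContMDiffAt.contMDiffWithinAt ?_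
  obtain ⟨h1, h2, h3⟩ := hO p hp
  have e1 : ContMDiffAt 𝓘(ℝ, Eu d × Eu m) (𝓡 d) ∞ (fun p : Eu d × Eu m => κ.symm p.1) p :=
    (contMDiffAt_symm_of_mem_maximalAtlas hκ h1).comp p contDiff_fst.contMDiff.contMDiffAt
  have e2 : ContMDiffAt 𝓘(ℝ, Eu d × Eu m) (𝓡 m) ∞ (fun p : Eu d × Eu m => e.symm p.2) p :=
    (contMDiffAt_symm_of_mem_maximalAtlas he h2).comp p contDiff_snd.contMDiff.contMDiffAt
  exact (contMDiffAt_of_mem_maximalAtlas hc h3).comp p (e1.smul e2)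

theorem isOpen_chart_smul (κ : OpenPartialHomeomorph H (Eu d)) (e c : OpenPartialHomeomorph M (Eu m))
    [ContinuousSMul H M] :
    IsOpen {p : Eu d × Eu m | (p.1 ∈ κ.target ∧ p.2 ∈ e.target) ∧
      κ.symm p.1 • e.symm p.2 ∈ c.source} := by
  have hcont : ContinuousOn (fun p : Eu d × Eu m => κ.symm p.1 • e.symm p.2)
      (κ.target ×ˢ e.target) :=
    (κ.continuousOn_symm.comp continuousOn_fst fun p hp => hp.1).smul
      (e.continuousOn_symm.comp continuousOn_snd fun p hp => hp.2)
  exact hcont.isOpen_inter_preimage (κ.open_target.prod e.open_target) c.open_source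

variable [T2Space M] {U : Opens M} {e : OpenPartialHomeomorph M (Eu m)}
  {u : Module.Dual ℂ (testDensity m U)} {f : (Eu m → ℂ) →ₗ[ℂ] ℂ}

/-- For functions supported near the fixed point, the push-forward in coordinates lifts to the
push-forward of densities under the group element. Both lifts are supported in `U`, so equivariance
can be tested on them even though `U` need not be stable. -/
theorem IsChartFunctional.locallyEquivariant (h : IsChartFunctional e u f)
    (he : e ∈ IsManifold.maximalAtlas (𝓡 m) ∞ M) {χ : H →* ℂˣ} (hu : IsEquivariant χ u)
    {κ : OpenPartialHomeomorph H (Eu d)} {b₀ : Eu d} (hb₀ : b₀ ∈ κ.target) {y₀ : Eu m} (hy₀ : y₀ ∈ e.target) (hy₀U : e.symm y₀ ∈ U)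
    (hfix : κ.symm b₀ • e.symm y₀ = e.symm y₀) {A : Eu d × Eu m → Eu m} (hAc : Continuous A)
    (hA : A =ᶠ[𝓝 (b₀, y₀)] fun p => e (κ.symm p.1 • e.symm p.2)) :
    LocallyEquivariant f A (fun b => (χ (κ.symm b) : ℂ)) b₀ y₀ := by
  have : ContinuousSMul H M := ContMDiffSMul.continuousSMul (I := 𝓡 d) (I' := 𝓡 m) ∞
  have hcont : ContinuousAt (fun p : Eu d × Eu m => κ.symm p.1 • e.symm p.2) (b₀, y₀) :=
    ((κ.continuousAt_symm hb₀).comp continuousAt_fst).smul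
      ((e.continuousAt_symm hy₀).comp continuousAt_snd)
  have h1 : ∀ᶠ p : Eu d × Eu m in 𝓝 (b₀, y₀), κ.symm p.1 • e.symm p.2 ∈ (U : Set M) ∩ e.source :=
    hcont.preimage_mem_nhds ((U.isOpen.inter e.open_source).mem_nhds (by
      change κ.symm b₀ • e.symm y₀ ∈ _
      rw [hfix]
      exact ⟨hy₀U, e.map_target hy₀⟩))
  have h2 : ∀ᶠ p : Eu d × Eu m in 𝓝 (b₀, y₀), p.2 ∈ e.target ∩ e.symm ⁻¹' U :=
    continuousAt_snd.preimage_mem_nhds ((e.isOpen_inter_preimage_symm U.isOpen).mem_nhds ⟨hy₀, hy₀U⟩)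
  obtain ⟨r, hr, hball⟩ := Metric.eventually_nhds_iff_ball.1 ((h1.and h2).and hA.eventually_nhds)
  refine ⟨r, hr, fun b hb ψ θ hψ hθ hψs hp => ?_⟩
  have hgood : ∀ y ∈ tsupport ψ, _ := fun y hy => hball (b, y) (by
    rw [← ball_prod_same]; exact ⟨hb, hψs hy⟩)
  set g := κ.symm b with hg
  have hAe : ∀ y ∈ tsupport ψ, A (b, y) = e (g • e.symm y) := fun y hy => (hgood y hy).2.self_of_nhds
  have hψt : tsupport ψ ⊆ e.target := fun y hy => (hgood y hy).1.2.1
  have hψc : HasCompactSupport ψ := isCompact_tsupport_of_subset_ball hψs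
  have hψm := liftDensity_mem_testDensity (U := U) he hψ hψc hψt fun y hy => (hgood y hy).1.2.2
  have hKc : IsCompact ((fun y => A (b, y)) '' tsupport ψ) :=
    hψc.isCompact.image (hAc.comp (Continuous.prodMk_right b))
  have hθK : tsupport θ ⊆ (fun y => A (b, y)) '' tsupport ψ :=
    closure_minimal (fun z hz => by_contra fun hn => hz (hp.2 z hn)) hKc.isClosed
  have hθt : tsupport θ ⊆ e.target := by
    intro z hz
    obtain ⟨y, hy, rfl⟩ := hθK hz
    change A (b, y) ∈ e.target
    rw [hAe y hy]
    exact e.map_source (hgood y hy).1.1.2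
  have hθm := liftDensity_mem_testDensity (U := U) he hθ (hKc.of_isClosed_subset
    (isClosed_tsupport _) hθK) hθt fun z hz => by
      obtain ⟨y, hy, rfl⟩ := hθK hz
      change e.symm (A (b, y)) ∈ U
      rw [hAe y hy, e.left_inv (hgood y hy).1.1.2]
      exact (hgood y hy).1.1.1
  rw [h ψ hψm, h θ hθm]
  refine hu g ⟨_, hψm⟩ ⟨_, hθm⟩ (funext fun x => ?_)
  change liftDensity e θ x = pullDensity m (fun x : M => g⁻¹ • x) (liftDensity e ψ) x
  -- On the translate of the support the identity is the chain rule for pull-backs together with `g`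
  -- and its inverse cancelling; off it, both densities vanish.
  by_cases hx : ∃ y ∈ tsupport ψ, g • e.symm y = x
  · obtain ⟨y, hy, rfl⟩ := hx
    have hs := (hgood y hy).1.1.2
    have hyt := hψt hy
    have hsm : ∀ (k : H) (x : M), MDifferentiableAt (𝓡 m) (𝓡 m) (fun x : M => k • x) x :=
      mdifferentiableAt_smul m d
    have hd : MDifferentiableAt (𝓡 m) (𝓡 m) (fun w => e (g • e.symm w)) y :=
      (mdifferentiableAt_chart he hs).comp y
        ((hsm g _).comp y (mdifferentiableAt_chart_symm he hyt))
    have e1 : liftDensity e ψ (e.symm y) = pullDensity m e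
        (pullDensity m (fun w => e (g • e.symm w)) θ) (e.symm y) := by
      rw [liftDensity, indicator_of_mem (e.map_target hyt), pullDensity, pullDensity, pullDensity,
        e.right_inv hyt, ← hp.1 y hy, modelDeriv_eq_fderiv, ← hAe y hy]
      have : (fun y => A (b, y)) =ᶠ[𝓝 y] fun w => e (g • e.symm w) :=
        (Continuous.tendsto (by fun_prop : Continuous fun y : Eu m => (b, y)) y).eventually
          (hgood y hy).2
      rw [this.fderiv_eq]
    have e2 : pullDensity m (fun x : M => g⁻¹ • x) (liftDensity e ψ) (g • e.symm y) =
        pullDensity m (fun x : M => g⁻¹ • x) (pullDensity m e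
          (pullDensity m (fun w => e (g • e.symm w)) θ)) (g • e.symm y) := by
      rw [pullDensity, pullDensity, inv_smul_smul, e1]
    have hde := mdifferentiableAt_chart he (e.map_target hyt)
    have hd' : MDifferentiableAt (𝓡 m) (𝓡 m) (fun w => e (g • e.symm w)) (e (e.symm y)) := by
      rwa [e.right_inv hyt]
    have hcs : ContinuousAt (fun x : M => g⁻¹ • x) (g • e.symm y) :=
      (continuous_const_smul g⁻¹).continuousAt
    have hev : ∀ᶠ x : M in 𝓝 (g • e.symm y), g⁻¹ • x ∈ e.source :=
      hcs.preimage_mem_nhds (e.open_source.mem_nhds (by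
        rw [inv_smul_smul]
        exact e.map_target hyt))
    have e3 : pullDensity m (fun x : M => g⁻¹ • x) (pullDensity m e
        (pullDensity m (fun w => e (g • e.symm w)) θ)) (g • e.symm y) =
        pullDensity m (fun x : M => g⁻¹ • x)
          (pullDensity m ((fun w => e (g • e.symm w)) ∘ e) θ) (g • e.symm y) := by
      rw [pullDensity, pullDensity]
      congr 1
      change pullDensity m e (pullDensity m (fun w => e (g • e.symm w)) θ) (g⁻¹ • g • e.symm y) =
        pullDensity m ((fun w => e (g • e.symm w)) ∘ e) θ (g⁻¹ • g • e.symm y)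
      rw [inv_smul_smul, pullDensity_comp hd' hde]
    rw [e2, e3, pullDensity_comp (by rw [inv_smul_smul]; exact hd'.comp _ hde) (hsm _ _),
      liftDensity, indicator_of_mem hs]
    refine pullDensity_congr ?_ θ
    filter_upwards [hev] with x hx
    simp only [Function.comp]
    rw [e.left_inv hx, smul_inv_smul]
  · have hl : liftDensity e ψ (g⁻¹ • x) = 0 := by
      by_contra hne
      obtain ⟨y, hy, hyx⟩ := support_liftDensity_subset_image ψ hne
      exact hx ⟨y, hy, by rw [hyx, smul_inv_smul]⟩
    rw [pullDensity, hl, mul_zero]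
    by_contra hne
    obtain ⟨z, hz, rfl⟩ := support_liftDensity_subset_image θ hne
    obtain ⟨y, hy, rfl⟩ := hθK hz
    refine hx ⟨y, hy, ?_⟩
    change _ = e.symm (A (b, y))
    rw [hAe y hy, e.left_inv (hgood y hy).1.1.2]

end ChartAction


/-! ### Linear algebra and sections of submersions -/

section Sections

variable {X E : Type} [NormedAddCommGroup X] [NormedSpace ℝ X] [FiniteDimensional ℝ X]
  [NormedAddCommGroup E] [NormedSpace ℝ E] [FiniteDimensional ℝ E]

theorem exists_projection (W : Submodule ℝ E) :
    ∃ P Q : E →L[ℝ] E, (∀ y, P y + Q y = y) ∧ (∀ y, P (P y) = P y) ∧ (∀ y, Q y = 0 ↔ y ∈ W) ∧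
      ∀ y, P y ∈ W := by
  obtain ⟨g, hg⟩ := LinearMap.exists_leftInverse_of_injective W.subtype W.ker_subtype
  have hg' : ∀ w : W, g w = w := fun w => LinearMap.congr_fun hg w
  let P : E →L[ℝ] E := LinearMap.toContinuousLinearMap (W.subtype.comp g)
  have hP : ∀ y, P y = g y := fun y => rfl
  refine ⟨P, 1 - P, fun y => by simp, fun y => by rw [hP, hP, hg'], fun y => ⟨fun h => ?_, fun h => ?_⟩,
    fun y => (g y).2⟩
  · have : y = P y := sub_eq_zero.1 h
    rw [this]
    exact (g y).2
  · change y - P y = 0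
    rw [hP, hg' ⟨y, h⟩, sub_self]

theorem hasDerivAt_mem {c : ℝ → E} {c' : E} (hc : HasDerivAt c c' 0) {W : Submodule ℝ E}
    (h : ∀ᶠ t in 𝓝 (0 : ℝ), c t ∈ W) : c' ∈ W := by
  obtain ⟨P, Q, -, -, hQ, -⟩ := exists_projection W
  rw [← hQ]
  have h1 : HasDerivAt (fun t => Q (c t)) (Q c') 0 := Q.hasFDerivAt.comp_hasDerivAt 0 hc
  refine h1.unique ((hasDerivAt_const (0 : ℝ) (0 : E)).congr_of_eventuallyEq ?_)
  filter_upwards [h] with t ht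
  exact (hQ _).2 ht

theorem fderiv_mem {F : X → E} {x : X} (hF : DifferentiableAt ℝ F x) {V : Submodule ℝ X}
    {W : Submodule ℝ E} (h : ∀ᶠ y in 𝓝 x, y - x ∈ V → F y ∈ W) {v : X} (hv : v ∈ V) :
    fderiv ℝ F x v ∈ W := by
  have h1 : HasDerivAt (fun t : ℝ => x + t • v) v 0 := by
    simpa using ((hasDerivAt_id (0 : ℝ)).smul_const v).const_add x
  have h0 : x + (0 : ℝ) • v = x := by simp
  have h2 : HasDerivAt (fun t : ℝ => F (x + t • v)) (fderiv ℝ F x v) 0 := by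
    have hF' : HasFDerivAt F (fderiv ℝ F x) (x + (0 : ℝ) • v) := by rw [h0]; exact hF.hasFDerivAt
    exact hF'.comp_hasDerivAt 0 h1
  refine hasDerivAt_mem h2 ?_
  have hc : Tendsto (fun t : ℝ => x + t • v) (𝓝 0) (𝓝 x) := by
    have : Continuous (fun t : ℝ => x + t • v) := by fun_prop
    simpa using this.tendsto 0
  filter_upwards [hc.eventually h] with t ht
  exact ht (by simpa using V.smul_mem t hv)

/-- Powers of `B - 1` and `Y - 1` agree modulo `W`, so the `k`-th power of `B - 1` lands in `W`; one
further factor kills it because `B` is the identity on `W`. -/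
theorem isNilpotent_sub_one_of_quotient {B Y : E →L[ℝ] E} {W : Submodule ℝ E} (hB : ∀ w ∈ W, B w = w)
    (hY : ∀ w ∈ W, Y w ∈ W) (hBY : ∀ v, B v - Y v ∈ W) {k : ℕ} (hk : ∀ v, ((Y - 1) ^ k) v ∈ W) :
    IsNilpotent (B - 1) := by
  have h : ∀ (j : ℕ) (v : E), ((B - 1) ^ j) v - ((Y - 1) ^ j) v ∈ W := by
    intro j
    induction j with
    | zero => intro v; simp
    | succ j ih =>
      intro v
      set x := ((B - 1) ^ j) v with hx
      set y := ((Y - 1) ^ j) v with hy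
      have e1 : ((B - 1) ^ (j + 1)) v = B x - x := by rw [pow_succ']; rfl
      have e2 : ((Y - 1) ^ (j + 1)) v = Y y - y := by rw [pow_succ']; rfl
      have e3 : B x - x - (Y y - y) = (B x - Y x) + Y (x - y) - (x - y) := by rw [map_sub]; abel
      rw [e1, e2, e3]
      exact W.sub_mem (W.add_mem (hBY x) (hY _ (ih v))) (ih v)
  refine ⟨k + 1, ContinuousLinearMap.ext fun v => ?_⟩
  have h1 : ((B - 1) ^ k) v ∈ W := by
    have := W.add_mem (h k v) (hk v)
    rwa [sub_add_cancel] at this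
  rw [pow_succ']
  change B (((B - 1) ^ k) v) - ((B - 1) ^ k) v = 0
  rw [hB _ h1, sub_self]

/-- A map which is a submersion onto a linear subspace `W`, when restricted to an affine subspace, has
a smooth local section over `W`. -/
theorem exists_local_section {a : X → E} (ha : ContDiff ℝ ∞ a) {p₀ : X} {W : Submodule ℝ E}
    {V : Submodule ℝ X} (h0 : a p₀ ∈ W) (hmap : ∀ᶠ p in 𝓝 p₀, p - p₀ ∈ V → a p ∈ W)
    (hsurj : ∀ w ∈ W, ∃ v ∈ V, fderiv ℝ a p₀ v = w) :
    ∃ γ : E → X, ContDiff ℝ ∞ γ ∧ γ (a p₀) = p₀ ∧ (∀ᶠ y in 𝓝 (a p₀), γ y - p₀ ∈ V) ∧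
      ∀ᶠ y in 𝓝 (a p₀), y ∈ W → a (γ y) = y := by
  set y₀ := a p₀ with hy₀
  obtain ⟨P, Q, hPQ, -, hQ, hP⟩ := exists_projection W
  choose! s hsV hs using hsurj
  let b := Module.finBasis ℝ W
  let ι : W →ₗ[ℝ] V := b.constr ℝ fun i => ⟨s (b i), hsV _ (b i).2⟩
  have hι : ((fderiv ℝ a p₀ : X →ₗ[ℝ] E).comp V.subtype).comp ι = W.subtype := b.ext fun i => by
    change fderiv ℝ a p₀ (ι (b i)) = b i
    rw [b.constr_basis]
    exact hs _ (b i).2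
  have hι' : ∀ w : W, fderiv ℝ a p₀ (ι w) = w := fun w => LinearMap.congr_fun hι w
  -- A linear right inverse, over `W` and with values in `V`, of the derivative at `p₀`; it is
  -- precomposed with the projection to `W` to be defined everywhere.
  let L : E →L[ℝ] X := LinearMap.toContinuousLinearMap
    (V.subtype.comp (ι.comp ((P : E →ₗ[ℝ] E).codRestrict W hP)))
  have hL : ∀ y, fderiv ℝ a p₀ (L y) = P y := fun y => hι' ⟨P y, hP y⟩
  have hLV : ∀ y, L y ∈ V := fun y => (ι ⟨P y, hP y⟩).2
  have hQ0 : Q y₀ = 0 := (hQ _).2 h0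
  -- Adding `Q y` fills in the complementary directions: `g` has derivative `P + Q = 1` at `y₀`, so
  -- the inverse function theorem applies.
  set g : E → E := fun y => a (p₀ + L (y - y₀)) + Q y with hg
  have hin : ContDiff ℝ ∞ (fun y => p₀ + L (y - y₀)) :=
    contDiff_const.add (L.contDiff.comp (contDiff_id.sub contDiff_const))
  have hgs : ContDiff ℝ ∞ g := (ha.comp hin).add Q.contDiff
  have hin0 : p₀ + L (y₀ - y₀) = p₀ := by simp
  have hg0 : g y₀ = y₀ := by rw [hg]; simp only [hin0, hQ0, add_zero, ← hy₀]
  have hgd : fderiv ℝ g y₀ = 1 := by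
    have h1 : HasFDerivAt (fun y => p₀ + L (y - y₀)) L y₀ :=
      (L.hasFDerivAt.comp y₀ ((hasFDerivAt_id y₀).sub_const y₀)).const_add p₀
    have h2 : HasFDerivAt a (fderiv ℝ a p₀) (p₀ + L (y₀ - y₀)) := by
      rw [hin0]; exact (ha.differentiable (by simp) p₀).hasFDerivAt
    have h3 : HasFDerivAt g ((fderiv ℝ a p₀).comp L + Q) y₀ := (h2.comp y₀ h1).add Q.hasFDerivAt
    rw [h3.fderiv]
    ext y
    change fderiv ℝ a p₀ (L y) + Q y = y
    rw [hL, hPQ]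
  obtain ⟨e, he, hye, -, hes⟩ := exists_local_inverse hgs (y₀ := y₀) (by
    rw [hgd]; simp [ContinuousLinearMap.det])
  have hyt : y₀ ∈ e.target := by
    have := e.map_source hye
    rwa [he, hg0] at this
  have hsym : e.symm y₀ = y₀ := by
    have := e.left_inv hye
    rwa [he, hg0] at this
  obtain ⟨k, hk, hke⟩ := exists_contDiff_eventuallyEq e.open_target hyt hes
  have hk0 : k y₀ = y₀ := by rw [hke.eq_of_nhds, hsym]
  have hγ : ContDiff ℝ ∞ (fun y => p₀ + L (k y - y₀)) := hin.comp hk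
  have hγ0 : p₀ + L (k y₀ - y₀) = p₀ := by rw [hk0]; simp
  refine ⟨fun y => p₀ + L (k y - y₀), hγ, hγ0, Eventually.of_forall fun y => by
    simpa using hLV (k y - y₀), ?_⟩
  have htend : Tendsto (fun y => p₀ + L (k y - y₀)) (𝓝 y₀) (𝓝 p₀) := by
    simpa only [hγ0] using hγ.continuous.tendsto y₀
  filter_upwards [htend.eventually hmap, hke, e.open_target.mem_nhds hyt] with y h1 h2 h3 hyW
  have h4 : g (k y) = y := by rw [← he, h2, e.right_inv h3]
  have h5 : a (p₀ + L (k y - y₀)) ∈ W := h1 (by simpa using hLV (k y - y₀))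
  have h6 : Q (k y) = y - a (p₀ + L (k y - y₀)) := by
    rw [eq_sub_iff_add_eq, add_comm]
    exact h4
  -- The correction `Q (k y)` is a difference of two elements of `W`. As `P` also has values in `W`,
  -- this puts `k y` in `W`, so the correction is zero and `γ` is a genuine section.
  have h7 : Q (Q (k y)) = 0 := (hQ _).2 (h6 ▸ W.sub_mem hyW h5)
  have h8 : Q (k y) ∈ W := (hQ _).1 h7
  have h9 : Q (k y) = 0 := by
    have e1 := (hQ (P (k y))).2 (hP (k y))
    have e2 : k y ∈ W := by rw [← hPQ (k y)]; exact W.add_mem (hP _) h8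
    exact (hQ _).2 e2
  rw [h9] at h6
  exact (sub_eq_zero.1 h6.symm).symm

end Sections


/-! ### Tangent spaces and slices in charts -/

section TangentSpaces

variable {n m : ℕ} {N : Type*} [TopologicalSpace N] [ChartedSpace (Eu n) N] [IsManifold (𝓡 n) ∞ N]
  {M : Type*} [TopologicalSpace M] [ChartedSpace (Eu m) M] [IsManifold (𝓡 m) ∞ M]

theorem fderiv_chart_comp {κ : OpenPartialHomeomorph N (Eu n)}
    (hκ : κ ∈ IsManifold.maximalAtlas (𝓡 n) ∞ N) {F : N → M} {G : M → Eu m} {x : N}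
    (hx : x ∈ κ.source) (hG : MDifferentiableAt (𝓡 m) (𝓡 m) G (F x))
    (hF : MDifferentiableAt (𝓡 n) (𝓡 m) F x) (v : Eu n) :
    fderiv ℝ (fun y => G (F (κ.symm y))) (κ x) (mfderiv (𝓡 n) (𝓡 n) κ x v : Eu n) =
      modelDeriv m G (F x) (mfderiv (𝓡 n) (𝓡 m) F x v : Eu m) := by
  have hxx : κ.symm (κ x) = x := κ.left_inv hx
  have h1 : MDifferentiableAt (𝓡 n) (𝓡 m) (fun x => G (F x)) x := hG.comp x hF
  have h2 : MDifferentiableAt (𝓡 n) (𝓡 m) (fun y => G (F (κ.symm y))) (κ x) := by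
    have : MDifferentiableAt (𝓡 n) (𝓡 m) (fun x => G (F x)) (κ.symm (κ x)) := by rwa [hxx]
    exact this.comp (κ x) (mdifferentiableAt_chart_symm hκ (κ.map_source hx))
  have h3 : (fun x => G (F x)) =ᶠ[𝓝 x] (fun y => G (F (κ.symm y))) ∘ κ := by
    filter_upwards [κ.open_source.mem_nhds hx] with w hw
    simp only [Function.comp, κ.left_inv hw]
  have e1 : mfderiv (𝓡 n) (𝓡 m) (fun x => G (F x)) x v =
      modelDeriv m G (F x) (mfderiv (𝓡 n) (𝓡 m) F x v : Eu m) :=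
    congrArg (fun L => L v) (mfderiv_comp x hG hF)
  have e2 : mfderiv (𝓡 n) (𝓡 m) ((fun y => G (F (κ.symm y))) ∘ κ) x v =
      fderiv ℝ (fun y => G (F (κ.symm y))) (κ x) (mfderiv (𝓡 n) (𝓡 n) κ x v : Eu n) := by
    rw [← mfderiv_eq_fderiv]
    exact congrArg (fun L => L v) (mfderiv_comp x h2 (mdifferentiableAt_chart hκ hx))
  rw [← e1, ← e2]
  exact congrArg (fun L : Eu n →L[ℝ] Eu m => L v) h3.mfderiv_eq.symm

/-- The chart `e` flattens `Z` to the linear subspace `W`. -/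
def IsAdapted (e : OpenPartialHomeomorph M (Eu m)) (Z : Set M) (W : Submodule ℝ (Eu m)) : Prop :=
  e ∈ IsManifold.maximalAtlas (𝓡 m) ∞ M ∧ ∀ x ∈ e.source, x ∈ Z ↔ e x ∈ W

/-- The image of a curve in `Z` is a curve in the closed linear subspace `W`, so its velocity stays
there; this passes to the span. -/
theorem modelDeriv_mem_of_mem_tangentOf {Z : Set M} {z : M} {G : M → Eu m}
    {W : Submodule ℝ (Eu m)} (hG : MDifferentiableAt (𝓡 m) (𝓡 m) G z)
    (hW : ∀ᶠ x in 𝓝 z, x ∈ Z → G x ∈ W) {v : Eu m} (hv : v ∈ tangentOf m Z z) :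
    modelDeriv m G z v ∈ W := by
  have hle : tangentOf m Z z ≤ W.comap (modelDeriv m G z : Eu m →ₗ[ℝ] Eu m) := by
    refine Submodule.span_le.2 ?_
    rintro v ⟨γ, rfl, hγ, hγZ, hv⟩
    change modelDeriv m G (γ 0) v ∈ W
    have hγd : MDifferentiableAt 𝓘(ℝ, ℝ) (𝓡 m) γ 0 := hγ.mdifferentiableAt (by simp)
    have h1 : MDifferentiableAt 𝓘(ℝ, ℝ) (𝓡 m) (fun t => G (γ t)) 0 := hG.comp 0 hγd
    have h2 : HasDerivAt (fun t => G (γ t)) (modelDeriv m G (γ 0) v) 0 := by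
      have h3 := h1.differentiableAt.hasDerivAt
      have h4 : deriv (fun t => G (γ t)) 0 = modelDeriv m G (γ 0) v := by
        rw [← fderiv_apply_one_eq_deriv, ← mfderiv_eq_fderiv, ← hv]
        exact congrArg (fun L => L (1 : ℝ)) (mfderiv_comp (0 : ℝ) hG hγd)
      rwa [h4] at h3
    refine hasDerivAt_mem h2 ?_
    filter_upwards [hγ.continuousAt.eventually hW, hγZ] with t h1 h2 using h1 h2
  exact hle hv

/-- For the converse, straight lines in the flattening chart are curves in `Z` realizing each vector
of `W`, so the velocities already form a subspace. -/
theorem IsAdapted.mem_tangentOf_iff {e : OpenPartialHomeomorph M (Eu m)} {Z : Set M}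
    {W : Submodule ℝ (Eu m)} (h : IsAdapted e Z W) {z : M} (hz : z ∈ e.source) (hzZ : z ∈ Z)
    (v : Eu m) : v ∈ tangentOf m Z z ↔ modelDeriv m e z v ∈ W := by
  obtain ⟨he, hW⟩ := h
  have hd := mdifferentiableAt_chart he hz
  refine ⟨modelDeriv_mem_of_mem_tangentOf hd ?_, fun hv => Submodule.subset_span ?_⟩
  · filter_upwards [e.open_source.mem_nhds hz] with x hx using (hW x hx).1
  · set w := modelDeriv m e z v with hw
    have hline : ContDiff ℝ ∞ (fun t : ℝ => e z + t • w) := by fun_prop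
    have h0 : e z + (0 : ℝ) • w = e z := by simp
    have hsm : ContMDiffAt (𝓡 m) (𝓡 m) ∞ e.symm (e z + (0 : ℝ) • w) := by
      rw [h0]; exact contMDiffAt_symm_of_mem_maximalAtlas he (e.map_source hz)
    have hev : ∀ᶠ t : ℝ in 𝓝 0, e z + t • w ∈ e.target :=
      hline.continuous.continuousAt.preimage_mem_nhds (e.open_target.mem_nhds (by
        rw [h0]; exact e.map_source hz))
    refine ⟨fun t => e.symm (e z + t • w), by
      change e.symm (e z + (0 : ℝ) • w) = z
      rw [h0, e.left_inv hz], hsm.comp 0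
      hline.contMDiff.contMDiffAt, ?_, ?_⟩
    · filter_upwards [hev] with t ht
      rw [hW _ (e.map_target ht), e.right_inv ht]
      exact W.add_mem ((hW z hz).1 hzZ) (W.smul_mem t hv)
    · have hl : HasFDerivAt (fun t : ℝ => e z + t • w) (ContinuousLinearMap.toSpanSingleton ℝ w) 0 := by
        have : HasDerivAt (fun t : ℝ => e z + t • w) w 0 := by
          simpa using ((hasDerivAt_id (0 : ℝ)).smul_const w).const_add (e z)
        exact this.hasFDerivAt
      have h1 : mfderiv 𝓘(ℝ, ℝ) (𝓡 m) (fun t : ℝ => e.symm (e z + t • w)) 0 (1 : ℝ) =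
          modelDeriv m e.symm (e z + (0 : ℝ) • w) w := by
        have h2 := mfderiv_comp (0 : ℝ) (hsm.mdifferentiableAt (by simp))
          hl.differentiableAt.mdifferentiableAt
        have h3 : mfderiv 𝓘(ℝ, ℝ) (𝓡 m) (fun t : ℝ => e z + t • w) 0 (1 : ℝ) = w := by
          rw [mfderiv_eq_fderiv, hl.fderiv]
          exact one_smul ℝ w
        refine (congrArg (fun L => L (1 : ℝ)) h2).trans ?_
        exact congrArg (modelDeriv m e.symm (e z + (0 : ℝ) • w)) h3
      refine h1.trans ?_
      rw [h0, hw]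
      have h4 : (modelDeriv m e.symm (e z)).comp (modelDeriv m e z) = 1 := by
        rw [← modelDeriv_comp (mdifferentiableAt_chart_symm he (e.map_source hz)) hd,
          ← modelDeriv_id (m := m) z]
        refine modelDeriv_congr ?_
        filter_upwards [e.open_source.mem_nhds hz] with x hx using e.left_inv hx
      exact congrArg (fun L : Eu m →L[ℝ] Eu m => L v) h4

end TangentSpaces

/-! ### Conjugation of unipotent normal isotropy -/

section Unipotent

variable {m : ℕ} {H : Type*} [Group H] [TopologicalSpace H]
  {M : Type*} [TopologicalSpace M] [ChartedSpace (Eu m) M] [IsManifold (𝓡 m) ∞ M]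
  [MulAction H M]

theorem mapQ_sub_one_pow {V : Type*} [AddCommGroup V] [Module ℝ V] (p : Submodule ℝ V)
    (f : V →ₗ[ℝ] V) (hf : p ≤ p.comap f) (j : ℕ) (v : V) :
    ((p.mapQ p f hf - 1) ^ j) (p.mkQ v) = p.mkQ (((f - 1) ^ j) v) := by
  induction j with
  | zero => rfl
  | succ j ih =>
    rw [pow_succ', pow_succ', Module.End.mul_apply, ih]
    simp

theorem sub_one_pow_intertwine {V E : Type*} [AddCommGroup V] [Module ℝ V] [NormedAddCommGroup E]
    [NormedSpace ℝ E] {Y : E →L[ℝ] E} {N : V →ₗ[ℝ] E} (I : V →ₗ[ℝ] V)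
    (h : ∀ v, Y (N v) = N (I v)) (j : ℕ) (v : V) :
    ((Y - 1) ^ j) (N v) = N (((I - 1) ^ j) v) := by
  induction j with
  | zero => rfl
  | succ j ih =>
    have e1 : ((Y - 1) ^ (j + 1)) (N v) = Y (((Y - 1) ^ j) (N v)) - ((Y - 1) ^ j) (N v) := by
      rw [pow_succ']; rfl
    have e2 : ((I - 1) ^ (j + 1)) v = I (((I - 1) ^ j) v) - ((I - 1) ^ j) v := by
      rw [pow_succ']; rfl
    rw [e1, e2, ih, h, map_sub]

/-- The conjugate by `h` of an element which acts unipotently on the normal space at `s` acts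
unipotently on the normal space at `h s`. -/
theorem IsAdapted.unipotent_conj (d : ℕ) [ChartedSpace (Eu d) H]
    [ContMDiffSMul (𝓡 d) (𝓡 m) ∞ H M] {e : OpenPartialHomeomorph M (Eu m)} {Z : Set M}
    {W : Submodule ℝ (Eu m)} (he : IsAdapted e Z W) (hZ : IsStable H Z) {h k : H} {s : M}
    (hs : h • s ∈ e.source) (hsZ : s ∈ Z) (hk : k • s = s)
    (hT : tangentOf m Z s ≤ (tangentOf m Z s).comap (isotropy m k s hk))
    (hn : IsNilpotent ((tangentOf m Z s).mapQ (tangentOf m Z s) (isotropy m k s hk) hT - 1)) :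
    (∀ v ∈ W, fderiv ℝ (fun y => e ((h * k * h⁻¹) • e.symm y)) (e (h • s)) v ∈ W) ∧
    ∃ j : ℕ, ∀ v, ((fderiv ℝ (fun y => e ((h * k * h⁻¹) • e.symm y)) (e (h • s)) - 1) ^ j) v ∈ W := by
  have : ContinuousSMul H M := ContMDiffSMul.continuousSMul (I := 𝓡 d) (I' := 𝓡 m) ∞
  have hsm : ∀ (k : H) (x : M), MDifferentiableAt (𝓡 m) (𝓡 m) (fun x : M => k • x) x :=
    mdifferentiableAt_smul m d
  set g := h * k * h⁻¹ with hg
  have hgh : ∀ x : M, g • h • x = h • k • x := fun x => by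
    rw [hg, ← mul_smul, ← mul_smul, inv_mul_cancel_right]
  have hgs : g • h • s = h • s := by rw [hgh, hk]
  set w := e (h • s) with hw
  have hwt : w ∈ e.target := e.map_source hs
  have hws : e.symm w = h • s := e.left_inv hs
  have hgw : g • e.symm w = h • s := by rw [hws, hgs]
  set Φ : Eu m → Eu m := fun y => e (g • e.symm y) with hΦ
  have hΦd : MDifferentiableAt (𝓡 m) (𝓡 m) Φ w :=
    (mdifferentiableAt_chart he.1 (by rw [hgw]; exact hs)).comp w
      ((hsm g _).comp w (mdifferentiableAt_chart_symm he.1 hwt))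
  -- Because `g h = h k`, this map intertwines `k` near `s` with `g` read in the chart near `h s`;
  -- its differential conjugates the two isotropy actions.
  set E : M → Eu m := fun x => e (h • x) with hE
  have hEd : MDifferentiableAt (𝓡 m) (𝓡 m) E s := (mdifferentiableAt_chart he.1 hs).comp s (hsm h s)
  have hnear : ∀ᶠ x in 𝓝 s, h • x ∈ e.source :=
    (continuous_const_smul h).continuousAt.preimage_mem_nhds (e.open_source.mem_nhds hs)
  have hYN : ∀ v, fderiv ℝ Φ w (modelDeriv m E s v) =
      modelDeriv m E s (modelDeriv m (fun x : M => k • x) s v) := by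
    intro v
    have hEd' : MDifferentiableAt (𝓡 m) (𝓡 m) E (k • s) := by rwa [hk]
    have e1 := modelDeriv_comp (f := E) (g := Φ) (y := s) hΦd hEd
    have e2 := modelDeriv_comp (f := fun x : M => k • x) (g := E) hEd' (hsm k s)
    have e3 : modelDeriv m (Φ ∘ E) s = modelDeriv m (E ∘ fun x : M => k • x) s := by
      refine modelDeriv_congr ?_
      filter_upwards [hnear] with x hx
      simp only [Function.comp, hΦ, hE, e.left_inv hx, hgh]
    rw [e1, e2, hk] at e3
    have := congrArg (fun L : Eu m →L[ℝ] Eu m => L v) e3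
    rw [← modelDeriv_eq_fderiv]
    exact this
  -- Surjectivity of the intertwiner is what allows powers to be computed on the side of `s`, where
  -- the hypothesis lives.
  have hNs : ∀ v, ∃ v', modelDeriv m E s v' = v := by
    intro v
    have h1 : h⁻¹ • e.symm w = s := by rw [hws, inv_smul_smul]
    have hd : MDifferentiableAt (𝓡 m) (𝓡 m) (fun y => h⁻¹ • e.symm y) w :=
      (hsm h⁻¹ _).comp w (mdifferentiableAt_chart_symm he.1 hwt)
    have e1 := modelDeriv_comp (f := fun y => h⁻¹ • e.symm y) (g := E) (y := w) (by rwa [h1]) hd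
    have e2 : modelDeriv m (E ∘ fun y => h⁻¹ • e.symm y) w = 1 := by
      rw [← modelDeriv_id (m := m) w]
      refine modelDeriv_congr ?_
      filter_upwards [e.open_target.mem_nhds hwt] with y hy
      simp only [Function.comp, hE, smul_inv_smul, e.right_inv hy, id]
    rw [e1, h1] at e2
    exact ⟨_, congrArg (fun L : Eu m →L[ℝ] Eu m => L v) e2⟩
  refine ⟨fun v hv => fderiv_mem (V := W) hΦd.differentiableAt ?_ hv, ?_⟩
  · have hwW : w ∈ W := (he.2 _ hs).1 (hZ h s hsZ)
    have hc : ContinuousAt (fun y => g • e.symm y) w :=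
      (e.continuousAt_symm hwt).const_smul g
    filter_upwards [e.open_target.mem_nhds hwt, hc.preimage_mem_nhds (e.open_source.mem_nhds
      (by rw [hgw]; exact hs))] with y hy hgy hyW
    have hyW' : y ∈ W := by simpa using W.add_mem hyW hwW
    exact (he.2 _ hgy).1 (hZ g _ ((he.2 _ (e.map_target hy)).2 (by rwa [e.right_inv hy])))
  · obtain ⟨j, hj⟩ := hn
    let N : TangentSpace (𝓡 m) s →ₗ[ℝ] Eu m := (mfderiv (𝓡 m) (𝓡 m) E s).toLinearMap
    have hint := sub_one_pow_intertwine (Y := fderiv ℝ Φ w) (N := N) (isotropy m k s hk) hYN j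
    refine ⟨j, fun v => ?_⟩
    obtain ⟨v', rfl⟩ := hNs v
    refine (congrArg (· ∈ W) (hint v')).mpr ?_
    refine modelDeriv_mem_of_mem_tangentOf (Z := Z) hEd ?_ ?_
    · filter_upwards [hnear] with x hx hxZ
      exact (he.2 _ hx).1 (hZ h x hxZ)
    · have h1 := mapQ_sub_one_pow (tangentOf m Z s) (isotropy m k s hk) hT j v'
      rw [hj] at h1
      exact (Submodule.Quotient.mk_eq_zero _).1 h1.symm

end Unipotent


/-! ### Vanishing near unipotently incompatible submanifolds -/

section Slices

theorem fderiv_prod_apply {X Y E : Type} [NormedAddCommGroup X] [NormedSpace ℝ X]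
    [NormedAddCommGroup Y] [NormedSpace ℝ Y] [NormedAddCommGroup E] [NormedSpace ℝ E]
    {a : X × Y → E} {p : X × Y} (ha : DifferentiableAt ℝ a p) (v : X) (w : Y) :
    fderiv ℝ a p (v, w) = fderiv ℝ (fun x => a (x, p.2)) p.1 v + fderiv ℝ (fun y => a (p.1, y)) p.2 w := by
  have h1 : HasFDerivAt (fun x => a (x, p.2)) ((fderiv ℝ a p).comp (.inl ℝ X Y)) p.1 :=
    ha.hasFDerivAt.comp p.1 (hasFDerivAt_prodMk_left p.1 p.2)
  have h2 : HasFDerivAt (fun y => a (p.1, y)) ((fderiv ℝ a p).comp (.inr ℝ X Y)) p.2 :=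
    ha.hasFDerivAt.comp p.2 (hasFDerivAt_prodMk_right p.1 p.2)
  rw [h1.fderiv, h2.fderiv]
  simp [← map_add]

theorem exists_add_eq_of_mem_range_sup_map {V₁ V₂ V₃ : Type*} [AddCommGroup V₁] [Module ℝ V₁]
    [AddCommGroup V₂] [Module ℝ V₂] [AddCommGroup V₃] [Module ℝ V₃] (f : V₁ →ₗ[ℝ] V₃)
    (g : V₂ →ₗ[ℝ] V₃) (p : Submodule ℝ V₂) (v : V₃) (hv : v ∈ LinearMap.range f ⊔ p.map g) :
    ∃ x, ∃ t ∈ p, f x + g t = v := by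
  obtain ⟨-, ⟨x, rfl⟩, -, ⟨t, ht, rfl⟩, h⟩ := Submodule.mem_sup.1 hv
  exact ⟨x, t, ht, h⟩

variable {d m : ℕ} {H : Type*} [Group H] [TopologicalSpace H] [ChartedSpace (Eu d) H]
  {M : Type*} [TopologicalSpace M] [ChartedSpace (Eu m) M] [IsManifold (𝓡 m) ∞ M]
  [MulAction H M] [ContMDiffSMul (𝓡 d) (𝓡 m) ∞ H M]

theorem modelDeriv_chart_comp_symm {e : OpenPartialHomeomorph M (Eu m)}
    (he : e ∈ IsManifold.maximalAtlas (𝓡 m) ∞ M) {z : M} (hz : z ∈ e.source) (w : Eu m) :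
    modelDeriv m e z (modelDeriv m e.symm (e z) w) = w := by
  have hd := mdifferentiableAt_chart he hz
  have hz' : e.symm (e z) = z := e.left_inv hz
  have h1 := modelDeriv_comp (f := e.symm) (g := e) (y := e z) (by rwa [hz'])
    (mdifferentiableAt_chart_symm he (e.map_source hz))
  have h2 : modelDeriv m (e ∘ e.symm) (e z) = 1 := by
    rw [← modelDeriv_id (m := m) (e z)]
    refine modelDeriv_congr ?_
    filter_upwards [e.open_target.mem_nhds (e.map_source hz)] with y hy using e.right_inv hy
  rw [h1, hz'] at h2
  exact congrArg (fun L : Eu m →L[ℝ] Eu m => L w) h2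

/-- Near a point of a local slice, the points of `Z` are smoothly written as translates of points of
the slice. -/
theorem exists_slice_section [IsManifold (𝓡 d) ∞ H] {e : OpenPartialHomeomorph M (Eu m)} {Z S : Set M}
    {W : Submodule ℝ (Eu m)} (he : IsAdapted e Z W) (hZ : IsStable H Z) {z₀ : M} (hz : z₀ ∈ e.source)
    (hzS : z₀ ∈ S) (hS : IsLocalSlice d m H Z S) :
    ∃ (O : Set (Eu m)) (h : Eu m → H) (s : Eu m → M), IsOpen O ∧ e z₀ ∈ O ∧ O ⊆ e.target ∧
      ContMDiffOn (𝓡 m) (𝓡 d) ∞ h O ∧ ContMDiffOn (𝓡 m) (𝓡 m) ∞ s O ∧ MapsTo s O S ∧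
      h (e z₀) = 1 ∧ s (e z₀) = z₀ ∧ ∀ y ∈ O, y ∈ W → h y • s y = e.symm y := by
  have : ContinuousSMul H M := ContMDiffSMul.continuousSMul (I := 𝓡 d) (I' := 𝓡 m) ∞
  obtain ⟨hSZ, hSm, hsub⟩ := hS
  obtain ⟨eS, heS, hzeS, WS, hWS⟩ := hSm z₀ hzS
  have heSA : IsAdapted eS S WS := ⟨heS, hWS⟩
  set κ := chartAt (Eu d) (1 : H) with hκdef
  have hκ : κ ∈ IsManifold.maximalAtlas (𝓡 d) ∞ H := IsManifold.chart_mem_maximalAtlas _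
  have h1κ : (1 : H) ∈ κ.source := mem_chart_source _ _
  have hκ1 : κ.symm (κ 1) = 1 := κ.left_inv h1κ
  have hS0 : eS.symm (eS z₀) = z₀ := eS.left_inv hzeS
  set p₀ : Eu d × Eu m := (κ 1, eS z₀) with hp₀
  set a₀ : Eu d × Eu m → Eu m := fun p => e (κ.symm p.1 • eS.symm p.2) with ha₀
  have hO := isOpen_chart_smul κ eS e
  set Oa : Set (Eu d × Eu m) := {p | (p.1 ∈ κ.target ∧ p.2 ∈ eS.target) ∧
      κ.symm p.1 • eS.symm p.2 ∈ e.source} with hOa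
  have hpO : p₀ ∈ Oa := ⟨⟨κ.map_source h1κ, eS.map_source hzeS⟩, by
    simpa only [hp₀, hκ1, hS0, one_smul] using hz⟩
  obtain ⟨a, ha, haa⟩ := exists_contDiff_eventuallyEq hO hpO
    (contDiffOn_chart_smul hκ heS he.1 fun p hp => ⟨hp.1.1, hp.1.2, hp.2⟩)
  have hap : a p₀ = e z₀ := by
    rw [haa.eq_of_nhds]
    change e (κ.symm (κ 1) • eS.symm (eS z₀)) = e z₀
    rw [hκ1, hS0, one_smul]
  -- All directions in the group, but only tangent directions of the slice: the action map is a
  -- submersion onto `Z` only from this subspace.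
  let V : Submodule ℝ (Eu d × Eu m) := (⊤ : Submodule ℝ (Eu d)).prod WS
  have hgood : ∀ᶠ p in 𝓝 p₀, a p = a₀ p ∧ p ∈ Oa := haa.and (hO.mem_nhds hpO)
  have hV : ∀ p : Eu d × Eu m, p - p₀ ∈ V → p.2 ∈ WS := by
    intro p hp
    have h1 : p.2 - eS z₀ ∈ WS := hp.2
    simpa using WS.add_mem h1 ((hWS _ hzeS).1 hzS)
  obtain ⟨γ, hγ, hγ0, hγV, hγa⟩ := exists_local_section ha (p₀ := p₀) (W := W) (V := V)
    (by rw [hap]; exact (he.2 _ hz).1 (hSZ hzS))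
    (by
      filter_upwards [hgood] with p ⟨h1, ⟨h2, h3⟩, h4⟩ hpV
      rw [h1]
      refine (he.2 _ h4).1 (hZ _ _ (hSZ ?_))
      rw [hWS _ (eS.map_target h3), eS.right_inv h3]
      exact hV p hpV)
    (by
      intro w hw
      have hz1 : (1 : H) • z₀ = z₀ := one_smul H z₀
      have hz1s : (1 : H) • z₀ ∈ e.source := by rwa [hz1]
      set v := modelDeriv m e.symm (e z₀) w with hv
      have hvw : modelDeriv m e ((1 : H) • z₀) v = w := by
        rw [hz1]; exact modelDeriv_chart_comp_symm he.1 hz w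
      have hvT : v ∈ tangentOf m Z ((1 : H) • z₀) :=
        (he.mem_tangentOf_iff hz1s (hZ 1 _ (hSZ hzS)) v).2 (by rw [hvw]; exact hw)
      -- The slice condition is used only at the identity and at `z₀`; nearby points are handled by
      -- the local section.
      rw [← hsub 1 z₀ hzS] at hvT
      obtain ⟨x, t, ht, hxt⟩ := exists_add_eq_of_mem_range_sup_map (orbitDeriv d m 1 z₀)
        (actionDeriv m 1 z₀) _ _ hvT
      refine ⟨(mfderiv (𝓡 d) (𝓡 d) κ (1 : H) x, modelDeriv m eS z₀ t),
        ⟨trivial, (heSA.mem_tangentOf_iff hzeS hzS t).1 ht⟩, ?_⟩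
      have hed := mdifferentiableAt_chart he.1 hz1s
      have horb : MDifferentiableAt (𝓡 d) (𝓡 m) (fun k : H => k • z₀) (1 : H) :=
        ((contMDiff_id (I := 𝓡 d) (n := ∞)).smul (contMDiff_const (c := z₀) (I' := 𝓡 m))
          ).contMDiffAt.mdifferentiableAt (by simp)
      have e1 := fderiv_chart_comp hκ h1κ (F := fun k : H => k • z₀) hed horb x
      have e2 := fderiv_chart_comp heS hzeS (F := fun x : M => (1 : H) • x) hed
        (mdifferentiableAt_smul m d 1 z₀) t
      have e3 : fderiv ℝ a p₀ = fderiv ℝ a₀ p₀ := haa.fderiv_eq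
      have e4 : DifferentiableAt ℝ a₀ p₀ :=
        (ha.differentiable (by simp) p₀).congr_of_eventuallyEq haa.symm
      refine (congrArg (fun L : Eu d × Eu m →L[ℝ] Eu m => L _) e3).trans ?_
      refine (fderiv_prod_apply e4 _ _).trans ?_
      simp only [ha₀, hp₀, hκ1, hS0]
      refine (congrArg₂ (· + ·) e1 e2).trans ?_
      have e5 : ∀ p q : Eu m, modelDeriv m e ((1 : H) • z₀) p + modelDeriv m e ((1 : H) • z₀) q =
        modelDeriv m e ((1 : H) • z₀) (p + q) := fun p q => (map_add _ p q).symm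
      refine (e5 _ _).trans (Eq.trans ?_ hvw)
      exact congrArg (modelDeriv m e ((1 : H) • z₀)) hxt)
  rw [hap] at hγ0 hγV hγa
  have htend : Tendsto γ (𝓝 (e z₀)) (𝓝 p₀) := by
    simpa only [hγ0] using hγ.continuous.tendsto (e z₀)
  obtain ⟨O, hOsub, hOo, hzO⟩ := mem_nhds_iff.1 (((htend.eventually hgood).and (hγV.and hγa)).and
    (e.open_target.mem_nhds (e.map_source hz)))
  refine ⟨O, fun y => κ.symm (γ y).1, fun y => eS.symm (γ y).2, hOo, hzO, fun y hy => (hOsub hy).2,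
    ?_, ?_, ?_, ?_, ?_, ?_⟩
  · intro y hy
    refine ContMDiffAt.contMDiffWithinAt ?_
    exact (contMDiffAt_symm_of_mem_maximalAtlas hκ (hOsub hy).1.1.2.1.1).comp y
      (contDiff_fst.comp hγ).contMDiff.contMDiffAt
  · intro y hy
    refine ContMDiffAt.contMDiffWithinAt ?_
    exact (contMDiffAt_symm_of_mem_maximalAtlas heS (hOsub hy).1.1.2.1.2).comp y
      (contDiff_snd.comp hγ).contMDiff.contMDiffAt
  · intro y hy
    have h3 := (hOsub hy).1.1.2.1.2
    change eS.symm (γ y).2 ∈ S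
    rw [hWS _ (eS.map_target h3), eS.right_inv h3]
    exact hV _ (hOsub hy).1.2.1
  · simp only [hγ0, hp₀, hκ1]
  · simp only [hγ0, hp₀, hS0]
  · intro y hy hyW
    have h1 := (hOsub hy).1.2.2 hyW
    rw [(hOsub hy).1.1.1] at h1
    calc κ.symm (γ y).1 • eS.symm (γ y).2 = e.symm (a₀ (γ y)) :=
          (e.left_inv (hOsub hy).1.1.2.2).symm
      _ = e.symm y := by rw [h1]

end Slices

/-- The action of `g⁻¹` read in the same chart is a local inverse at the fixed point, so the
derivative is injective. -/
theorem det_chart_smul_ne_zero (d : ℕ) {m : ℕ} {H : Type*} [Group H] [TopologicalSpace H]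
    [ChartedSpace (Eu d) H] {M : Type*} [TopologicalSpace M] [ChartedSpace (Eu m) M]
    [IsManifold (𝓡 m) ∞ M] [MulAction H M] [ContMDiffSMul (𝓡 d) (𝓡 m) ∞ H M]
    {e : OpenPartialHomeomorph M (Eu m)}
    (he : e ∈ IsManifold.maximalAtlas (𝓡 m) ∞ M) (g : H) {y : Eu m} (hy : y ∈ e.target)
    (hg : g • e.symm y = e.symm y) : (fderiv ℝ (fun y => e (g • e.symm y)) y).det ≠ 0 := by
  have : ContinuousSMul H M := ContMDiffSMul.continuousSMul (I := 𝓡 d) (I' := 𝓡 m) ∞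
  have hd : ∀ k : H, k • e.symm y = e.symm y →
      MDifferentiableAt (𝓡 m) (𝓡 m) (fun y => e (k • e.symm y)) y := fun k hk =>
    (mdifferentiableAt_chart he (by rw [hk]; exact e.map_target hy)).comp y
      ((mdifferentiableAt_smul m d k _).comp y (mdifferentiableAt_chart_symm he hy))
  have hy' : e (g • e.symm y) = y := by rw [hg, e.right_inv hy]
  have h1 := modelDeriv_comp (f := fun y => e (g • e.symm y)) (g := fun y => e (g⁻¹ • e.symm y))
    (y := y) (by rw [hy']; exact hd _ (by rw [inv_smul_eq_iff, hg])) (hd g hg)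
  have h2 : modelDeriv m ((fun y => e (g⁻¹ • e.symm y)) ∘ fun y => e (g • e.symm y)) y = 1 := by
    rw [← modelDeriv_id (m := m) y]
    refine modelDeriv_congr ?_
    have hc : ContinuousAt (fun y => g • e.symm y) y := (e.continuousAt_symm hy).const_smul g
    filter_upwards [e.open_target.mem_nhds hy, hc.preimage_mem_nhds (e.open_source.mem_nhds
      (by rw [hg]; exact e.map_target hy))] with w hw hgw
    simp only [Function.comp, e.left_inv hgw, inv_smul_smul, e.right_inv hw, id]
  rw [h1, modelDeriv_eq_fderiv _ y] at h2
  refine det_ne_zero_iff_injective.2 fun v hv => ?_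
  have h3 := congrArg (fun L : Eu m →L[ℝ] Eu m => L v) h2
  have h4 : v = modelDeriv m (fun y => e (g⁻¹ • e.symm y)) (e (g • e.symm y))
    (fderiv ℝ (fun y => e (g • e.symm y)) y v) := h3.symm
  rw [h4, hv, map_zero]

/-! ### Vanishing for unipotently incompatible submanifolds -/

section PartOne

variable {d m : ℕ} {H : Type*} [Group H] [TopologicalSpace H] [ChartedSpace (Eu d) H]
  [LieGroup (𝓡 d) ∞ H]
  {M : Type*} [TopologicalSpace M] [T2Space M] [ChartedSpace (Eu m) M] [IsManifold (𝓡 m) ∞ M]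
  [MulAction H M] [ContMDiffSMul (𝓡 d) (𝓡 m) ∞ H M]

/-- Conjugating `φ` along the slice section gives group elements fixing each nearby point of `Z`,
extended smoothly off `Z`. The resulting map of the chart satisfies `UnipotentInvariance`, which
forces `f` to vanish near the point. -/
theorem UnipotentlyIncompatible.eq_zero_near {χ : H →* ℂˣ} {Z : Set M} (hZ : IsStable H Z)
    (hUI : UnipotentlyIncompatible d m χ Z) {U : Opens M} {u : Module.Dual ℂ (testDensity m U)}
    (hu : u ∈ equivariantSupported m χ U Z) {e : OpenPartialHomeomorph M (Eu m)}
    {W : Submodule ℝ (Eu m)} (he : IsAdapted e Z W) {z₀ : M} (hz : z₀ ∈ e.source) (hzZ : z₀ ∈ Z)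
    (hzU : z₀ ∈ U) {f : (Eu m → ℂ) →ₗ[ℂ] ℂ} (hf : IsChartFunctional e u f) :
    ∃ r > 0, ∀ ψ : Eu m → ℂ, ContDiff ℝ ∞ ψ → tsupport ψ ⊆ Metric.ball (e z₀) r → f ψ = 0 := by
  have : ContinuousSMul H M := ContMDiffSMul.continuousSMul (I := 𝓡 d) (I' := 𝓡 m) ∞
  obtain ⟨hug, hus, hue⟩ := hu
  obtain ⟨S, hzS, hS, φ, hφ, hφS⟩ := hUI z₀ hzZ
  obtain ⟨O, h, s, hO, hzO, hOt, hh, hs, hsS, h1, hs1, hhs⟩ := exists_slice_section he hZ hz hzS hS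
  obtain ⟨P, Q, hPQ, hPP, hQW, -⟩ := exists_projection W
  set y₀ := e z₀ with hy₀
  have hy₀W : y₀ ∈ W := (he.2 _ hz).1 hzZ
  have hy₀t : y₀ ∈ e.target := e.map_source hz
  have hsy₀ : e.symm y₀ = z₀ := e.left_inv hz
  -- the family of group elements
  set τ : Eu m → H := fun y => h y * φ (s y) * (h y)⁻¹ with hτ
  have hτs : ContMDiffOn (𝓡 m) (𝓡 d) ∞ τ O := (hh.mul (hφ.comp hs hsS)).mul hh.inv
  have hτ0 : τ y₀ = φ z₀ := by simp only [hτ, h1, hs1, one_mul, inv_one, mul_one]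
  -- Only points of `Z` are fixed: off `W` the product `h y • s y` need not be the point `e.symm y`.
  have hτfix : ∀ y ∈ O, y ∈ W → τ y • e.symm y = e.symm y := by
    intro y hy hyW
    obtain ⟨⟨hk, -⟩, -⟩ := hφS (s y) (hsS hy)
    rw [← hhs y hy hyW, hτ]
    simp only [mul_smul, inv_smul_smul, hk]
  set κ := chartAt (Eu d) (φ z₀) with hκdef
  have hκ : κ ∈ IsManifold.maximalAtlas (𝓡 d) ∞ H := IsManifold.chart_mem_maximalAtlas _
  have hκ0 : φ z₀ ∈ κ.source := mem_chart_source _ _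
  set b₀ := κ (φ z₀) with hb₀
  have hb₀t : b₀ ∈ κ.target := κ.map_source hκ0
  have hκb₀ : κ.symm b₀ = φ z₀ := κ.left_inv hκ0
  have hO₁ : IsOpen (O ∩ τ ⁻¹' κ.source) := hτs.continuousOn.isOpen_inter_preimage hO κ.open_source
  have hzO₁ : y₀ ∈ O ∩ τ ⁻¹' κ.source := ⟨hzO, by rw [mem_preimage, hτ0]; exact hκ0⟩
  obtain ⟨β, hβ, hββ⟩ := exists_contDiff_eventuallyEq (g := fun y => κ (τ y)) hO₁ hzO₁ (by
    refine contMDiffOn_iff_contDiffOn.1 fun y hy => ContMDiffAt.contMDiffWithinAt ?_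
    exact (contMDiffAt_of_mem_maximalAtlas hκ hy.2).comp y (hτs.contMDiffAt (hO.mem_nhds hy.1)))
  have hβ0 : β y₀ = b₀ := by rw [hββ.eq_of_nhds, hτ0]
  -- the action in charts
  have hOA := isOpen_chart_smul κ e e
  have hfix0 : κ.symm b₀ • e.symm y₀ = e.symm y₀ := by rw [hκb₀, ← hτ0, hτfix y₀ hzO hy₀W]
  obtain ⟨A, hA, hAA⟩ := exists_contDiff_eventuallyEq hOA (x := (b₀, y₀))
    ⟨⟨hb₀t, hy₀t⟩, by
      change κ.symm b₀ • e.symm y₀ ∈ e.source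
      rw [hfix0]; exact e.map_target hy₀t⟩
    (contDiffOn_chart_smul hκ he.1 he.1 fun p hp => ⟨hp.1.1, hp.1.2, hp.2⟩)
  have hA0 : A (b₀, y₀) = y₀ := by
    rw [hAA.eq_of_nhds]
    change e (κ.symm b₀ • e.symm y₀) = y₀
    rw [hfix0, e.right_inv hy₀t]
  obtain ⟨R, hR, hRU, hfo⟩ := hf.finiteOrderOn he.1 hug hy₀t (by rw [hsy₀]; exact hzU)
  have hle := hf.locallyEquivariant he.1 hue hb₀t hy₀t (by rw [hsy₀]; exact hzU) hfix0
    hA.continuous hAA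
  have hcA : Continuous (fun y => (b₀, y) : Eu m → Eu d × Eu m) := by fun_prop
  have hdet : (fderiv ℝ (fun y => A (b₀, y)) y₀).det ≠ 0 := by
    have hev : (fun y => A (b₀, y)) =ᶠ[𝓝 y₀] fun y => e (κ.symm b₀ • e.symm y) :=
      (hcA.tendsto y₀).eventually hAA
    rw [hev.fderiv_eq]
    exact det_chart_smul_ne_zero d he.1 _ hy₀t hfix0
  -- If `f` vanishes near `y₀` there is nothing to prove; otherwise its nonvanishing at arbitrarily
  -- small scales makes `χ` smooth near `b₀`.
  by_cases hne : ∀ r > 0, ∃ ψ : Eu m → ℂ, ContDiff ℝ ∞ ψ ∧ tsupport ψ ⊆ Metric.ball y₀ r ∧ f ψ ≠ 0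
  swap
  · push Not at hne
    exact hne
  obtain ⟨χ', hχ', hχχ⟩ := hle.exists_contDiff hA hA0 hdet hR hfo hne
  have hle' : LocallyEquivariant f A χ' b₀ y₀ := by
    obtain ⟨r, hr, hle⟩ := hle
    obtain ⟨r', hr', hb⟩ := Metric.eventually_nhds_iff_ball.1 hχχ
    refine ⟨min r r', lt_min hr hr', fun b hbm ψ θ hψ hθ hψs hp => ?_⟩
    rw [hb b (Metric.ball_subset_ball (min_le_right _ _) hbm)]
    exact hle b (Metric.ball_subset_ball (min_le_left _ _) hbm) ψ θ hψ hθ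
      (hψs.trans (Metric.ball_subset_ball (min_le_left _ _))) hp
  -- the unipotent transformation
  have hβc : Continuous (fun y => (β y, y)) := hβ.continuous.prodMk continuous_id
  have hgood : ∀ᶠ y in 𝓝 y₀, (y ∈ O ∩ τ ⁻¹' κ.source ∧ β y = κ (τ y)) ∧
      ∀ᶠ p in 𝓝 (β y, y), A p = e (κ.symm p.1 • e.symm p.2) := by
    refine (Filter.Eventually.and (hO₁.mem_nhds hzO₁) hββ).and ?_
    have hβt : Tendsto (fun y => (β y, y)) (𝓝 y₀) (𝓝 (b₀, y₀)) := by
      simpa only [hβ0] using hβc.tendsto y₀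
    exact hβt.eventually hAA.eventually_nhds
  set T : Eu m → Eu m := fun y => A (β y, y) with hT
  have hTs : ContDiff ℝ ∞ T := hA.comp (hβ.prodMk contDiff_id)
  have hfixes : ∀ᶠ y in 𝓝 y₀, Q y = 0 → T y = y := by
    filter_upwards [hgood] with y ⟨⟨hy, hb⟩, hAy⟩ hQy
    have hyW := (hQW y).1 hQy
    rw [hT]
    simp only
    rw [hAy.self_of_nhds]
    simp only
    rw [hb, κ.left_inv hy.2, hτfix y hy.1 hyW, e.right_inv (hOt hy.1)]
  have hunip : ∀ᶠ y in 𝓝 y₀, Q y = 0 → IsNilpotent (fderiv ℝ T y - 1) := by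
    filter_upwards [hgood, hfixes.eventually_nhds] with w ⟨⟨hw, hb⟩, hAw⟩ hfw hQw
    have hwW := (hQW w).1 hQw
    have hwt := hOt hw.1
    have hκb : κ.symm (β w) = τ w := by rw [hb, κ.left_inv hw.2]
    have hsym := hhs w hw.1 hwW
    obtain ⟨⟨hk, hTan, hnil⟩, -⟩ := hφS (s w) (hsS hw.1)
    have hewt : e (h w • s w) = w := by rw [hsym, e.right_inv hwt]
    obtain ⟨hYW, j, hj⟩ := he.unipotent_conj d hZ (h := h w) (k := φ (s w)) (s := s w)
      (by rw [hsym]; exact e.map_target hwt) (hS.1 (hsS hw.1)) hk hTan hnil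
    rw [hewt] at hYW hj
    change ∀ v ∈ W, fderiv ℝ (fun y => e (τ w • e.symm y)) w v ∈ W at hYW
    change ∀ v, ((fderiv ℝ (fun y => e (τ w • e.symm y)) w - 1) ^ j) v ∈ W at hj
    -- The differential of `T` is the identity on `W` and is compared modulo `W` with that of the
    -- fixed group element `τ w`, which is unipotent there by conjugation.
    refine isNilpotent_sub_one_of_quotient (fun v hv => ?_) hYW (fun v => ?_) hj
    · exact fderiv_apply_of_eq_on_kernel hTs hfw hQw ((hQW v).2 hv)
    -- By the chain rule the two differentials differ by the term from varying the group element.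
    -- This term is tangent to an orbit of a point of the stable set `Z`, hence lies in `W`.
    · have hAd := hA.differentiable (by simp) (β w, w)
      have e1 : fderiv ℝ T w v = fderiv ℝ A (β w, w) (fderiv ℝ β w v, v) := by
        have h2 : HasFDerivAt (fun y => (β y, y)) ((fderiv ℝ β w).prod (.id ℝ (Eu m))) w :=
          ((hβ.differentiable (by simp)) w).hasFDerivAt.prodMk (hasFDerivAt_id w)
        have h3 : HasFDerivAt T _ w := HasFDerivAt.comp (f := fun y => (β y, y)) w hAd.hasFDerivAt h2
        exact congrArg (fun L : Eu m →L[ℝ] Eu m => L v) h3.fderiv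
      have e2 : (fun y => A (β w, y)) =ᶠ[𝓝 w] fun y => e (τ w • e.symm y) := by
        have hc : Continuous (fun y => (β w, y) : Eu m → Eu d × Eu m) := by fun_prop
        filter_upwards [(hc.tendsto w).eventually hAw] with y hy
        rw [hy, hκb]
      rw [e1, fderiv_prod_apply hAd, e2.fderiv_eq, add_sub_cancel_right]
      have hc : Continuous (fun b => (b, w) : Eu d → Eu d × Eu m) := by fun_prop
      refine fderiv_mem (V := ⊤) (hAd.comp (β w) (hasFDerivAt_prodMk_left (β w) w).differentiableAt)
        ?_ trivial
      have hbt : β w ∈ κ.target := by rw [hb]; exact κ.map_source hw.2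
      have hcs : ContinuousAt (fun b => κ.symm b • e.symm w) (β w) :=
        (κ.continuousAt_symm hbt).smul continuousAt_const
      filter_upwards [(hc.tendsto (β w)).eventually hAw, hcs.preimage_mem_nhds
        (e.open_source.mem_nhds (by rw [hκb, hτfix w hw.1 hwW]; exact e.map_target hwt))]
        with b hb1 hb2 _
      change A (b, w) ∈ W
      rw [hb1]
      refine (he.2 _ hb2).1 (hZ _ _ ?_)
      rw [he.2 _ (e.map_target hwt), e.right_inv hwt]
      exact hwW
  have hdetT : (fderiv ℝ T y₀).det ≠ 0 := by
    rw [det_eq_one_of_isNilpotent (hunip.self_of_nhds ((hQW _).2 hy₀W))]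
    exact one_ne_zero
  have hinv : UnipotentInvariance f P Q T (fun y => χ' (β y)) y₀ :=
    { add_eq := hPQ
      idem := hPP
      base := (hQW _).2 hy₀W
      smooth := hTs
      smooth_mul := hχ'.comp hβ
      fixes := hfixes
      unipotent := hunip
      ne_one := by
        simp only [hβ0, hχχ.eq_of_nhds, hκb₀]
        intro hc
        exact (hφS z₀ hzS).2 (Units.ext hc)
      transform := hle'.transform_graph hA hχ' hA0 hdet hR hfo hβ hβ0 hdetT }
  refine hinv.eq_zero hR hfo fun ψ hψ hψs hQψ => ?_
  refine hf.eq_zero_of_tsupport he.1 hus hψ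
    ((isCompact_closedBall y₀ R).of_isClosed_subset (isClosed_tsupport _) hψs) (hψs.trans hRU)
    fun y hy hyZ => hQψ y hy ?_
  have hyt := (hRU (hψs hy)).1
  rw [he.2 _ (e.map_target hyt), e.right_inv hyt] at hyZ
  exact (hQW y).2 hyZ

theorem exists_eq_zero_near_of_notMem {U : Opens M} {u : Module.Dual ℂ (testDensity m U)} {Z : Set M}
    (hu : IsSupportedIn u Z) (hZ : ∃ C : Set M, IsClosed C ∧ Z ⊆ C ∧ (U : Set M) ∩ C ⊆ Z) {z : M}
    (hzU : z ∈ U) (hz : z ∉ Z) : ∃ V : Set M, IsOpen V ∧ z ∈ V ∧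
      ∀ ρ : testDensity m U, tsupport (ρ : M → ℂ) ⊆ V → u ρ = 0 := by
  obtain ⟨C, hC, hZC, hCZ⟩ := hZ
  exact ⟨Cᶜ, hC.isOpen_compl, fun h => hz (hCZ ⟨hzU, h⟩), fun ρ hρ =>
    hu ρ (Set.disjoint_left.2 fun x hx hxZ => hρ hx (hZC hxZ))⟩

theorem IsChartFunctional.eq_zero_of_ball {U : Opens M} {u : Module.Dual ℂ (testDensity m U)}
    {e : OpenPartialHomeomorph M (Eu m)} (he : e ∈ IsManifold.maximalAtlas (𝓡 m) ∞ M) {z : M}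
    (hz : z ∈ e.source) {f : (Eu m → ℂ) →ₗ[ℂ] ℂ} (hf : IsChartFunctional e u f)
    (h : ∃ r > 0, ∀ ψ : Eu m → ℂ, ContDiff ℝ ∞ ψ → tsupport ψ ⊆ Metric.ball (e z) r → f ψ = 0) :
    ∃ V : Set M, IsOpen V ∧ z ∈ V ∧
      ∀ ρ : testDensity m U, tsupport (ρ : M → ℂ) ⊆ V → u ρ = 0 := by
  obtain ⟨r, hr, h0⟩ := h
  refine ⟨e.source ∩ e ⁻¹' Metric.ball (e z) r, e.isOpen_inter_preimage Metric.isOpen_ball,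
    ⟨hz, Metric.mem_ball_self hr⟩, fun ρ hρ => ?_⟩
  obtain ⟨ψ, hψ, -, hψs, hl, -⟩ := exists_liftDensity_eq he ρ.2 (hρ.trans inter_subset_left)
  have hmem : liftDensity e ψ ∈ testDensity m U := by rw [hl]; exact ρ.2
  have e1 : ρ = ⟨_, hmem⟩ := Subtype.ext hl.symm
  rw [e1, ← hf ψ hmem]
  refine h0 ψ hψ (hψs.trans ?_)
  rintro - ⟨x, hx, rfl⟩
  exact (hρ hx).2

/-- There are no nonzero `χ`-equivariant generalized functions supported in a unipotently
`χ`-incompatible submanifold. Continuity of `χ` is not needed: near a point where `u` is nonzero,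
`χ h` is a quotient of values of `u` on smooth families of densities, so `χ` is smooth near the
group elements that matter. -/
theorem equivariantSupported_eq_bot [SecondCountableTopology M] {χ : H →* ℂˣ} {Z : Set M}
    (hZm : IsSubmanifold m Z) (hZ : IsStable H Z) (hUI : UnipotentlyIncompatible d m χ Z)
    {U : Opens M} (hZU : ∃ C : Set M, IsClosed C ∧ Z = (U : Set M) ∩ C) :
    equivariantSupported m χ U Z = ⊥ := by
  obtain ⟨C, hC, hZC⟩ := hZU
  refine (Submodule.eq_bot_iff _).2 fun u hu => eq_zero_of_locally fun z hzU => ?_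
  by_cases hz : z ∈ Z
  · obtain ⟨e, he, hze, W, hW⟩ := hZm z hz
    obtain ⟨f, hf⟩ := exists_isChartFunctional e u
    exact hf.eq_zero_of_ball he hze (hUI.eq_zero_near hZ hu ⟨he, hW⟩ hze hz hzU hf)
  · exact exists_eq_zero_near_of_notMem hu.2.1 ⟨C, hC, hZC ▸ inter_subset_right, hZC ▸ subset_rfl⟩ hzU hz

end PartOne


/-! ### Differential operators of order two on `ℝ^m` and their transposes -/

section Transpose

variable {m : ℕ}

theorem contDiff_pi_pow {φ : Eu m → ℂ} (hφ : ContDiff ℝ ∞ φ) (k : ℕ) : ContDiff ℝ ∞ (φ ^ k) :=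
  hφ.pow k

theorem contDiff_pi_smul {φ : Eu m → ℂ} (hφ : ContDiff ℝ ∞ φ) (c : ℂ) : ContDiff ℝ ∞ (c • φ) :=
  hφ.const_smul c

theorem contDiff_pi_sum {ι : Type*} (t : Finset ι) {φ : ι → Eu m → ℂ}
    (hφ : ∀ i, ContDiff ℝ ∞ (φ i)) : ContDiff ℝ ∞ (∑ i ∈ t, φ i) := by
  have : ∑ i ∈ t, φ i = fun y => ∑ i ∈ t, φ i y := by
    funext y; rw [Finset.sum_apply]
  rw [this]
  exact ContDiff.sum fun i _ => hφ i

/-- The `i`-th partial derivative. -/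
noncomputable def pd (i : Fin m) (φ : Eu m → ℂ) (y : Eu m) : ℂ :=
  fderiv ℝ φ y (EuclideanSpace.single i 1)

theorem ContDiff.pd {φ : Eu m → ℂ} (hφ : ContDiff ℝ ∞ φ) (i : Fin m) : ContDiff ℝ ∞ (pd i φ) :=
  (hφ.fderiv_right (m := ∞) (by simp)).clm_apply contDiff_const

theorem pd_mul {φ ψ : Eu m → ℂ} (hφ : ContDiff ℝ ∞ φ) (hψ : ContDiff ℝ ∞ ψ) (i : Fin m) :
    pd i (φ * ψ) = φ * pd i ψ + ψ * pd i φ := by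
  funext y
  simp only [pd, fderiv_mul (hφ.differentiable (by simp) y) (hψ.differentiable (by simp) y)]
  rfl

theorem pd_add {φ ψ : Eu m → ℂ} (hφ : ContDiff ℝ ∞ φ) (hψ : ContDiff ℝ ∞ ψ) (i : Fin m) :
    pd i (φ + ψ) = pd i φ + pd i ψ := by
  funext y
  simp only [pd, fderiv_add (hφ.differentiable (by simp) y) (hψ.differentiable (by simp) y)]
  rfl

theorem pd_pow {φ : Eu m → ℂ} (hφ : ContDiff ℝ ∞ φ) (i : Fin m) (k : ℕ) :
    pd i (φ ^ (k + 1)) = ((k : ℂ) + 1) • (φ ^ k * pd i φ) := by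
  induction k with
  | zero => simp
  | succ k ih =>
    rw [pow_succ, pd_mul (contDiff_pi_pow hφ _) hφ, ih]
    funext y
    simp only [Pi.add_apply, Pi.mul_apply, Pi.pow_apply, Pi.smul_apply, smul_eq_mul]
    push_cast
    ring

theorem support_pd_subset {φ : Eu m → ℂ} (i : Fin m) {S : Set (Eu m)} (hS : IsClosed S)
    (h : ∀ y ∉ S, φ y = 0) : ∀ y ∉ S, pd i φ y = 0 := by
  intro y hy
  have h1 : φ =ᶠ[𝓝 y] fun _ => 0 := by
    filter_upwards [hS.isOpen_compl.mem_nhds hy] with w hw using h w hw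
  rw [pd, h1.fderiv_eq]
  simp

theorem integral_mul_pd {φ ψ : Eu m → ℂ} (hφ : ContDiff ℝ ∞ φ) (hψ : ContDiff ℝ ∞ ψ)
    (hc : HasCompactSupport ψ) (i : Fin m) :
    ∫ y, pd i φ y * ψ y = - ∫ y, φ y * pd i ψ y := by
  have h1 : HasCompactSupport (pd i ψ) := hc.fderiv_apply ℝ _
  rw [← neg_eq_iff_eq_neg]
  refine (integral_mul_fderiv_eq_neg_fderiv_mul_of_integrable ?_ ?_ ?_
    (fun x _ => hφ.differentiable (by simp) x) fun x _ => hψ.differentiable (by simp) x).symm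
  · exact (((hφ.pd i).continuous.mul hψ.continuous)).integrable_of_hasCompactSupport hc.mul_left
  · exact ((hφ.continuous.mul (hψ.pd i).continuous)).integrable_of_hasCompactSupport h1.mul_left
  · exact (hφ.continuous.mul hψ.continuous).integrable_of_hasCompactSupport hc.mul_left

/-- The coefficients of a differential operator of order two. -/
abbrev Coeff (m : ℕ) : Type := (j : ℕ) → (Fin j → Fin m) → Eu m → ℂ

/-- The differential operator of order two with given coefficients. -/
noncomputable def applyCoeff (a : Coeff m) (G : Eu m → ℂ) (y : Eu m) : ℂ :=
  ∑ j ∈ Finset.range (2 + 1), ∑ i : Fin j → Fin m,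
    a j i y * iteratedFDeriv ℝ j G y (fun l => EuclideanSpace.single (i l) (1 : ℝ))

/-- The transpose of the differential operator of order two with given coefficients. -/
noncomputable def transposeCoeff (a : Coeff m) (ψ : Eu m → ℂ) : Eu m → ℂ :=
  ∑ i, a 0 i * ψ - ∑ i, pd (i 0) (a 1 i * ψ) + ∑ i, pd (i 1) (pd (i 0) (a 2 i * ψ))

theorem applyCoeff_eq (a : Coeff m) {G : Eu m → ℂ} (hG : ContDiff ℝ ∞ G) (y : Eu m) :
    applyCoeff a G y = ∑ i, a 0 i y * G y + ∑ i, a 1 i y * pd (i 0) G y +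
      ∑ i, a 2 i y * pd (i 0) (pd (i 1) G) y := by
  have h2 : ∀ i : Fin 2 → Fin m, iteratedFDeriv ℝ 2 G y (fun l => EuclideanSpace.single (i l) (1 : ℝ)) =
      pd (i 0) (pd (i 1) G) y := by
    intro i
    rw [iteratedFDeriv_two_apply]
    have hd := (hG.fderiv_right (m := ∞) (by simp)).differentiable (by simp) y
    have h3 : HasFDerivAt (pd (i 1) G) _ y :=
      hd.hasFDerivAt.clm_apply (hasFDerivAt_const (EuclideanSpace.single (i 1) (1 : ℝ)) y)
    rw [pd, h3.fderiv]
    simp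
  rw [applyCoeff, Finset.sum_range_succ, Finset.sum_range_succ, Finset.sum_range_one]
  congr 1
  · congr 1
    refine Finset.sum_congr rfl fun i _ => ?_
    rw [iteratedFDeriv_one_apply, pd]
  · exact Finset.sum_congr rfl fun i _ => by rw [h2]

theorem ContDiff.transposeCoeff {a : Coeff m} (ha : ∀ j i, ContDiff ℝ ∞ (a j i)) {ψ : Eu m → ℂ}
    (hψ : ContDiff ℝ ∞ ψ) : ContDiff ℝ ∞ (transposeCoeff a ψ) := by
  have h (j : ℕ) (i : Fin j → Fin m) : ContDiff ℝ ∞ (a j i * ψ) := (ha j i).mul hψ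
  refine ContDiff.add (ContDiff.sub ?_ ?_) ?_
  · exact contDiff_pi_sum _ fun i => h 0 i
  · exact contDiff_pi_sum _ fun i => ContDiff.pd (h 1 i) _
  · exact contDiff_pi_sum _ fun i => ContDiff.pd (ContDiff.pd (h 2 i) _) _

theorem transposeCoeff_eq_zero {a : Coeff m} {ψ : Eu m → ℂ} {S : Set (Eu m)} (hS : IsClosed S)
    (h : ∀ y ∉ S, ψ y = 0) : ∀ y ∉ S, transposeCoeff a ψ y = 0 := by
  intro y hy
  have h1 (j : ℕ) (i : Fin j → Fin m) : ∀ y ∉ S, (a j i * ψ) y = 0 := fun y hy => by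
    simp [h y hy]
  simp only [transposeCoeff, Pi.add_apply, Pi.sub_apply, Finset.sum_apply]
  rw [Finset.sum_eq_zero fun i _ => h1 0 i y hy,
    Finset.sum_eq_zero fun i _ => support_pd_subset (i 0) hS (h1 1 i) y hy,
    Finset.sum_eq_zero fun i _ => support_pd_subset (i 1) hS
      (support_pd_subset (i 0) hS (h1 2 i)) y hy]
  simp

/-- One integration by parts for the first-order terms and two for the second-order terms; compact
support of `ψ` makes all pieces integrable without boundary terms. -/
theorem integral_applyCoeff_mul {a : Coeff m} (ha : ∀ j i, ContDiff ℝ ∞ (a j i)) {G ψ : Eu m → ℂ}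
    (hG : ContDiff ℝ ∞ G) (hψ : ContDiff ℝ ∞ ψ) (hc : HasCompactSupport ψ) :
    ∫ y, applyCoeff a G y * ψ y = ∫ y, G y * transposeCoeff a ψ y := by
  have h (j : ℕ) (i : Fin j → Fin m) : ContDiff ℝ ∞ (a j i * ψ) := (ha j i).mul hψ
  have hcs (j : ℕ) (i : Fin j → Fin m) : HasCompactSupport (a j i * ψ) := hc.mul_left
  have hcp {φ : Eu m → ℂ} (hφ : HasCompactSupport φ) (i : Fin m) : HasCompactSupport (pd i φ) :=
    hφ.fderiv_apply ℝ _
  have hint {φ θ : Eu m → ℂ} (hφ : ContDiff ℝ ∞ φ) (hθ : ContDiff ℝ ∞ θ)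
      (hθc : HasCompactSupport θ) : Integrable (fun y => φ y * θ y) :=
    (hφ.continuous.mul hθ.continuous).integrable_of_hasCompactSupport hθc.mul_left
  have e1 : (fun y => applyCoeff a G y * ψ y) = fun y => ∑ i, G y * (a 0 i * ψ) y +
      ∑ i, pd (i 0) G y * (a 1 i * ψ) y + ∑ i, pd (i 0) (pd (i 1) G) y * (a 2 i * ψ) y := by
    funext y
    rw [applyCoeff_eq a hG]
    simp only [add_mul, Finset.sum_mul, Pi.mul_apply]
    congr 1
    · congr 1
      · exact Finset.sum_congr rfl fun i _ => by ring
      · exact Finset.sum_congr rfl fun i _ => by ring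
    · exact Finset.sum_congr rfl fun i _ => by ring
  have e2 : (fun y => G y * transposeCoeff a ψ y) = fun y => ∑ i, G y * (a 0 i * ψ) y -
      ∑ i, G y * pd (i 0) (a 1 i * ψ) y + ∑ i, G y * pd (i 1) (pd (i 0) (a 2 i * ψ)) y := by
    funext y
    simp only [transposeCoeff, Pi.add_apply, Pi.sub_apply, Finset.sum_apply, mul_add, mul_sub,
      Finset.mul_sum]
  have i0 (i : Fin 0 → Fin m) : Integrable (fun y => G y * (a 0 i * ψ) y) := hint hG (h 0 i) (hcs 0 i)
  have i1 (i : Fin 1 → Fin m) : Integrable (fun y => pd (i 0) G y * (a 1 i * ψ) y) :=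
    hint (hG.pd _) (h 1 i) (hcs 1 i)
  have i1' (i : Fin 1 → Fin m) : Integrable (fun y => G y * pd (i 0) (a 1 i * ψ) y) :=
    hint hG ((h 1 i).pd _) (hcp (hcs 1 i) _)
  have i2 (i : Fin 2 → Fin m) : Integrable (fun y => pd (i 0) (pd (i 1) G) y * (a 2 i * ψ) y) :=
    hint ((hG.pd _).pd _) (h 2 i) (hcs 2 i)
  have i2' (i : Fin 2 → Fin m) : Integrable (fun y => G y * pd (i 1) (pd (i 0) (a 2 i * ψ)) y) :=
    hint hG (((h 2 i).pd _).pd _) (hcp (hcp (hcs 2 i) _) _)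
  have hadd {A B C : Eu m → ℂ} (hA : Integrable A) (hB : Integrable B) (hC : Integrable C) :
      ∫ y, (A y + B y + C y) = (∫ y, A y) + (∫ y, B y) + ∫ y, C y := by
    rw [integral_add (f := fun y => A y + B y) (hA.add hB) hC, integral_add hA hB]
  have hsub {A B C : Eu m → ℂ} (hA : Integrable A) (hB : Integrable B) (hC : Integrable C) :
      ∫ y, (A y - B y + C y) = (∫ y, A y) - (∫ y, B y) + ∫ y, C y := by
    rw [integral_add (f := fun y => A y - B y) (hA.sub hB) hC, integral_sub hA hB]
  rw [e1, e2, hadd (integrable_finsetSum _ fun i _ => i0 i) (integrable_finsetSum _ fun i _ => i1 i)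
      (integrable_finsetSum _ fun i _ => i2 i),
    hsub (integrable_finsetSum _ fun i _ => i0 i) (integrable_finsetSum _ fun i _ => i1' i)
      (integrable_finsetSum _ fun i _ => i2' i),
    integral_finsetSum _ fun i _ => i1 i, integral_finsetSum _ fun i _ => i1' i,
    integral_finsetSum _ fun i _ => i2 i, integral_finsetSum _ fun i _ => i2' i, sub_eq_add_neg,
    ← Finset.sum_neg_distrib]
  congr 1
  · congr 1
    exact Finset.sum_congr rfl fun i _ => integral_mul_pd hG (h 1 i) (hcs 1 i) _
  · refine Finset.sum_congr rfl fun i _ => ?_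
    rw [integral_mul_pd (hG.pd _) (h 2 i) (hcs 2 i),
      integral_mul_pd hG ((h 2 i).pd _) (hcp (hcs 2 i) _), neg_neg]

/-- `Θ = F ^ k * (s + F * r)` with `r` smooth and supported in `S`. -/
def HasLeadingTerm (F : Eu m → ℂ) (k : ℕ) (S : Set (Eu m)) (s Θ : Eu m → ℂ) : Prop :=
  ∃ r : Eu m → ℂ, ContDiff ℝ ∞ r ∧ (∀ y ∉ S, r y = 0) ∧ Θ = F ^ k * (s + F * r)

theorem HasLeadingTerm.add {F s s' Θ Θ' : Eu m → ℂ} {k : ℕ} {S : Set (Eu m)}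
    (h : HasLeadingTerm F k S s Θ) (h' : HasLeadingTerm F k S s' Θ') :
    HasLeadingTerm F k S (s + s') (Θ + Θ') := by
  obtain ⟨r, hr, hrS, rfl⟩ := h
  obtain ⟨r', hr', hrS', rfl⟩ := h'
  exact ⟨r + r', hr.add hr', fun y hy => by simp [hrS y hy, hrS' y hy], by ring⟩

theorem HasLeadingTerm.neg {F s Θ : Eu m → ℂ} {k : ℕ} {S : Set (Eu m)}
    (h : HasLeadingTerm F k S s Θ) : HasLeadingTerm F k S (-s) (-Θ) := by
  obtain ⟨r, hr, hrS, rfl⟩ := h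
  exact ⟨-r, hr.neg, fun y hy => by simp [hrS y hy], by ring⟩

theorem HasLeadingTerm.sum {F : Eu m → ℂ} {k : ℕ} {S : Set (Eu m)} {ι : Type*} (t : Finset ι)
    {s Θ : ι → Eu m → ℂ} (h : ∀ i ∈ t, HasLeadingTerm F k S (s i) (Θ i)) :
    HasLeadingTerm F k S (∑ i ∈ t, s i) (∑ i ∈ t, Θ i) := by
  classical
  induction t using Finset.induction_on with
  | empty => exact ⟨0, contDiff_const, fun _ _ => rfl, by simp⟩
  | insert i t hi ih =>
    rw [Finset.sum_insert hi, Finset.sum_insert hi]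
    exact (h i (Finset.mem_insert_self _ _)).add (ih fun j hj => h j (Finset.mem_insert_of_mem hj))

/-- Only when both derivatives of a second-order term hit the power `F^(k+2)` does the exponent drop
to `k`, with factor `(k+2)(k+1)`. Every other term retains `F^(k+1)`. -/
theorem hasLeadingTerm_transposeCoeff {a : Coeff m} (ha : ∀ j i, ContDiff ℝ ∞ (a j i))
    {F ρ : Eu m → ℂ} (hF : ContDiff ℝ ∞ F) (hρ : ContDiff ℝ ∞ ρ) {S : Set (Eu m)} (hS : IsClosed S)
    (hρS : ∀ y ∉ S, ρ y = 0) (k : ℕ) :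
    HasLeadingTerm F k S
      ((((k : ℂ) + 2) * ((k : ℂ) + 1)) • ((∑ i : Fin 2 → Fin m, a 2 i * pd (i 0) F * pd (i 1) F) * ρ))
      (transposeCoeff a (F ^ (k + 2) * ρ)) := by
  have h (j : ℕ) (i : Fin j → Fin m) : ContDiff ℝ ∞ (a j i * ρ) := (ha j i).mul hρ
  have hz (j : ℕ) (i : Fin j → Fin m) : ∀ y ∉ S, (a j i * ρ) y = 0 := fun y hy => by simp [hρS y hy]
  have h0 : ∀ i, HasLeadingTerm F k S 0 (a 0 i * (F ^ (k + 2) * ρ)) := fun i =>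
    ⟨F * (a 0 i * ρ), hF.mul (h 0 i), fun y hy => by simp [hρS y hy], by ring⟩
  have hpd (b : Eu m → ℂ) (hb : ContDiff ℝ ∞ b) (l : Fin m) : pd l (F ^ (k + 2) * b) =
      F ^ (k + 1) * (F * pd l b + ((k : ℂ) + 2) • (pd l F * b)) := by
    rw [pd_mul (contDiff_pi_pow hF _) hb, pd_pow hF]
    funext y
    simp only [Pi.add_apply, Pi.mul_apply, Pi.pow_apply, Pi.smul_apply, smul_eq_mul]
    push_cast
    ring
  have h1 : ∀ i : Fin 1 → Fin m, HasLeadingTerm F k S 0 (pd (i 0) (a 1 i * (F ^ (k + 2) * ρ))) := by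
    intro i
    rw [mul_left_comm, hpd _ (h 1 i)]
    refine ⟨F * pd (i 0) (a 1 i * ρ) + ((k : ℂ) + 2) • (pd (i 0) F * (a 1 i * ρ)),
      (hF.mul ((h 1 i).pd _)).add (contDiff_pi_smul ((hF.pd _).mul (h 1 i)) _), fun y hy => ?_, by ring⟩
    simp [hρS y hy, support_pd_subset (i 0) hS (hz 1 i) y hy]
  have h2 : ∀ i : Fin 2 → Fin m, HasLeadingTerm F k S
      ((((k : ℂ) + 2) * ((k : ℂ) + 1)) • (a 2 i * pd (i 0) F * pd (i 1) F * ρ))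
      (pd (i 1) (pd (i 0) (a 2 i * (F ^ (k + 2) * ρ)))) := by
    intro i
    set b := a 2 i * ρ with hb
    have hbs : ContDiff ℝ ∞ b := h 2 i
    set p := pd (i 0) b with hp
    have hps : ContDiff ℝ ∞ p := hbs.pd _
    set c := pd (i 0) F * b with hc
    have hcs : ContDiff ℝ ∞ c := (hF.pd _).mul hbs
    have hzp : ∀ y ∉ S, p y = 0 := support_pd_subset (i 0) hS (hz 2 i)
    have hzc : ∀ y ∉ S, c y = 0 := fun y hy => by
      change pd (i 0) F y * b y = 0
      rw [show b y = 0 from hz 2 i y hy, mul_zero]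
    have hcs' : ContDiff ℝ ∞ (((k : ℂ) + 2) • c) := contDiff_pi_smul hcs _
    have e1 : pd (i 1) (((k : ℂ) + 2) • c) = ((k : ℂ) + 2) • pd (i 1) c := by
      funext y
      simp only [pd, fderiv_const_smul (hcs.differentiable (by simp) y)]
      rfl
    have hFp : ContDiff ℝ ∞ (F * p) := hF.mul hps
    have hFpc : ContDiff ℝ ∞ (F * p + ((k : ℂ) + 2) • c) := hFp.add hcs'
    rw [mul_left_comm, ← hb, hpd _ hbs, ← hp, ← hc, pd_mul (contDiff_pi_pow hF _) hFpc,
      pd_add hFp hcs', pd_mul hF hps, e1, pd_pow hF]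
    refine ⟨F * pd (i 1) p + p * pd (i 1) F + ((k : ℂ) + 2) • pd (i 1) c +
      ((k : ℂ) + 1) • (pd (i 1) F * p), ?_, fun y hy => ?_, ?_⟩
    · exact (((hF.mul (hps.pd _)).add (hps.mul (hF.pd _))).add (contDiff_pi_smul (hcs.pd _) _)).add
        (contDiff_pi_smul ((hF.pd _).mul hps) _)
    · simp [hzp y hy, support_pd_subset (i 1) hS hzp y hy, support_pd_subset (i 1) hS hzc y hy]
    · funext y
      simp only [Pi.add_apply, Pi.mul_apply, Pi.pow_apply, Pi.smul_apply, smul_eq_mul, hc, hb]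
      ring
  have := ((HasLeadingTerm.sum Finset.univ fun i _ => h0 i).add
    (HasLeadingTerm.sum Finset.univ fun i _ => h1 i).neg).add
    (HasLeadingTerm.sum Finset.univ fun i _ => h2 i)
  rw [transposeCoeff, sub_eq_add_neg]
  convert this using 1
  simp only [Finset.sum_const_zero, neg_zero, zero_add, Finset.sum_mul, Finset.smul_sum]

/-- A functional of finite order, supported on the zero set of `F`, which is annihilated by a
differential operator of order two for which the zero set of `F` is not characteristic, vanishes. -/
theorem FiniteOrderOn.eq_zero_of_transposeCoeff {f : (Eu m → ℂ) →ₗ[ℂ] ℂ} {y₀ : Eu m} {R : ℝ}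
    (hR : 0 < R) (hf : FiniteOrderOn f (Metric.closedBall y₀ R)) {F : Eu m → ℝ}
    (hF : ContDiff ℝ ∞ F)
    (hs : ∀ ψ : Eu m → ℂ, ContDiff ℝ ∞ ψ → tsupport ψ ⊆ Metric.closedBall y₀ R →
      (∀ y ∈ tsupport ψ, F y ≠ 0) → f ψ = 0)
    {a : Coeff m} (ha : ∀ j i, ContDiff ℝ ∞ (a j i))
    (hD : ∃ r > 0, ∀ ψ : Eu m → ℂ, ContDiff ℝ ∞ ψ → tsupport ψ ⊆ Metric.ball y₀ r →
      f (transposeCoeff a ψ) = 0)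
    (hq : ∑ i : Fin 2 → Fin m, a 2 i y₀ * pd (i 0) (fun y => (F y : ℂ)) y₀ *
      pd (i 1) (fun y => (F y : ℂ)) y₀ ≠ 0) :
    ∃ r > 0, ∀ ψ : Eu m → ℂ, ContDiff ℝ ∞ ψ → tsupport ψ ⊆ Metric.ball y₀ r → f ψ = 0 := by
  obtain ⟨rD, hrD, hD⟩ := hD
  set Fc : Eu m → ℂ := fun y => (F y : ℂ) with hFc
  have hFcs : ContDiff ℝ ∞ Fc := Complex.ofRealCLM.contDiff.comp hF
  set q : Eu m → ℂ := ∑ i : Fin 2 → Fin m, a 2 i * pd (i 0) Fc * pd (i 1) Fc with hqdef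
  have hqs : ContDiff ℝ ∞ q := by
    exact contDiff_pi_sum _ fun i => ((ha 2 i).mul (hFcs.pd _)).mul (hFcs.pd _)
  have hq0 : q y₀ ≠ 0 := by
    rw [hqdef, Finset.sum_apply]
    exact hq
  have hqo : IsOpen {y | q y ≠ 0} := isOpen_ne_fun hqs.continuous continuous_const
  obtain ⟨rq, hrq, hqb⟩ := Metric.isOpen_iff.1 hqo y₀ hq0
  obtain ⟨N, hN⟩ := hf.exists_kills (isCompact_closedBall y₀ R) hF hs
  set r := min rD (min rq R) with hr
  have hr0 : 0 < r := by positivity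
  -- Descending induction on the exponent `k`, starting at `N + 1` where finite order suffices. The
  -- radius stays fixed because the remainders are supported in the support of `ρ`.
  have key : ∀ n k : ℕ, n + k = N + 1 → ∀ ρ : Eu m → ℂ, ContDiff ℝ ∞ ρ →
      tsupport ρ ⊆ Metric.ball y₀ r → f (Fc ^ k * ρ) = 0 := by
    intro n
    induction n with
    | zero =>
      intro k hk ρ hρ hρs
      have hk' : k = N + 1 := by omega
      refine hN (fun p => (p.2 : ℂ) ^ k * ρ p.1) ?_ (fun y hy v => ?_) fun y t v => ?_
      · exact ((Complex.ofRealCLM.contDiff.comp contDiff_snd).pow k).mul (hρ.comp contDiff_fst)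
      · have : ρ y = 0 := image_eq_zero_of_notMem_tsupport fun h => hy
          (Metric.ball_subset_closedBall (Metric.ball_subset_ball
            ((min_le_right _ _).trans (min_le_right _ _)) (hρs h)))
        simp [this]
      · simp only [smul_eq_mul, Complex.ofReal_mul, hk']
        ring
    | succ n ih =>
      intro k hk ρ hρ hρs
      have hkc : ((k : ℂ) + 2) * ((k : ℂ) + 1) ≠ 0 := by
        have h1 : ((k + 2 : ℕ) : ℂ) ≠ 0 := by exact_mod_cast (by omega : k + 2 ≠ 0)
        have h2 : ((k + 1 : ℕ) : ℂ) ≠ 0 := by exact_mod_cast (by omega : k + 1 ≠ 0)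
        push_cast at h1 h2
        exact mul_ne_zero h1 h2
      -- Dividing by the symbol value `q`, nonzero on the support of `ρ`, makes the leading term of
      -- the transpose applied to `F^(k+2) ρ'` equal to `F^k ρ`.
      set ρ' : Eu m → ℂ := fun y => (((k : ℂ) + 2) * ((k : ℂ) + 1))⁻¹ * ((q y)⁻¹ * ρ y) with hρ'
      have hsq : tsupport ρ ⊆ {y | q y ≠ 0} := hρs.trans ((Metric.ball_subset_ball
        ((min_le_right _ _).trans (min_le_left _ _))).trans hqb)
      have hρz : ∀ y ∉ tsupport ρ, ρ y = 0 := fun y hy => image_eq_zero_of_notMem_tsupport hy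
      have hρs' : ContDiff ℝ ∞ ρ' := by
        refine contDiff_of_eq_zero hqo (isClosed_tsupport ρ) hsq ?_ fun y hy => by
          simp [hρ', hρz y hy]
        exact contDiffOn_const.mul ((hqs.contDiffOn.inv fun y hy => hy).mul hρ.contDiffOn)
      have hρz' : ∀ y ∉ tsupport ρ, ρ' y = 0 := fun y hy => by simp [hρ', hρz y hy]
      obtain ⟨t, ht, htz, he⟩ := hasLeadingTerm_transposeCoeff ha hFcs hρs' (isClosed_tsupport ρ) hρz' k
      have hlead : (((k : ℂ) + 2) * ((k : ℂ) + 1)) • (q * ρ') = ρ := by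
        funext y
        simp only [Pi.smul_apply, Pi.mul_apply, smul_eq_mul, hρ']
        by_cases hy : y ∈ tsupport ρ
        · have : q y ≠ 0 := hsq hy
          calc _ = ((((k : ℂ) + 2) * ((k : ℂ) + 1)) * (((k : ℂ) + 2) * ((k : ℂ) + 1))⁻¹) *
                (q y * (q y)⁻¹) * ρ y := by ring
            _ = ρ y := by rw [mul_inv_cancel₀ hkc, mul_inv_cancel₀ this, one_mul, one_mul]
        · simp [hρz y hy]
      rw [hlead, mul_add, ← mul_assoc, ← pow_succ] at he
      have hts : tsupport t ⊆ Metric.ball y₀ r :=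
        (closure_minimal (fun y (hy : t y ≠ 0) => by_contra fun h => hy (htz y h)) (isClosed_tsupport ρ)).trans hρs
      have h1 := hD (Fc ^ (k + 2) * ρ') ((hFcs.pow _).mul hρs') (by
        have : tsupport (Fc ^ (k + 2) * ρ') ⊆ tsupport ρ :=
          closure_minimal (fun y (hy : _ ≠ _) => by_contra fun h => hy (by simp [hρz' y h]))
            (isClosed_tsupport ρ)
        exact this.trans (hρs.trans (Metric.ball_subset_ball (min_le_left _ _))))
      rw [he, map_add, ih (k + 1) (by omega) t ht hts, add_zero] at h1
      exact h1
  refine ⟨r, hr0, fun ψ hψ hψs => ?_⟩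
  have := key (N + 1) 0 (by omega) ψ hψ hψs
  rwa [pow_zero, one_mul] at this

end Transpose


/-! ### Vanishing near metrically proper submanifolds -/

section LinearAlgebra

variable {V : Type*} [AddCommGroup V] [Module ℝ V] [FiniteDimensional ℝ V] (B : V →ₗ[ℝ] V →ₗ[ℝ] ℝ)

/-- The orthogonal complement of a proper nondegenerate subspace contains an anisotropic vector. -/
theorem exists_anisotropic_orthogonal (hsymm : ∀ v w, B v w = B w v) (hB : ∀ v, (∀ w, B v w = 0) → v = 0) {W : Submodule ℝ V}
    (hW : W ≠ ⊤) (hWB : ∀ v ∈ W, (∀ w ∈ W, B v w = 0) → v = 0) :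
    ∃ v, (∀ w ∈ W, B v w = 0) ∧ B v v ≠ 0 := by
  let T : W →ₗ[ℝ] Module.Dual ℝ W := (LinearMap.lcomp ℝ ℝ W.subtype).comp (B.comp W.subtype)
  have hT : Function.Injective T := by
    refine (injective_iff_map_eq_zero T).2 fun w hw => Subtype.ext (hWB w w.2 fun w' hw' => ?_)
    exact LinearMap.congr_fun hw ⟨w', hw'⟩
  have hTs : Function.Surjective T :=
    (LinearMap.injective_iff_surjective_of_finrank_eq_finrank
      (Subspace.dual_finrank_eq (K := ℝ) (V := W)).symm).1 hT
  -- Nondegeneracy on `W` identifies `W` with its dual, which yields an orthogonal projection onto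
  -- `W`.
  have hproj : ∀ x, ∃ w ∈ W, ∀ w' ∈ W, B (x - w) w' = 0 := by
    intro x
    obtain ⟨w, hw⟩ := hTs ((B x).comp W.subtype)
    refine ⟨w, w.2, fun w' hw' => ?_⟩
    have : B w w' = B x w' := LinearMap.congr_fun hw ⟨w', hw'⟩
    rw [map_sub, LinearMap.sub_apply, this, sub_self]
  by_contra! hcon
  obtain ⟨x, -, hx⟩ := SetLike.exists_of_lt (lt_top_iff_ne_top.2 hW)
  obtain ⟨w, hw, hxw⟩ := hproj x
  refine hx ?_
  have h0 : x - w = 0 := by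
    refine hB _ fun y => ?_
    obtain ⟨w', hw', hyw⟩ := hproj y
    -- Polarization: if all vectors orthogonal to `W` were isotropic, the form would vanish on the
    -- complement, and `x - w` would lie in the radical.
    have h1 : B (x - w + (y - w')) (x - w + (y - w')) = 0 := hcon _ fun z hz => by
      rw [map_add, LinearMap.add_apply, hxw z hz, hyw z hz, add_zero]
    have h2 := hcon (x - w) hxw
    have h3 := hcon (y - w') hyw
    have h4 := hsymm (y - w') (x - w)
    have h5 := hxw w' hw'
    have h6 : B (x - w) y = B (x - w) (y - w') + B (x - w) w' := by rw [← map_add, sub_add_cancel]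
    simp only [map_add, LinearMap.add_apply] at h1
    linarith
  rw [sub_eq_zero.1 h0]
  exact hw

/-- Pairing with the dual basis reads off the coordinates of `v`. It evaluates a Laplacian symbol on
the covector dual to `v`. -/
theorem sum_mul_dual_basis {m : ℕ} (b b' : Module.Basis (Fin m) ℝ V)
    (h : ∀ i j, B (b i) (b' j) = if i = j then 1 else 0) (v : V) :
    ∑ i, B v (b i) * B v (b' i) = B v v := by
  have hc : ∀ j, B v (b' j) = b.repr v j := by
    intro j
    calc B v (b' j) = B (∑ i, b.repr v i • b i) (b' j) := by rw [b.sum_repr]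
      _ = ∑ i, b.repr v i * B (b i) (b' j) := by
        simp only [map_sum, LinearMap.sum_apply, map_smul, LinearMap.smul_apply, smul_eq_mul]
      _ = b.repr v j := by simp [h]
  conv_rhs => enter [2]; rw [← b.sum_repr v]
  rw [map_sum]
  refine Finset.sum_congr rfl fun i _ => ?_
  rw [map_smul, hc, smul_eq_mul, mul_comm]

end LinearAlgebra

/-! ### Local coefficients, transposes and symbols of operators on the manifold -/

section LocalCoefficients

variable {m : ℕ} {M : Type*} [TopologicalSpace M] [ChartedSpace (Eu m) M]

theorem exists_contDiff_eqOn_ball {F : Type} [NormedAddCommGroup F] [NormedSpace ℝ F] {G : Eu m → F}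
    {O : Set (Eu m)} (hO : IsOpen O) (hG : ContDiffOn ℝ ∞ G O) {y₀ : Eu m} {r : ℝ} (hr : 0 < r)
    (hb : Metric.ball y₀ r ⊆ O) :
    ∃ G' : Eu m → F, ContDiff ℝ ∞ G' ∧ ∀ y ∈ Metric.ball y₀ (r / 2), G' y = G y := by
  obtain ⟨η, hη, h1, hs, -⟩ := exists_smooth_cutoff y₀ hr
  refine ⟨fun y => η y • G y, contDiff_of_eq_zero hO (isClosed_tsupport η) (hs.trans hb)
    (hη.contDiffOn.smul hG) fun y hy => by rw [image_eq_zero_of_notMem_tsupport hy, zero_smul],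
    fun y hy => ?_⟩
  change η y • G y = G y
  rw [h1 y hy, one_smul]

theorem applyCoeff_congr (a : Coeff m) {G G' : Eu m → ℂ} {y : Eu m} (h : G =ᶠ[𝓝 y] G') :
    applyCoeff a G y = applyCoeff a G' y := by
  simp only [applyCoeff]
  refine Finset.sum_congr rfl fun j _ => Finset.sum_congr rfl fun i _ => ?_
  rw [(h.iteratedFDeriv ℝ j).eq_of_nhds]

/-- The coefficients are smooth only on the chart target; cutting them off gives global coefficients
that agree on a smaller ball. Coefficients of order above two never occur and are set to zero. -/
theorem DiffOp.exists_coeff (D : DiffOp m M 2) (z : M) :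
    ∃ r > 0, Metric.ball (chartAt (Eu m) z z) r ⊆ (chartAt (Eu m) z).target ∧
      ∃ a : Coeff m, (∀ j i, ContDiff ℝ ∞ (a j i)) ∧
        ∀ y ∈ Metric.ball (chartAt (Eu m) z z) r, ∀ h : SmoothFun m M,
          D.toFun h ((chartAt (Eu m) z).symm y) =
            applyCoeff a (fun w => h ((chartAt (Eu m) z).symm w)) y := by
  obtain ⟨a, ha, hD⟩ := D.local_form z
  set c := chartAt (Eu m) z
  obtain ⟨r, hr, hb⟩ := Metric.isOpen_iff.1 c.open_target _ (c.map_source (mem_chart_source _ z))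
  have hex : ∀ (j : ℕ) (i : Fin j → Fin m), ∃ a' : Eu m → ℂ, ContDiff ℝ ∞ a' ∧
      (j ≤ 2 → ∀ y ∈ Metric.ball (c z) (r / 2), a' y = a j i y) := by
    intro j i
    by_cases hj : j ≤ 2
    · obtain ⟨a', ha', h⟩ := exists_contDiff_eqOn_ball c.open_target (ha j hj i) hr hb
      exact ⟨a', ha', fun _ => h⟩
    · exact ⟨0, contDiff_const, fun h => absurd h hj⟩
  choose a' ha' haa using hex
  have hb2 := Metric.ball_subset_ball (x := c z) (half_le_self hr.le)
  refine ⟨r / 2, half_pos hr, hb2.trans hb, a', ha', fun y hy h => ?_⟩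
  rw [hD h y (hb (hb2 hy)), applyCoeff]
  refine Finset.sum_congr rfl fun j hj => Finset.sum_congr rfl fun i _ => ?_
  rw [haa j i (by have := Finset.mem_range.1 hj; omega) y hy]

variable [IsManifold (𝓡 m) ∞ M]

theorem SmoothFun.contDiffOn_chart (h : SmoothFun m M) (z : M) :
    ContDiffOn ℝ ∞ (fun w => h ((chartAt (Eu m) z).symm w)) (chartAt (Eu m) z).target := by
  refine contMDiffOn_iff_contDiffOn.1 fun y hy => ContMDiffAt.contMDiffWithinAt ?_
  exact h.contMDiff.contMDiffAt.comp y
    (contMDiffAt_symm_of_mem_maximalAtlas (IsManifold.chart_mem_maximalAtlas _) hy)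

/-- Both integrals over the chart only see the support of `ψ`, where the test function may be
replaced by a globally smooth one; the identity then reduces to integration by parts on the model
space. -/
theorem DiffOp.isTranspose_liftDensity (D : DiffOp m M 2) {z : M} {r : ℝ} (hr : 0 < r)
    (hb : Metric.ball (chartAt (Eu m) z z) r ⊆ (chartAt (Eu m) z).target) {a : Coeff m}
    (ha : ∀ j i, ContDiff ℝ ∞ (a j i))
    (hD : ∀ y ∈ Metric.ball (chartAt (Eu m) z z) r, ∀ h : SmoothFun m M,
      D.toFun h ((chartAt (Eu m) z).symm y) = applyCoeff a (fun w => h ((chartAt (Eu m) z).symm w)) y)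
    {ψ : Eu m → ℂ} (hψ : ContDiff ℝ ∞ ψ)
    (hs : tsupport ψ ⊆ Metric.ball (chartAt (Eu m) z z) (r / 2)) :
    D.IsTranspose z (liftDensity (chartAt (Eu m) z) ψ)
      (liftDensity (chartAt (Eu m) z) (transposeCoeff a ψ)) := by
  intro h
  set c := chartAt (Eu m) z
  have hc : c ∈ IsManifold.maximalAtlas (𝓡 m) ∞ M := IsManifold.chart_mem_maximalAtlas _
  obtain ⟨G, hG, hGe⟩ := exists_contDiff_eqOn_ball c.open_target (h.contDiffOn_chart z) hr hb
  have hz : ∀ y ∉ tsupport ψ, ψ y = 0 := fun y hy => image_eq_zero_of_notMem_tsupport hy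
  have hz' := transposeCoeff_eq_zero (a := a) (isClosed_tsupport ψ) hz
  have hb2 := Metric.ball_subset_ball (x := c z) (half_le_self hr.le)
  have hst : tsupport ψ ⊆ c.target := hs.trans (hb2.trans hb)
  have e1 : integralInChart m z (D.toFun h) (liftDensity c ψ) = ∫ y, applyCoeff a G y * ψ y := by
    rw [← setIntegral_eq_integral_of_forall_compl_eq_zero (s := c.target) fun y hy => by
      rw [hz y fun h => hy (hst h), mul_zero]]
    refine setIntegral_congr_fun c.open_target.measurableSet fun y hy => ?_
    change D.toFun h (c.symm y) * chartDensity m c (liftDensity c ψ) y = applyCoeff a G y * ψ y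
    rw [chartDensity_liftDensity hc ψ hy]
    by_cases hys : y ∈ tsupport ψ
    · rw [hD y (hb2 (hs hys))]
      congr 1
      refine applyCoeff_congr a ?_
      filter_upwards [Metric.isOpen_ball.mem_nhds (hs hys)] with w hw using (hGe w hw).symm
    · rw [hz y hys, mul_zero, mul_zero]
  have e2 : integralInChart m z h (liftDensity c (transposeCoeff a ψ)) =
      ∫ y, G y * transposeCoeff a ψ y := by
    rw [← setIntegral_eq_integral_of_forall_compl_eq_zero (s := c.target) fun y hy => by
      rw [hz' y fun h => hy (hst h), mul_zero]]
    refine setIntegral_congr_fun c.open_target.measurableSet fun y hy => ?_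
    change h (c.symm y) * chartDensity m c (liftDensity c (transposeCoeff a ψ)) y =
      G y * transposeCoeff a ψ y
    rw [chartDensity_liftDensity hc _ hy]
    by_cases hys : y ∈ tsupport ψ
    · rw [hGe y (hs hys)]
    · rw [hz' y hys, mul_zero, mul_zero]
  rw [e1, e2]
  exact integral_applyCoeff_mul ha hG hψ (isCompact_tsupport_of_subset_ball hs)

/-- The principal symbol in a chart. -/
theorem DiffOp.symbol_eq (D : DiffOp m M 2) {z : M} {a : Coeff m}
    (hD : ∀ h : SmoothFun m M, D.toFun h z =
      applyCoeff a (fun w => h ((chartAt (Eu m) z).symm w)) (chartAt (Eu m) z z))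
    {h : SmoothFun m M} (hz : h z = 0) {F : Eu m → ℂ} (hF : ContDiff ℝ ∞ F)
    (hFh : (fun w => h ((chartAt (Eu m) z).symm w)) =ᶠ[𝓝 (chartAt (Eu m) z z)] F) :
    D.symbol z h = ∑ i : Fin 2 → Fin m, a 2 i (chartAt (Eu m) z z) *
      pd (i 0) F (chartAt (Eu m) z z) * pd (i 1) F (chartAt (Eu m) z z) := by
  set c := chartAt (Eu m) z
  have hF0 : F (c z) = 0 := by
    rw [← hFh.eq_of_nhds, c.left_inv (mem_chart_source _ z), hz]
  -- Since `F` vanishes at the point, the value and the first derivatives of `F * F` vanish there,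
  -- and the second derivatives are twice a product of first ones; this `2` cancels the `1 / 2!` of
  -- the symbol.
  have e1 : (fun w => devPow z h 2 (c.symm w)) =ᶠ[𝓝 (c z)] F * F := by
    filter_upwards [hFh] with w hw
    change (h (c.symm w) - h z) ^ 2 = F w * F w
    rw [hw, hz, sub_zero, sq]
  have hFF : ContDiff ℝ ∞ (F * F) := hF.mul hF
  have hFp (i : Fin m) : ContDiff ℝ ∞ (F * pd i F) := hF.mul (hF.pd i)
  rw [DiffOp.symbol, hD, applyCoeff_congr a e1, applyCoeff_eq a hFF]
  have e2 : ∀ i j : Fin m, pd i (pd j (F * F)) (c z) = 2 * (pd i F (c z) * pd j F (c z)) := by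
    intro i j
    rw [pd_mul hF hF, pd_add (hFp j) (hFp j), pd_mul hF (hF.pd j)]
    simp only [Pi.add_apply, Pi.mul_apply, hF0]
    ring
  have e3 : ∀ i : Fin m, pd i (F * F) (c z) = 0 := by
    intro i
    rw [pd_mul hF hF]
    simp [hF0]
  simp only [e2, e3, Pi.mul_apply, hF0, mul_zero, Finset.sum_const_zero, zero_add,
    Nat.factorial_two, Nat.cast_ofNat, Finset.mul_sum]
  exact Finset.sum_congr rfl fun i _ => by ring

end LocalCoefficients

/-! ### Noncharacteristic conormals of metrically proper submanifolds -/

section Metric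

theorem FiniteOrderOn.mono {E : Type} [NormedAddCommGroup E] [NormedSpace ℝ E]
    {f : (E → ℂ) →ₗ[ℂ] ℂ} {K K' : Set E} (h : FiniteOrderOn f K) (hK : K' ⊆ K) :
    FiniteOrderOn f K' := by
  obtain ⟨C, N, hb⟩ := h
  refine ⟨C, N, fun ψ hψ hs B hB hψB => hb ψ hψ (hs.trans hK) B hB fun j hj y hy => ?_⟩
  by_cases hy' : y ∈ tsupport ψ
  · exact hψB j hj y (hs hy')
  · have : iteratedFDeriv ℝ j ψ y = 0 := image_eq_zero_of_notMem_tsupport fun h =>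
      hy' (tsupport_iteratedFDeriv_subset j h)
    rw [this, norm_zero]
    exact hB

variable {m : ℕ} {M : Type*} [TopologicalSpace M] [T2Space M] [ChartedSpace (Eu m) M]
  [IsManifold (𝓡 m) ∞ M]

theorem modelDeriv_symm_comp_chart {e : OpenPartialHomeomorph M (Eu m)}
    (he : e ∈ IsManifold.maximalAtlas (𝓡 m) ∞ M) {z : M} (hz : z ∈ e.source) (v : Eu m) :
    modelDeriv m e.symm (e z) (modelDeriv m e z v) = v := by
  have h : (modelDeriv m e.symm (e z)).comp (modelDeriv m e z) = 1 := by
    rw [← modelDeriv_comp (mdifferentiableAt_chart_symm he (e.map_source hz))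
      (mdifferentiableAt_chart he hz), ← modelDeriv_id (m := m) z]
    refine modelDeriv_congr ?_
    filter_upwards [e.open_source.mem_nhds hz] with x hx using e.left_inv hx
  exact congrArg (fun L : Eu m →L[ℝ] Eu m => L v) h

/-- The normal space of a metrically proper submanifold contains a noncharacteristic conormal: there
is a local equation whose differential is dual to an anisotropic vector. -/
theorem MetricallyProper.exists_conormal {g : PseudoRiemannianMetric m M} {Z : Set M}
    (hZ : MetricallyProper g Z) {e : OpenPartialHomeomorph M (Eu m)} {W : Submodule ℝ (Eu m)}
    (he : IsAdapted e Z W) {z : M} (hz : z ∈ e.source) (hzZ : z ∈ Z) :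
    ∃ (ℓ : Eu m →L[ℝ] ℝ), (∀ w ∈ W, ℓ w = 0) ∧
      ∀ D : DiffOp m M 2, IsLaplacianType g D → ∀ h : SmoothFun m M,
        (h =ᶠ[𝓝 z] fun x => ((ℓ (e x) : ℝ) : ℂ)) → D.symbol z h ≠ 0 := by
  -- The proper nondegenerate space containing the tangent space supplies an anisotropic vector
  -- orthogonal to it; pairing with that vector, transported to the chart, is the required covector.
  obtain ⟨W', hW', hWt, hWn⟩ := hZ z hzZ
  have : FiniteDimensional ℝ (TangentSpace (𝓡 m) z) := inferInstanceAs (FiniteDimensional ℝ (Eu m))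
  let B : TangentSpace (𝓡 m) z →ₗ[ℝ] TangentSpace (𝓡 m) z →ₗ[ℝ] ℝ :=
    (ContinuousLinearMap.coeLM ℝ).comp (g.form z).toLinearMap
  obtain ⟨v, hvW, hvv⟩ := exists_anisotropic_orthogonal B (g.symm z) (g.nondegenerate z) hWt hWn
  let ℓ₀ : Eu m →L[ℝ] ℝ := g.form z v
  refine ⟨ℓ₀.comp (modelDeriv m e.symm (e z)), fun w hw => ?_, fun D hD h hh => ?_⟩
  · refine hvW _ (hW' ((he.mem_tangentOf_iff hz hzZ _).2 ?_))
    have e1 : modelDeriv m e z (modelDeriv m e.symm (e z) w) = w :=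
      modelDeriv_chart_comp_symm he.1 hz w
    exact (congrArg (· ∈ W) e1).mpr hw
  · obtain ⟨b, b', hbb, hsym⟩ := hD z
    have hd : ∀ x : TangentSpace (𝓡 m) z, differential z h x = ((B v x : ℝ) : ℂ) := by
      intro x
      let L : Eu m →L[ℝ] ℂ := Complex.ofRealCLM.comp (ℓ₀.comp (modelDeriv m e.symm (e z)))
      have h1 : mfderiv (𝓡 m) 𝓘(ℝ, ℂ) h z = mfderiv (𝓡 m) 𝓘(ℝ, ℂ) (L ∘ e) z := hh.mfderiv_eq
      have h2 := mfderiv_comp z (L.differentiableAt (x := e z)).mdifferentiableAt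
        (mdifferentiableAt_chart he.1 hz)
      rw [mfderiv_eq_fderiv, L.fderiv] at h2
      refine (congrArg (fun T : Eu m →L[ℝ] ℂ => T x) (h1.trans h2)).trans ?_
      exact congrArg (fun w : Eu m => ((ℓ₀ w : ℝ) : ℂ)) (modelDeriv_symm_comp_chart he.1 hz x)
    rw [hsym h]
    simp only [hd]
    -- The symbol at `dh` is thus `⟨v, v⟩`, which is nonzero by the choice of `v`.
    have := sum_mul_dual_basis B b b' hbb v
    rw [show ∑ i, ((B v (b i) : ℝ) : ℂ) * ((B v (b' i) : ℝ) : ℂ) =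
      ((∑ i, B v (b i) * B v (b' i) : ℝ) : ℂ) by push_cast; rfl, this]
    exact_mod_cast hvv

end Metric


/-! ### The filtration argument -/

section Filtration

variable {m : ℕ} {M : Type*} [TopologicalSpace M] [T2Space M] [ChartedSpace (Eu m) M]
  [IsManifold (𝓡 m) ∞ M]

/-- A smooth function on a chart extends to `M` after shrinking. -/
theorem exists_smoothFun_eventuallyEq (z : M) {F : Eu m → ℂ} (hF : ContDiff ℝ ∞ F) :
    ∃ h : SmoothFun m M, h =ᶠ[𝓝 z] fun x => F (chartAt (Eu m) z x) := by
  obtain ⟨η⟩ : Nonempty (SmoothBumpFunction (𝓡 m) z) := inferInstance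
  have hF' : ContMDiffOn (𝓡 m) 𝓘(ℝ, ℂ) ∞ (fun x => F (chartAt (Eu m) z x))
      (chartAt (Eu m) z).source :=
    hF.contMDiff.comp_contMDiffOn (contMDiffOn_of_mem_maximalAtlas (IsManifold.chart_mem_maximalAtlas z))
  refine ⟨⟨_, η.contMDiff_smul hF'⟩, ?_⟩
  filter_upwards [η.eventuallyEq_one] with x hx
  change η x • F (chartAt (Eu m) z x) = _
  rw [hx, Pi.one_apply, one_smul]

/-- The conormal gives a local equation on which the symbol of `D` is nonzero, so
`FiniteOrderOn.eq_zero_of_transposeCoeff` applies. Two charts are involved: `e` flattens `N` and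
provides the equation, while the preferred chart carries the coefficients and the transpose of `D`.
-/
theorem MetricallyProper.eq_zero_near {g : PseudoRiemannianMetric m M} {N : Set M}
    (hN : MetricallyProper g N) {D : DiffOp m M 2} (hL : IsLaplacianType g D) {U : Opens M}
    {u : Module.Dual ℂ (testDensity m U)} (hu : u ∈ genFun m U) (hus : IsSupportedIn u N)
    (huD : D.Maps u 0) {e : OpenPartialHomeomorph M (Eu m)} {W : Submodule ℝ (Eu m)}
    (he : IsAdapted e N W) {z : M} (hz : z ∈ e.source) (hzN : z ∈ N) (hzU : z ∈ U) :
    ∃ V : Set M, IsOpen V ∧ z ∈ V ∧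
      ∀ ρ : testDensity m U, tsupport (ρ : M → ℂ) ⊆ V → u ρ = 0 := by
  obtain ⟨ℓ, hℓW, hℓ⟩ := hN.exists_conormal he hz hzN
  obtain ⟨r, hr, hrt, a, ha, hDa⟩ := D.exists_coeff z
  set c := chartAt (Eu m) z with hcdef
  have hc : c ∈ IsManifold.maximalAtlas (𝓡 m) ∞ M := IsManifold.chart_mem_maximalAtlas _
  have hzc : z ∈ c.source := mem_chart_source _ z
  have hcz : c.symm (c z) = z := c.left_inv hzc
  have hy₀ : c z ∈ c.target := c.map_source hzc
  obtain ⟨f, hf⟩ := exists_isChartFunctional c u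
  refine hf.eq_zero_of_ball hc hzc ?_
  have hO : IsOpen (c.target ∩ c.symm ⁻¹' e.source) := isOpen_transition
  have hyO : c z ∈ c.target ∩ c.symm ⁻¹' e.source := ⟨hy₀, by
    change c.symm (c z) ∈ e.source
    rwa [hcz]⟩
  -- A defining function in the preferred chart. Its zero set only needs to contain `N` near the
  -- point, not to equal it.
  obtain ⟨F, hF, hFe⟩ := exists_contDiff_eventuallyEq (g := fun y => ℓ (e (c.symm y))) hO hyO
    (ℓ.contDiff.comp_contDiffOn (contDiffOn_transition hc he.1))
  have hFc : ContDiff ℝ ∞ (fun y => (F y : ℂ)) := Complex.ofRealCLM.contDiff.comp hF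
  obtain ⟨h, hh⟩ := exists_smoothFun_eventuallyEq z hFc
  have hhe : h =ᶠ[𝓝 z] fun x => ((ℓ (e x) : ℝ) : ℂ) := by
    filter_upwards [hh, (c.continuousAt hzc).eventually hFe, c.open_source.mem_nhds hzc]
      with x hx hFx hxc
    rw [hx]
    change ((F (c x) : ℝ) : ℂ) = _
    rw [hFx, c.left_inv hxc]
  have hhF : (fun w => h (c.symm w)) =ᶠ[𝓝 (c z)] fun y => (F y : ℂ) := by
    have hcont : Tendsto c.symm (𝓝 (c z)) (𝓝 z) := by
      have := (c.continuousAt_symm hy₀).tendsto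
      rwa [hcz] at this
    filter_upwards [hcont.eventually hh, c.open_target.mem_nhds hy₀] with w hw hwt
    rw [hw]
    change ((F (c (c.symm w)) : ℝ) : ℂ) = _
    rw [c.right_inv hwt]
  have hz0 : h z = 0 := by
    rw [hhe.eq_of_nhds, hℓW _ ((he.2 z hz).1 hzN), Complex.ofReal_zero]
  have hDz : ∀ h : SmoothFun m M, D.toFun h z = applyCoeff a (fun w => h (c.symm w)) (c z) := by
    intro h
    have := hDa (c z) (Metric.mem_ball_self hr) h
    rwa [hcz] at this
  have hq := hℓ D hL h hhe
  rw [D.symbol_eq hDz hz0 hFc hhF] at hq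
  obtain ⟨R, hR, hRU, hfo⟩ := hf.finiteOrderOn hc hu hy₀ (by rwa [hcz])
  obtain ⟨s, hs, hsb⟩ := Metric.eventually_nhds_iff_ball.1
    (Filter.Eventually.and hFe (hO.mem_nhds hyO))
  -- Half of `s` puts the closed ball inside the open ball on which `F` agrees with the equation of
  -- `N`.
  set R' := min R (s / 2)
  have hR' : 0 < R' := lt_min hR (half_pos hs)
  have hsub : Metric.closedBall (c z) R' ⊆ Metric.closedBall (c z) R :=
    Metric.closedBall_subset_closedBall (min_le_left _ _)
  have hsub' : Metric.closedBall (c z) R' ⊆ Metric.ball (c z) s :=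
    Metric.closedBall_subset_ball ((min_le_right _ _).trans_lt (half_lt_self hs))
  refine (hfo.mono hsub).eq_zero_of_transposeCoeff hR' hF ?_ ha ?_ hq
  · intro ψ hψ hψs hψF
    refine hf.eq_zero_of_tsupport hc hus hψ
      ((isCompact_closedBall _ _).of_isClosed_subset (isClosed_tsupport _) hψs)
      (hψs.trans (hsub.trans hRU)) fun y hy hyN => hψF y hy ?_
    obtain ⟨h1, h2⟩ := hsb y (hsub' (hψs hy))
    rw [h1]
    exact hℓW _ ((he.2 _ h2.2).1 hyN)
  · refine ⟨min R (r / 2), lt_min hR (half_pos hr), fun ψ hψ hψs => ?_⟩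
    have hψR : tsupport ψ ⊆ Metric.closedBall (c z) R :=
      hψs.trans ((Metric.ball_subset_ball (min_le_left _ _)).trans Metric.ball_subset_closedBall)
    have hψr : tsupport ψ ⊆ Metric.ball (c z) (r / 2) :=
      hψs.trans (Metric.ball_subset_ball (min_le_right _ _))
    have hT : tsupport (transposeCoeff a ψ) ⊆ tsupport ψ := by
      refine closure_minimal (fun y (hy : transposeCoeff a ψ y ≠ 0) => ?_) (isClosed_tsupport ψ)
      by_contra hyn
      exact hy (transposeCoeff_eq_zero (isClosed_tsupport ψ)
        (fun w hw => image_eq_zero_of_notMem_tsupport hw) y hyn)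
    have hcψ : HasCompactSupport ψ := isCompact_tsupport_of_subset_ball hψr
    have hcT : HasCompactSupport (transposeCoeff a ψ) :=
      isCompact_tsupport_of_subset_ball (hT.trans hψr)
    have ht : tsupport ψ ⊆ c.target := hψR.trans (hRU.trans inter_subset_left)
    have hm1 : liftDensity c ψ ∈ testDensity m U :=
      liftDensity_mem_testDensity hc hψ hcψ ht fun y hy => (hRU (hψR hy)).2
    have hm2 : liftDensity c (transposeCoeff a ψ) ∈ testDensity m U :=
      liftDensity_mem_testDensity hc (hψ.transposeCoeff ha) hcT (hT.trans ht)
        fun y hy => (hRU (hψR (hT hy))).2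
    have hsrc : ∀ {φ : Eu m → ℂ}, HasCompactSupport φ → tsupport φ ⊆ c.target →
        tsupport (liftDensity c φ) ⊆ c.source := by
      intro φ hφ hφt x hx
      obtain ⟨y, hy, rfl⟩ := tsupport_liftDensity_subset hφ hφt hx
      exact c.map_target (hφt hy)
    rw [hf _ hm2]
    exact (huD z ⟨_, hm1⟩ ⟨_, hm2⟩ (hsrc hcψ ht) (hsrc hcT (hT.trans ht))
      (D.isTranspose_liftDensity hr hrt ha hDa hψ hψr)).symm

variable {d : ℕ} {H : Type*} [Group H] [TopologicalSpace H] [MulAction H M]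

theorem testDensity_mono {U V : Opens M} (h : U ≤ V) : testDensity m U ≤ testDensity m V :=
  fun _ hρ => ⟨hρ.1, hρ.2.1, hρ.2.2.trans h⟩

/-- The restriction of a functional on densities to a smaller open set. -/
noncomputable def restrictDual {U V : Opens M} (h : U ≤ V) (u : Module.Dual ℂ (testDensity m V)) :
    Module.Dual ℂ (testDensity m U) :=
  u.comp (Submodule.inclusion (testDensity_mono h))

theorem restrictDual_mem_genFun {U V : Opens M} (h : U ≤ V) {u : Module.Dual ℂ (testDensity m V)}
    (hu : u ∈ genFun m V) : restrictDual h u ∈ genFun m U := by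
  intro c K hK hKt hKU
  obtain ⟨C, N, hb⟩ := hu c K hK hKt (hKU.trans h)
  exact ⟨C, N, fun ρ hρ => hb (Submodule.inclusion (testDensity_mono h) ρ) hρ⟩

theorem IsEquivariant.restrictDual {χ : H →* ℂˣ} {U V : Opens M} (h : U ≤ V)
    {u : Module.Dual ℂ (testDensity m V)} (hu : IsEquivariant χ u) :
    IsEquivariant χ (restrictDual h u) := fun k ρ ρ' e =>
  hu k (Submodule.inclusion (testDensity_mono h) ρ) (Submodule.inclusion (testDensity_mono h) ρ') e

theorem DiffOp.Maps.restrictDual {D : DiffOp m M 2} {U V : Opens M} (h : U ≤ V)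
    {u : Module.Dual ℂ (testDensity m V)} (hu : D.Maps u 0) : D.Maps (restrictDual h u) 0 :=
  fun c ρ ρ' s s' t =>
    hu c (Submodule.inclusion (testDensity_mono h) ρ) (Submodule.inclusion (testDensity_mono h) ρ')
      s s' t

theorem IsSupportedIn.restrictDual {U V : Opens M} (h : U ≤ V)
    {u : Module.Dual ℂ (testDensity m V)} {Z : Set M} (hu : IsSupportedIn u Z) :
    IsSupportedIn (restrictDual h u) (U ∩ Z) := fun ρ hρ =>
  hu (Submodule.inclusion (testDensity_mono h) ρ) (Set.disjoint_left.2 fun _ hx hxZ =>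
    Set.disjoint_left.1 hρ hx ⟨ρ.2.2.2 hx, hxZ⟩)

variable [SecondCountableTopology M] [T2Space H] [SecondCountableTopology H]
  [ChartedSpace (Eu d) H] [LieGroup (𝓡 d) ∞ H] [ContMDiffSMul (𝓡 d) (𝓡 m) ∞ H M]

/-- Induction along the filtration pushes the support of `u` into each successive step until it is
empty. -/
theorem equivariantSupportedKilled_eq_bot {χ : H →* ℂˣ} {g : PseudoRiemannianMetric m M}
    {D : DiffOp m M 2} (hL : IsLaplacianType g D) {Z : Set M} (hZc : IsClosed Z)
    (hZ : HasUChiM (d := d) χ g Z) : equivariantSupportedKilled χ ⊤ Z D = ⊥ := by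
  refine (Submodule.eq_bot_iff _).2 fun u hu => ?_
  obtain ⟨⟨hug, hus, hue⟩, huD⟩ := hu
  obtain ⟨-, -, k, F, hF0, hFk, hF⟩ := hZ
  have hclosed : ∀ i ≤ k + 1, IsClosed (F i) := by
    intro i hi
    rcases Nat.lt_succ_iff_lt_or_eq.1 (Nat.lt_succ_of_le hi) with hi | rfl
    · obtain ⟨-, -, ⟨C, hC, hFC⟩, -⟩ := hF i (Nat.lt_succ_iff.1 hi)
      exact hFC ▸ hZc.inter hC
    · exact hFk ▸ isClosed_empty
  have hstable : ∀ i ≤ k + 1, IsStable H (F i) := by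
    intro i hi
    rcases Nat.lt_succ_iff_lt_or_eq.1 (Nat.lt_succ_of_le hi) with hi | rfl
    · exact (hF i (Nat.lt_succ_iff.1 hi)).2.1
    · rw [hFk]
      exact fun _ z hz => hz.elim
  have hsupp : ∀ i ≤ k + 1, IsSupportedIn u (F i) := by
    intro i
    induction i with
    | zero => exact fun _ => hF0 ▸ hus
    | succ i ih =>
      intro hi ρ hρ
      have hik : i ≤ k := by omega
      obtain ⟨-, -, -, hsub, hcase⟩ := hF i hik
      -- On this open set the layer is relatively closed, so the restriction of `u` is supported in
      -- a submanifold. If the restriction vanishes, `u` is supported in the next step.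
      let U : Opens M := ⟨(F (i + 1))ᶜ, (hclosed _ hi).isOpen_compl⟩
      have hUi : (U : Set M) ∩ F i = F i \ F (i + 1) := by
        rw [sdiff_eq, inter_comm]; rfl
      have hle : U ≤ ⊤ := le_top
      have hu' := (ih (by omega)).restrictDual hle
      rw [hUi] at hu'
      have hN : IsStable H (F i \ F (i + 1)) := fun h z hz => ⟨hstable i (by omega) h z hz.1, fun hc =>
        hz.2 (by simpa using hstable (i + 1) hi h⁻¹ _ hc)⟩
      have hzero : EquivGenFun.restrictDual hle u = 0 := by
        rcases hcase with hUI | hMP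
        · have h0 := equivariantSupported_eq_bot hsub hN hUI (U := U)
            ⟨F i, hclosed i (by omega), hUi.symm⟩
          exact (Submodule.eq_bot_iff _).1 h0 _
            ⟨restrictDual_mem_genFun hle hug, hu', hue.restrictDual hle⟩
        · refine eq_zero_of_locally fun z hzU => ?_
          by_cases hz : z ∈ F i \ F (i + 1)
          · obtain ⟨e, he, hze, W, hW⟩ := hsub z hz
            exact hMP.eq_zero_near hL (restrictDual_mem_genFun hle hug) hu' (huD.restrictDual hle)
              ⟨he, hW⟩ hze hz hzU
          · exact exists_eq_zero_near_of_notMem hu'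
              ⟨F i, hclosed i (by omega), sdiff_subset, hUi.subset⟩ hzU hz
      have hρU : (ρ : M → ℂ) ∈ testDensity m U :=
        ⟨ρ.2.1, ρ.2.2.1, fun x hx => Set.disjoint_left.1 hρ hx⟩
      exact LinearMap.congr_fun hzero ⟨ρ, hρU⟩
  -- The last step of the filtration is empty, so every density is disjoint from it.
  refine LinearMap.ext fun ρ => hsupp (k + 1) le_rfl ρ ?_
  rw [hFk]
  exact Set.disjoint_empty _

end Filtration

end EquivGenFun

theorem mainTheorem12
    {d m : ℕ}
    {H : Type*} [Group H] [TopologicalSpace H] [T2Space H] [SecondCountableTopology H]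
    [ChartedSpace (Eu d) H] [LieGroup (𝓡 d) ∞ H]
    {M : Type*} [TopologicalSpace M] [T2Space M] [SecondCountableTopology M]
    [ChartedSpace (Eu m) M] [IsManifold (𝓡 m) ∞ M]
    [MulAction H M] [ContMDiffSMul (𝓡 d) (𝓡 m) ∞ H M]
    (χ : H →* ℂˣ) (hχ : Continuous χ) :
    (∀ Z : Set M, IsSubmanifold m Z → IsStable H Z → UnipotentlyIncompatible d m χ Z →
      ∀ U : Opens M, Z ⊆ U → (∃ C : Set M, IsClosed C ∧ Z = (U : Set M) ∩ C) →
        equivariantSupported m χ U Z = ⊥) ∧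
    (∀ (g : PseudoRiemannianMetric m M) (D : DiffOp m M 2), IsLaplacianType g D →
      ∀ Z : Set M, IsClosed Z → IsStable H Z → HasUChiM (d := d) χ g Z →
        equivariantSupportedKilled χ ⊤ Z D = ⊥) := by
  refine ⟨fun Z hZm hZ hUI U _ hZU => equivariantSupported_eq_bot hZm hZ hUI hZU, ?_⟩
  exact fun g D hL Z hZc _ hZ => equivariantSupportedKilled_eq_bot hL hZc hZ
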